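/- Let $\mathrm{GL}_n(\mathbb{C})$ be regarded as an affine variety with its Zariski topology. A (complex) linear algebraic group $G$ is a Zariski closed subgroup of some $\mathrm{GL}_n(\mathbb{C})$; it is connected if it is connected in the Zariski topology, and reductive if its only Zariski closed, connected, normal subgroup consisting of unipotent elements is the trivial one. Let $C(G)=\{(a,b)\in G\times G : ab=ba\}$, a Zariski closed subset of $G\times G$, and define the commuting probability of $G$ by $$p(G)=\frac{\dim C(G)}{2\dim G}\quad\text{if }\dim G>0,\qquad p(G)=1\quad\text{if }\dim G=0.$$ Then the following hold. (1) $\{p(G): G$ connected reductive$\}=\{p(G): G$ connected nilpotent$\}=\{p(G): G$ connected solvable$\}=\{p(G): G$ a connected linear algebraic group$\}=\mathbb{Q}\cap(1/2,1]$. (2) Every real number $\alpha\in[1/2,1]$ is a limit point (accumulation point) of each of the four sets in (1). -/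

import Mathlib

open Filter Topology Matrix

/-- The Zariski topology on the affine space `ℂ^σ`: the closed sets are the zero loci of ideals of
polynomials.  It is a plain definition, not an instance, because `σ → ℂ` already carries the
Euclidean topology. -/
abbrev zariskiTopology (σ : Type) : TopologicalSpace (σ → ℂ) :=
  TopologicalSpace.ofClosed
    {X | ∃ I : Ideal (MvPolynomial σ ℂ), X = MvPolynomial.zeroLocus ℂ I}
    ⟨⊤, by simp⟩
    (by
      intro A hA
      refine ⟨⨆ I ∈ {I : Ideal (MvPolynomial σ ℂ) | MvPolynomial.zeroLocus ℂ I ∈ A}, I, ?_⟩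
      apply Set.Subset.antisymm
      · apply MvPolynomial.le_zeroLocus_iff_le_vanishingIdeal.mpr
        refine iSup₂_le fun I hI => ?_
        exact MvPolynomial.le_zeroLocus_iff_le_vanishingIdeal.mp (Set.sInter_subset_of_mem hI)
      · intro x hx X hX
        obtain ⟨I, rfl⟩ := hA hX
        exact MvPolynomial.zeroLocus_anti_mono (le_iSup₂_of_le I hX le_rfl) hx)
    (by
      rintro _ ⟨I, rfl⟩ _ ⟨J, rfl⟩
      refine ⟨I * J, ?_⟩
      ext x
      constructor
      · rintro (h | h)
        · exact MvPolynomial.zeroLocus_anti_mono Ideal.mul_le_left h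
        · exact MvPolynomial.zeroLocus_anti_mono Ideal.mul_le_right h
      · intro h
        by_contra hcon
        rw [Set.mem_union, not_or] at hcon
        simp only [MvPolynomial.mem_zeroLocus_iff, not_forall] at hcon
        obtain ⟨⟨p, hp, hpx⟩, ⟨q, hq, hqx⟩⟩ := hcon
        have h0 := h (p * q) (Ideal.mul_mem_mul hp hq)
        rw [map_mul] at h0
        exact (mul_ne_zero hpx hqx) h0)

/-- A subset of affine space is closed for the Zariski topology. -/
def IsZariskiClosed {σ : Type} (X : Set (σ → ℂ)) : Prop :=
  @IsClosed _ (zariskiTopology σ) X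

theorem isZariskiClosed_iff {σ : Type} (X : Set (σ → ℂ)) :
    IsZariskiClosed X ↔ ∃ I : Ideal (MvPolynomial σ ℂ), X = MvPolynomial.zeroLocus ℂ I := by
  unfold IsZariskiClosed
  rw [← @isOpen_compl_iff _ _ (zariskiTopology σ)]
  change Xᶜᶜ ∈ {X | ∃ I : Ideal (MvPolynomial σ ℂ), X = MvPolynomial.zeroLocus ℂ I} ↔ _
  rw [compl_compl]
  rfl

/-- A subset of affine space is (nonempty and) connected for the Zariski topology. -/
def IsZariskiConnected {σ : Type} (X : Set (σ → ℂ)) : Prop :=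
  @IsConnected _ (zariskiTopology σ) X

/-- The dimension of a subset of affine space: the Krull dimension of the subspace topology induced
by the Zariski topology, i.e. the supremum of the lengths of chains of irreducible closed subsets. -/
noncomputable def zariskiDim {σ : Type} (X : Set (σ → ℂ)) : WithBot ℕ∞ :=
  @topologicalKrullDim X (@instTopologicalSpaceSubtype _ (· ∈ X) (zariskiTopology σ))

/-- The coordinates on the affine variety `GL_n`: the matrix entries and the inverse of the
determinant.  They identify `GL_n` with the closed subvariety `t * det x = 1` of the affine space of
dimension `n ^ 2 + 1`. -/
noncomputable def glCoords {n : ℕ} (g : GL (Fin n) ℂ) : (Fin n × Fin n) ⊕ Unit → ℂ :=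
  Sum.elim (fun ij => (g : Matrix (Fin n) (Fin n) ℂ) ij.1 ij.2)
    (fun _ => (g : Matrix (Fin n) (Fin n) ℂ).det⁻¹)

/-- The coordinates on the affine variety `GL_n × GL_n`. -/
noncomputable def glPairCoords {n : ℕ} (x : GL (Fin n) ℂ × GL (Fin n) ℂ) :
    ((Fin n × Fin n) ⊕ Unit) ⊕ ((Fin n × Fin n) ⊕ Unit) → ℂ :=
  Sum.elim (glCoords x.1) (glCoords x.2)

/-- A complex linear algebraic group: a Zariski closed subgroup of some `GL_n(ℂ)`. -/
structure LinearAlgebraicGroup where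
  /-- The size of the matrices. -/
  n : ℕ
  /-- The group of complex points. -/
  points : Subgroup (GL (Fin n) ℂ)
  isClosed : IsZariskiClosed (glCoords '' (points : Set (GL (Fin n) ℂ)))

namespace LinearAlgebraicGroup

/-- `G` is connected for the Zariski topology. -/
def IsConnected (G : LinearAlgebraicGroup) : Prop :=
  IsZariskiConnected (glCoords '' (G.points : Set (GL (Fin G.n) ℂ)))

/-- `G` is nilpotent. -/
def IsNilpotent (G : LinearAlgebraicGroup) : Prop := Group.IsNilpotent G.points

/-- `G` is solvable. -/
def IsSolvable (G : LinearAlgebraicGroup) : Prop := Group.IsSolvable G.points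

/-- `G` is reductive: its unipotent radical is trivial, that is, the only Zariski closed, connected,
normal subgroup of `G` that consists of unipotent elements is the trivial one. -/
def IsReductive (G : LinearAlgebraicGroup) : Prop :=
  ∀ U : Subgroup (GL (Fin G.n) ℂ), U ≤ G.points →
    IsZariskiClosed (glCoords '' (U : Set (GL (Fin G.n) ℂ))) →
    IsZariskiConnected (glCoords '' (U : Set (GL (Fin G.n) ℂ))) →
    (U.subgroupOf G.points).Normal →
    (∀ u ∈ U, _root_.IsNilpotent ((u : Matrix (Fin G.n) (Fin G.n) ℂ) - 1)) →
    U = ⊥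

/-- The set `C(G)` of ordered pairs of commuting elements of `G`. -/
def commutingPairs (G : LinearAlgebraicGroup) : Set (GL (Fin G.n) ℂ × GL (Fin G.n) ℂ) :=
  {x | x.1 ∈ G.points ∧ x.2 ∈ G.points ∧ x.1 * x.2 = x.2 * x.1}

/-- The dimension of `G` as a natural number.  (It is never `⊥` or `⊤`, since `G` is a nonempty
algebraic subset of an affine space.) -/
noncomputable def dim (G : LinearAlgebraicGroup) : ℕ :=
  ((zariskiDim (glCoords '' (G.points : Set (GL (Fin G.n) ℂ)))).unbotD 0).toNat

/-- The dimension of the variety `C(G) ⊆ G × G` of commuting pairs, as a natural number. -/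
noncomputable def commutingDim (G : LinearAlgebraicGroup) : ℕ :=
  ((zariskiDim (glPairCoords '' G.commutingPairs)).unbotD 0).toNat

/-- The commuting probability `p(G) = dim C(G) / (2 dim G)`, and `p(G) = 1` if `dim G = 0`. -/
noncomputable def commutingProbability (G : LinearAlgebraicGroup) : ℝ :=
  if G.dim = 0 then 1 else (G.commutingDim : ℝ) / (2 * (G.dim : ℝ))

/-- The set of the numbers `p(G)` for the connected linear algebraic groups `G` with property `P`. -/
def commutingProbabilities (P : LinearAlgebraicGroup → Prop) : Set ℝ :=
  {x | ∃ G : LinearAlgebraicGroup, G.IsConnected ∧ P G ∧ G.commutingProbability = x}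

end LinearAlgebraicGroup

/-!
Both inclusions of `{p(G)} = ℚ ∩ (1/2, 1]` are proved with dimensions computed from points over
extension fields: a Zariski closed set has dimension at most `k` if and only if each of its points
with coordinates in an extension field of `ℂ` has transcendence degree at most `k`
(`zariskiDim_le_of_forall_point`, `exists_finset_of_zariskiDim_le`, by Noether normalization).

*Values lie in `(1/2, 1]`* (`commutingProbability_mem`).  A connected group `G` is irreducible,
since its points are all alike.  Clearly `C(G) ⊆ G × G`.  If `dim C(G) = dim G`, then the graphs
`{(g, g ^ k)}`, which are irreducible of dimension `dim G`, are irreducible components of `C(G)`.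
There are finitely many components, so two graphs coincide and `G` has finite exponent `m`.  The
trace of `∑ k < m, g ^ k` takes finitely many values, hence is constant, and this forces `G = 1`.

*Every rational number in `(1/2, 1]` is a value* (`subset_commutingProbabilities`).  The pairs
`(dim G, dim C(G))` for connected reductive (or nilpotent) `G` are closed under addition, because of
products, and contain `(1, 2)`, because of `GL_1`.  If they also contain pairs `(d, c)` with
`c / (2 d)` arbitrarily close to `1 / 2`, then suitable combinations with `(1, 2)` have any given
ratio.

* In the reductive case such pairs come from `GL_n`, whose commuting variety has dimension at most
  `n ^ 2 + n`.  This follows from the rational canonical form: the first matrix of a commuting pair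
  is conjugate to a matrix with at most `n` parameters, and the choice of the conjugating matrix
  modulo the centralizer and of the second matrix in the centralizer costs `n ^ 2` parameters
  together (`exists_finset_entries_mem_adjoin`).  Instead of reductivity, the stronger property that
  there is no nontrivial normal subgroup of unipotent elements at all is used; it passes to products.
* In the nilpotent case they come from the group of substitutions `X ↦ X + a₂ X ^ 2 + ⋯` modulo
  `X ^ (m + 2)`, a unipotent group of dimension `m`.  If `F = X + a X ^ e + ⋯` and `H = X + ⋯`
  commute, then the vanishing of the coefficient of degree `k + e - 1` in `H ∘ F - F ∘ H` expresses
  `(k - e) a` times the coefficient of degree `k` of `H` by lower ones.  Hence only `e` coefficients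
  of `H` are free, while `F` has at most `m + 2 - e` nonzero ones apart from the leading one, and the
  commuting variety has dimension at most `m + 2` (`coeff_mem_of_comp_comm`,
  `commutingDim_substitutionGroup_le`).

As nilpotent groups are solvable, the solvable and the general case follow.  The statement on limit
points is the density of `ℚ`.
-/

/-! ### Zariski closed and irreducible sets -/

namespace Zariski

open MvPolynomial

variable {σ τ : Type}

attribute [local instance] zariskiTopology

theorem isClosed_iff_zeroLocus_vanishingIdeal {X : Set (σ → ℂ)} :
    IsClosed X ↔ zeroLocus ℂ (vanishingIdeal ℂ X) = X := by
  refine (isZariskiClosed_iff X).trans ⟨?_, fun h => ⟨_, h.symm⟩⟩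
  rintro ⟨I, rfl⟩
  exact Set.Subset.antisymm (zeroLocus_anti_mono (K := ℂ) (le_vanishingIdeal_zeroLocus I))
    (zeroLocus_vanishingIdeal_le (K := ℂ) _)

theorem isClosed_zeroLocus (I : Ideal (MvPolynomial σ ℂ)) :
    IsClosed (X := σ → ℂ) (zeroLocus ℂ I) :=
  (isZariskiClosed_iff _).2 ⟨I, rfl⟩

theorem isClosed_setOf_forall_eval_eq_zero {ι : Sort*} (p : ι → MvPolynomial σ ℂ) :
    IsClosed {x : σ → ℂ | ∀ i, eval x (p i) = 0} := by
  have : {x : σ → ℂ | ∀ i, eval x (p i) = 0} =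
      zeroLocus ℂ (Ideal.span (Set.range p)) := by
    rw [zeroLocus_span]
    ext x
    simp [MvPolynomial.aeval_eq_eval]
  rw [this]
  exact isClosed_zeroLocus _

theorem isClosed_setOf_eval_eq_zero (p : MvPolynomial σ ℂ) :
    IsClosed {x : σ → ℂ | eval x p = 0} := by
  simpa using isClosed_setOf_forall_eval_eq_zero (fun _ : Unit => p)

theorem isClosed_iff_forall {X : Set (σ → ℂ)} :
    IsClosed X ↔ ∀ x : σ → ℂ, (∀ p : MvPolynomial σ ℂ, (∀ y ∈ X, eval y p = 0) → eval x p = 0) →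
      x ∈ X := by
  rw [isClosed_iff_zeroLocus_vanishingIdeal]
  constructor
  · intro h x hx
    rw [← h]
    intro p hp
    exact hx p hp
  · intro h
    exact Set.Subset.antisymm (fun x hx => h x fun p hp => hx p hp)
      (zeroLocus_vanishingIdeal_le (K := ℂ) _)

theorem exists_eval_ne_zero_of_notMem {X : Set (σ → ℂ)} (hX : IsClosed X)
    {x : σ → ℂ} (hx : x ∉ X) :
    ∃ p : MvPolynomial σ ℂ, (∀ y ∈ X, eval y p = 0) ∧ eval x p ≠ 0 := by
  by_contra! h
  exact hx (isClosed_iff_forall.1 hX x h)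

/-- The map of affine spaces with the given polynomial components. -/
noncomputable def polyMap (F : τ → MvPolynomial σ ℂ) (x : σ → ℂ) : τ → ℂ :=
  fun t => eval x (F t)

theorem eval_polyMap (F : τ → MvPolynomial σ ℂ) (x : σ → ℂ) (p : MvPolynomial τ ℂ) :
    eval (polyMap F x) p = eval x (bind₁ F p) := by
  simp only [← MvPolynomial.aeval_eq_eval, aeval_bind₁]
  rfl

theorem continuous_polyMap (F : τ → MvPolynomial σ ℂ) : Continuous (polyMap F) := by
  refine continuous_iff_isClosed.2 fun X hX => isClosed_iff_forall.2 fun x hx => ?_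
  refine isClosed_iff_forall.1 hX _ fun p hp => ?_
  rw [eval_polyMap]
  refine hx _ fun y hy => ?_
  rw [← eval_polyMap]
  exact hp _ hy

/-- A set is irreducible for the Zariski topology if and only if its vanishing ideal is prime. -/
theorem isIrreducible_iff_forall {X : Set (σ → ℂ)} :
    _root_.IsIrreducible X ↔ X.Nonempty ∧ ∀ p q : MvPolynomial σ ℂ,
      (∀ x ∈ X, eval x p * eval x q = 0) →
        (∀ x ∈ X, eval x p = 0) ∨ (∀ x ∈ X, eval x q = 0) := by
  refine and_congr_right fun _ => ?_
  rw [isPreirreducible_iff_isClosed_union_isClosed]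
  constructor
  · intro h p q hpq
    exact h _ _ (isClosed_setOf_eval_eq_zero p) (isClosed_setOf_eval_eq_zero q)
      fun x hx => mul_eq_zero.1 (hpq x hx)
  · intro h A B hA hB hAB
    by_contra! hcon
    obtain ⟨⟨x, hx, hxA⟩, ⟨y, hy, hyB⟩⟩ := hcon.imp Set.not_subset.1 Set.not_subset.1
    obtain ⟨p, hp, hpx⟩ := exists_eval_ne_zero_of_notMem hA hxA
    obtain ⟨q, hq, hqy⟩ := exists_eval_ne_zero_of_notMem hB hyB
    have hpq : ∀ z ∈ X, eval z p * eval z q = 0 := fun z hz => by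
      rcases hAB hz with hz | hz
      · rw [hp z hz, zero_mul]
      · rw [hq z hz, mul_zero]
    exact (h p q hpq).elim (fun h1 => hpx (h1 x hx)) fun h1 => hqy (h1 y hy)

theorem isPrime_vanishingIdeal {X : Set (σ → ℂ)} (hX : _root_.IsIrreducible X) :
    (vanishingIdeal ℂ X).IsPrime := by
  rw [isIrreducible_iff_forall] at hX
  obtain ⟨⟨x, hx⟩, h⟩ := hX
  refine ⟨fun htop => ?_, fun {p q} hpq => ?_⟩
  · have : (1 : MvPolynomial σ ℂ) ∈ vanishingIdeal ℂ X := htop ▸ trivial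
    simpa using this x hx
  · exact h p q fun y hy => by simpa using hpq y hy

/-- A consequence of the Nullstellensatz. -/
theorem isIrreducible_zeroLocus [Finite σ] (P : Ideal (MvPolynomial σ ℂ)) [hP : P.IsPrime] :
    _root_.IsIrreducible (X := σ → ℂ) (zeroLocus ℂ P) := by
  have hV := MvPolynomial.IsPrime.vanishingIdeal_zeroLocus (K := ℂ) P
  rw [isIrreducible_iff_forall]
  constructor
  · by_contra hemp
    rw [Set.not_nonempty_iff_eq_empty] at hemp
    rw [show zeroLocus ℂ P = ∅ from hemp, vanishingIdeal_empty] at hV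
    exact hP.ne_top hV.symm
  · intro p q hpq
    have : p * q ∈ P := by
      rw [← hV]
      intro x hx
      simpa using hpq x hx
    rcases hP.mem_or_mem this with h | h
    · exact Or.inl fun x hx => hx p h
    · exact Or.inr fun x hx => hx q h

open TopologicalSpace in
/-- Hilbert's basis theorem. -/
instance [Finite σ] : NoetherianSpace (σ → ℂ) := by
  rw [((noetherianSpace_TFAE (σ → ℂ)).out 0 1 :)]
  refine ⟨?_⟩
  let f : Closeds (σ → ℂ) → (Ideal (MvPolynomial σ ℂ))ᵒᵈ :=
    fun X => OrderDual.toDual (vanishingIdeal ℂ (X : Set (σ → ℂ)))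
  have hf : StrictMono f := by
    refine Monotone.strictMono_of_injective (fun A B h => ?_) fun A B h => ?_
    · exact vanishingIdeal_anti_mono (K := ℂ) h
    · apply SetLike.coe_injective
      have hA := isClosed_iff_zeroLocus_vanishingIdeal.1 A.isClosed
      have hB := isClosed_iff_zeroLocus_vanishingIdeal.1 B.isClosed
      rw [← hA, ← hB]
      exact congrArg (fun I => zeroLocus ℂ (OrderDual.ofDual I)) h
  exact (InvImage.wf f (wellFounded_lt)).mono fun A B h => hf h

/-! ### Products -/

/-- The product of two subsets of affine spaces, as a subset of the affine space whose set of
coordinates is the disjoint union. -/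
def prodSet (X : Set (σ → ℂ)) (Y : Set (τ → ℂ)) :
    Set (σ ⊕ τ → ℂ) :=
  {z | (fun i => z (Sum.inl i)) ∈ X ∧ (fun j => z (Sum.inr j)) ∈ Y}

theorem prodSet_eq_image (X : Set (σ → ℂ)) (Y : Set (τ → ℂ)) :
    prodSet X Y = (fun z : (σ → ℂ) × (τ → ℂ) => (Sum.elim z.1 z.2 : σ ⊕ τ → ℂ)) ''
      {z | z.1 ∈ X ∧ z.2 ∈ Y} := by
  ext z
  constructor
  · intro h
    exact ⟨(fun i => z (Sum.inl i), fun j => z (Sum.inr j)), h, by ext (i | i) <;> rfl⟩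
  · rintro ⟨⟨x, y⟩, h, rfl⟩
    exact h

theorem isClosed_prodSet {X : Set (σ → ℂ)} {Y : Set (τ → ℂ)}
    (hX : IsClosed X) (hY : IsClosed Y) : IsClosed (prodSet X Y) := by
  have h1 := hX.preimage (continuous_polyMap (σ := σ ⊕ τ) fun i => MvPolynomial.X (Sum.inl i))
  have h2 := hY.preimage (continuous_polyMap (σ := σ ⊕ τ) fun i => MvPolynomial.X (Sum.inr i))
  convert h1.inter h2 using 1
  ext z
  simp +unfoldPartialApp [prodSet, polyMap]

/-- Substituting constants for the second group of variables. -/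
theorem eval_elim_left (p : MvPolynomial (σ ⊕ τ) ℂ) (x : σ → ℂ) (y : τ → ℂ) :
    eval (Sum.elim x y) p = eval x (bind₁ (Sum.elim MvPolynomial.X fun j => C (y j)) p) := by
  rw [← eval_polyMap]
  congr 2
  ext (i | i) <;> simp [polyMap]

/-- Substituting constants for the first group of variables. -/
theorem eval_elim_right (p : MvPolynomial (σ ⊕ τ) ℂ) (x : σ → ℂ) (y : τ → ℂ) :
    eval (Sum.elim x y) p = eval y (bind₁ (Sum.elim (fun i => C (x i)) MvPolynomial.X) p) := by
  rw [← eval_polyMap]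
  congr 2
  ext (i | i) <;> simp [polyMap]

/-- If neither `p` nor `q` vanishes on `X × Y`, then their restrictions to some slice `{x} × Y` do
not vanish either, by the irreducibility of `X`. -/
theorem isIrreducible_prodSet {X : Set (σ → ℂ)} {Y : Set (τ → ℂ)}
    (hX : _root_.IsIrreducible X) (hY : _root_.IsIrreducible Y) :
    _root_.IsIrreducible (prodSet X Y) := by
  rw [isIrreducible_iff_forall] at *
  obtain ⟨⟨x₀, hx₀⟩, hX⟩ := hX
  obtain ⟨⟨y₀, hy₀⟩, hY⟩ := hY
  rw [prodSet_eq_image]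
  refine ⟨⟨_, ⟨(x₀, y₀), ⟨hx₀, hy₀⟩, rfl⟩⟩, fun p q hpq => ?_⟩
  simp only [Set.forall_mem_image, Set.mem_ofPred_eq, and_imp, Prod.forall] at hpq ⊢
  by_contra! hcon
  obtain ⟨⟨x₁, y₁, hx₁, hy₁, h₁⟩, ⟨x₂, y₂, hx₂, hy₂, h₂⟩⟩ := hcon
  -- There is a point `x` with `p (x, y₁)` and `q (x, y₂)` both nonzero.
  have : ∃ x ∈ X, eval (Sum.elim x y₁) p ≠ 0 ∧ eval (Sum.elim x y₂) q ≠ 0 := by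
    by_contra! hno
    simp only [eval_elim_left] at hno h₁ h₂
    rcases hX _ _ fun x hx => mul_eq_zero.2 (or_iff_not_imp_left.2 (hno x hx)) with h | h
    exacts [h₁ (h _ hx₁), h₂ (h _ hx₂)]
  obtain ⟨x, hx, hp, hq⟩ := this
  have h := hpq x
  simp only [eval_elim_right] at hp hq h
  rcases hY _ _ fun y hy => h y hx hy with h | h
  exacts [hp (h _ hy₁), hq (h _ hy₂)]

end Zariski

/-! ### Dimension -/

namespace Zariski

open MvPolynomial TopologicalSpace

variable {σ τ : Type}

attribute [local instance] zariskiTopology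

/-- A polynomial map with a polynomial left inverse does not lower dimensions. -/
theorem zariskiDim_le_of_polyMap {X : Set (σ → ℂ)} {Y : Set (τ → ℂ)} (F : τ → MvPolynomial σ ℂ)
    (G : σ → MvPolynomial τ ℂ) (hF : ∀ x ∈ X, polyMap F x ∈ Y)
    (hG : ∀ x ∈ X, polyMap G (polyMap F x) = x) : zariskiDim X ≤ zariskiDim Y := by
  let f : X → Y := fun x => ⟨polyMap F x, hF x x.2⟩
  have hf : IsInducing f := by
    rw [← IsInducing.subtypeVal.of_comp_iff]
    have hfc : Continuous (Subtype.val ∘ f) := (continuous_polyMap F).comp continuous_subtype_val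
    refine IsInducing.of_comp hfc (continuous_polyMap G) ?_
    have : polyMap G ∘ Subtype.val ∘ f = Subtype.val := funext fun x => hG x x.2
    rw [this]
    exact IsInducing.subtypeVal
  exact hf.topologicalKrullDim_le

theorem zariskiDim_image_polyMap {X : Set (σ → ℂ)} (F : τ → MvPolynomial σ ℂ)
    (G : σ → MvPolynomial τ ℂ) (h : ∀ x ∈ X, polyMap G (polyMap F x) = x) :
    zariskiDim (polyMap F '' X) = zariskiDim X := by
  refine le_antisymm (zariskiDim_le_of_polyMap G F ?_ ?_)
    (zariskiDim_le_of_polyMap F G (fun x hx => ⟨x, hx, rfl⟩) h)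
  · rintro _ ⟨x, hx, rfl⟩
    rwa [h x hx]
  · rintro _ ⟨x, hx, rfl⟩
    rw [h x hx]

theorem polyMap_X (x : σ → ℂ) : polyMap MvPolynomial.X x = x := by
  ext; simp [polyMap]

theorem zariskiDim_mono {X Y : Set (σ → ℂ)} (h : X ⊆ Y) : zariskiDim X ≤ zariskiDim Y :=
  zariskiDim_le_of_polyMap MvPolynomial.X MvPolynomial.X (fun x hx => by rw [polyMap_X]; exact h hx)
    fun x _ => by simp [polyMap_X]

/-- Chains of irreducible closed subsets of a closed set `X`, regarded in the ambient affine space,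
compute the dimension of `X`. -/
theorem exists_ltSeries_of_le_zariskiDim {X : Set (σ → ℂ)} (hX : IsClosed X) {n : ℕ}
    (h : (n : WithBot ℕ∞) ≤ zariskiDim X) :
    ∃ s : LTSeries (IrreducibleCloseds (σ → ℂ)), s.length = n ∧ (s.last : Set (σ → ℂ)) ⊆ X := by
  obtain ⟨s, hs⟩ := Order.le_krullDim_iff.1 h
  refine ⟨s.map _ (IrreducibleCloseds.map_strictMono_of_isInducing IsInducing.subtypeVal), hs, ?_⟩
  rw [LTSeries.last_map, IrreducibleCloseds.coe_map]
  exact hX.closure_subset_iff.2 (by simp)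

theorem length_le_zariskiDim {X : Set (σ → ℂ)} (s : LTSeries (IrreducibleCloseds (σ → ℂ)))
    (hs : (s.last : Set (σ → ℂ)) ⊆ X) : (s.length : WithBot ℕ∞) ≤ zariskiDim X := by
  have hsub : ∀ i, (s i : Set (σ → ℂ)) ⊆ X := fun i =>
    Set.Subset.trans (LTSeries.monotone s (Fin.le_last i)) hs
  have himg : ∀ i, (Subtype.val '' ((Subtype.val : X → σ → ℂ) ⁻¹' (s i))) = (s i : Set (σ → ℂ)) :=
    fun i => by rw [Subtype.image_preimage_coe, Set.inter_eq_right.2 (hsub i)]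
  let t : LTSeries (IrreducibleCloseds X) :=
    LTSeries.mk s.length (fun i =>
      { carrier := Subtype.val ⁻¹' (s i : Set (σ → ℂ))
        isIrreducible' := by
          constructor
          · rw [← Set.image_nonempty (f := Subtype.val), himg]
            exact (s i).isIrreducible.nonempty
          · rintro _ _ ⟨u, hu, rfl⟩ ⟨v, hv, rfl⟩ ⟨x, hxs, hxu⟩ ⟨y, hys, hyv⟩
            obtain ⟨z, hzs, hzu, hzv⟩ :=
              (s i).isIrreducible.isPreirreducible u v hu hv ⟨x, hxs, hxu⟩ ⟨y, hys, hyv⟩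
            exact ⟨⟨z, hsub _ hzs⟩, hzs, hzu, hzv⟩
        isClosed' := (s i).isClosed.preimage continuous_subtype_val }) fun i j hij => by
      have h := s.strictMono hij
      refine lt_of_le_not_ge (fun x hx => h.le hx) fun hle => h.not_ge ?_
      intro y hy
      exact hle (show (⟨y, hsub _ hy⟩ : X) ∈ _ from hy)
  exact Order.le_krullDim_iff.2 ⟨t, rfl⟩

/-- The dimension of a closed set is the Krull dimension of its coordinate ring. -/
theorem zariskiDim_eq_ringKrullDim [Finite σ] {X : Set (σ → ℂ)} (hX : IsClosed X) :
    zariskiDim X = ringKrullDim (MvPolynomial σ ℂ ⧸ vanishingIdeal ℂ X) := by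
  rw [ringKrullDim_quotient, ← Order.krullDim_orderDual]
  apply le_antisymm
  · refine iSup_le fun p => ?_
    obtain ⟨s, hs, hsX⟩ := exists_ltSeries_of_le_zariskiDim hX
      (Order.le_krullDim_iff.2 ⟨p, rfl⟩ : (p.length : WithBot ℕ∞) ≤ zariskiDim X)
    refine Order.le_krullDim_iff.2 ⟨LTSeries.mk s.length (fun i => OrderDual.toDual
      ⟨⟨vanishingIdeal ℂ (s i : Set (σ → ℂ)), isPrime_vanishingIdeal (s i).isIrreducible⟩, ?_⟩) ?_,
      hs⟩
    · exact vanishingIdeal_anti_mono (K := ℂ)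
        (Set.Subset.trans (LTSeries.monotone s (Fin.le_last i)) hsX)
    · intro i j hij
      have h := s.strictMono hij
      refine lt_of_le_not_ge (vanishingIdeal_anti_mono (K := ℂ) h.le) fun hle => h.not_ge ?_
      have := zeroLocus_anti_mono (K := ℂ) (show vanishingIdeal ℂ (s i : Set (σ → ℂ)) ≤
        vanishingIdeal ℂ (s j : Set (σ → ℂ)) from hle)
      rwa [isClosed_iff_zeroLocus_vanishingIdeal.1 (s i).isClosed,
        isClosed_iff_zeroLocus_vanishingIdeal.1 (s j).isClosed] at this
  · refine iSup_le fun p => ?_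
    let s : LTSeries (IrreducibleCloseds (σ → ℂ)) := LTSeries.mk p.length (fun i =>
      { carrier := zeroLocus ℂ (OrderDual.ofDual (p i)).1.asIdeal
        isIrreducible' := isIrreducible_zeroLocus _
        isClosed' := isClosed_zeroLocus _ }) fun i j hij => by
      have h : (OrderDual.ofDual (p j)) < (OrderDual.ofDual (p i)) := p.strictMono hij
      refine lt_of_le_not_ge (zeroLocus_anti_mono (K := ℂ) h.le) fun hle => h.not_ge ?_
      have := vanishingIdeal_anti_mono (k := ℂ) (K := ℂ) hle
      simp only [IrreducibleCloseds.coe_mk] at this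
      erw [MvPolynomial.IsPrime.vanishingIdeal_zeroLocus (K := ℂ),
        MvPolynomial.IsPrime.vanishingIdeal_zeroLocus (K := ℂ)] at this
      exact this
    refine length_le_zariskiDim s (?_ : zeroLocus ℂ (OrderDual.ofDual p.last).1.asIdeal ⊆ X)
    exact (zeroLocus_anti_mono (K := ℂ) (OrderDual.ofDual p.last).2).trans
      (isClosed_iff_zeroLocus_vanishingIdeal.1 hX).le

/-- An integral extension of rings preserves the Krull dimension. -/
theorem ringKrullDim_eq_of_isIntegral {R S : Type*} [CommRing R] [CommRing S] [Algebra R S]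
    [Algebra.IsIntegral R S] (h : Function.Injective (algebraMap R S)) :
    ringKrullDim R = ringKrullDim S := by
  apply le_antisymm
  · refine iSup_le fun l => ?_
    obtain ⟨Q, -, hQ, hQl⟩ := Ideal.exists_ideal_over_prime_of_isIntegral (S := S)
      l.head.asIdeal ⊥ (by
        rw [← RingHom.ker_eq_comap_bot, (RingHom.injective_iff_ker_eq_bot _).1 h]
        exact bot_le)
    have : Q.LiesOver l.head.asIdeal := ⟨hQl.symm⟩
    obtain ⟨L, hL, -⟩ := Ideal.exists_ltSeries_of_hasGoingUp l Q
    exact Order.le_krullDim_iff.2 ⟨L, hL⟩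
  · exact Order.krullDim_le_of_strictMono (PrimeSpectrum.comap (algebraMap R S))
      fun I J hIJ => Ideal.IsIntegral.comap_lt_comap hIJ

open scoped IntermediateField.algebraAdjoinAdjoin in
theorem isAlgebraic_adjoin_iff {K : Type} [Field K] [Algebra ℂ K] {T : Set K} {a : K} :
    IsAlgebraic (IntermediateField.adjoin ℂ T) a ↔ IsAlgebraic (Algebra.adjoin ℂ T) a :=
  (IsFractionRing.isAlgebraic_iff (Algebra.adjoin ℂ T) (IntermediateField.adjoin ℂ T) K).symm

theorem _root_.IsAlgebraic.adjoin_mono {K : Type} [Field K] [Algebra ℂ K] {S T : Set K} {a : K}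
    (h : S ⊆ T) (ha : IsAlgebraic (IntermediateField.adjoin ℂ S) a) :
    IsAlgebraic (IntermediateField.adjoin ℂ T) a := by
  have hle := IntermediateField.adjoin.mono ℂ _ _ h
  algebraize [(IntermediateField.inclusion hle).toRingHom]
  have : IsScalarTower (IntermediateField.adjoin ℂ S) (IntermediateField.adjoin ℂ T) K :=
    IsScalarTower.of_algebraMap_eq fun _ => rfl
  exact ha.tower_top _

theorem isAlgebraic_adjoin_of_mem {K : Type} [Field K] [Algebra ℂ K] {T : Set K} {a : K}
    (h : a ∈ IntermediateField.adjoin ℂ T) : IsAlgebraic (IntermediateField.adjoin ℂ T) a :=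
  isAlgebraic_algebraMap (⟨a, h⟩ : IntermediateField.adjoin ℂ T)

/-- The inequality between an independent and a spanning set, in the matroid of algebraic
independence. -/
theorem card_le_of_algebraicIndependent {K : Type} [Field K] [Algebra ℂ K] {ι : Type} [Fintype ι]
    {x : ι → K} (hx : AlgebraicIndependent ℂ x) (T : Finset K)
    (hT : ∀ i, IsAlgebraic (IntermediateField.adjoin ℂ (T : Set K)) (x i)) :
    Fintype.card ι ≤ T.card := by
  let M := AlgebraicIndependent.matroid ℂ K
  have hind : M.Indep (Set.range x) :=
    AlgebraicIndependent.matroid_indep_iff.2 hx.to_subtype_range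
  have hsub : Set.range x ⊆ M.closure (T : Set K) := by
    rw [AlgebraicIndependent.matroid_closure_eq]
    rintro _ ⟨i, rfl⟩
    exact isAlgebraic_adjoin_iff.1 (hT i)
  have h1 : (Set.range x).encard ≤ (T : Set K).encard := by
    rw [← hind.eRk_eq_encard]
    exact (M.eRk_mono hsub).trans ((M.eRk_closure_eq _).trans_le (M.eRk_le_encard _))
  rw [Set.encard_coe_eq_coe_finsetCard, ← Set.image_univ, hx.injective.encard_image] at h1
  simpa using h1

/-- The dimension of an affine domain is at most its transcendence degree. -/
theorem ringKrullDim_le_of_isAlgebraic {A K : Type} [CommRing A] [IsDomain A] [Algebra ℂ A]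
    [Algebra.FiniteType ℂ A] [Field K] [Algebra ℂ K] (f : A →ₐ[ℂ] K)
    (hf : Function.Injective f) (T : Finset K)
    (hT : ∀ a : A, IsAlgebraic (IntermediateField.adjoin ℂ (T : Set K)) (f a)) :
    ringKrullDim A ≤ T.card := by
  obtain ⟨s, g, hg, hgi⟩ := exists_integral_inj_algHom_of_fg ℂ A
  have hind : AlgebraicIndependent ℂ fun i => f (g (X i)) := by
    have : (aeval fun i => f (g (X i))) = f.comp g := by ext; simp
    rw [AlgebraicIndependent, this]
    exact hf.comp hg
  have hcard := card_le_of_algebraicIndependent hind T fun i => hT _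
  algebraize [g.toRingHom]
  rw [← ringKrullDim_eq_of_isIntegral hg, MvPolynomial.ringKrullDim_of_isNoetherianRing,
    ringKrullDim_eq_zero_of_field, zero_add]
  simp only [Nat.card_eq_fintype_card]
  exact_mod_cast hcard

/-- The transcendence degree of the image of an affine domain in a field is at most its
dimension. -/
theorem exists_finset_of_ringKrullDim_le {A K : Type} [CommRing A] [IsDomain A] [Algebra ℂ A]
    [Algebra.FiniteType ℂ A] [Field K] [Algebra ℂ K] (f : A →ₐ[ℂ] K)
    {k : ℕ} (hk : ringKrullDim A ≤ k) :
    ∃ T : Finset K, T.card ≤ k ∧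
      ∀ a : A, IsAlgebraic (IntermediateField.adjoin ℂ (T : Set K)) (f a) := by
  classical
  obtain ⟨s, g, hg, hgi⟩ := exists_integral_inj_algHom_of_fg ℂ A
  algebraize [g.toRingHom]
  rw [← ringKrullDim_eq_of_isIntegral hg, MvPolynomial.ringKrullDim_of_isNoetherianRing,
    ringKrullDim_eq_zero_of_field, zero_add] at hk
  refine ⟨Finset.univ.image fun i => f (g (X i)), Finset.card_image_le.trans ?_, fun a => ?_⟩
  · simpa using hk
  let L := IntermediateField.adjoin ℂ
    ((Finset.univ.image fun i => f (g (X i)) : Finset K) : Set K)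
  let φ : MvPolynomial (Fin s) ℂ →ₐ[ℂ] L := aeval fun i => ⟨f (g (X i)),
    IntermediateField.subset_adjoin _ _ (by simp)⟩
  have ha : IsIntegral (MvPolynomial (Fin s) ℂ) a := hgi a
  have : IsIntegral L (f a) := by
    refine ha.map_of_comp_eq φ.toRingHom f.toRingHom ?_
    have : (IsScalarTower.toAlgHom ℂ L K).comp φ = f.comp g := by ext i; simp [φ]
    exact congrArg AlgHom.toRingHom this
  exact this.isAlgebraic

theorem isAlgebraic_aeval {K : Type} [Field K] [Algebra ℂ K] {L : IntermediateField ℂ K}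
    {x : σ → K} (hx : ∀ i, IsAlgebraic L (x i)) (p : MvPolynomial σ ℂ) :
    IsAlgebraic L (aeval x p) := by
  induction p using MvPolynomial.induction_on with
  | C a =>
    rw [MvPolynomial.aeval_C]
    exact isAlgebraic_algebraMap (algebraMap ℂ L a)
  | add p q hp hq => rw [map_add]; exact hp.add hq
  | mul_X p i hp => rw [map_mul, aeval_X]; exact hp.mul (hx i)

/-- The dimension of a closed set is bounded by the transcendence degrees of its points with
coordinates in extension fields of `ℂ`. -/
theorem zariskiDim_le_of_forall_point [Finite σ] {X : Set (σ → ℂ)} (hX : IsClosed X) {k : ℕ}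
    (h : ∀ (K : Type) [Field K] [Algebra ℂ K] (x : σ → K),
      x ∈ zeroLocus K (vanishingIdeal ℂ X) → ∃ T : Finset K, T.card ≤ k ∧
        ∀ i, IsAlgebraic (IntermediateField.adjoin ℂ (T : Set K)) (x i)) :
    zariskiDim X ≤ k := by
  refine iSup_le fun p => ?_
  obtain ⟨s, hs, hsX⟩ := exists_ltSeries_of_le_zariskiDim hX
    (Order.le_krullDim_iff.2 ⟨p, rfl⟩ : (p.length : WithBot ℕ∞) ≤ zariskiDim X)
  let P := vanishingIdeal ℂ (s.last : Set (σ → ℂ))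
  have : P.IsPrime := isPrime_vanishingIdeal s.last.isIrreducible
  let A := MvPolynomial σ ℂ ⧸ P
  let f : A →ₐ[ℂ] FractionRing A := IsScalarTower.toAlgHom ℂ A (FractionRing A)
  have hf : Function.Injective f := IsFractionRing.injective A (FractionRing A)
  have hx : ∀ q, aeval (fun i => f (Ideal.Quotient.mk P (MvPolynomial.X i))) q =
      f (Ideal.Quotient.mk P q) := by
    intro q
    have : aeval (fun i => f (Ideal.Quotient.mk P (MvPolynomial.X i))) =
        f.comp (Ideal.Quotient.mkₐ ℂ P) := by ext i; simp; rfl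
    rw [this]
    rfl
  obtain ⟨T, hTk, hT⟩ := h (FractionRing A) (fun i => f (Ideal.Quotient.mk P (MvPolynomial.X i)))
    fun q hq => by
      rw [hx, Ideal.Quotient.eq_zero_iff_mem.2 (vanishingIdeal_anti_mono (K := ℂ) hsX hq),
        map_zero]
  have hdim := ringKrullDim_le_of_isAlgebraic f hf T fun a => by
    obtain ⟨q, rfl⟩ := Ideal.Quotient.mk_surjective a
    rw [← hx]
    exact isAlgebraic_aeval hT q
  rw [← zariskiDim_eq_ringKrullDim s.last.isClosed] at hdim
  rw [← hs]
  exact (length_le_zariskiDim s le_rfl).trans (hdim.trans (by exact_mod_cast hTk))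

/-- A point of a closed set with coordinates in an extension field of `ℂ` has transcendence degree
at most the dimension of the set. -/
theorem exists_finset_of_zariskiDim_le [Finite σ] {X : Set (σ → ℂ)} (hX : IsClosed X) {k : ℕ}
    (hk : zariskiDim X ≤ k) {K : Type} [Field K] [Algebra ℂ K] {x : σ → K}
    (hx : x ∈ zeroLocus K (vanishingIdeal ℂ X)) : ∃ T : Finset K, T.card ≤ k ∧
        ∀ i, IsAlgebraic (IntermediateField.adjoin ℂ (T : Set K)) (x i) := by
  have : Algebra.FiniteType ℂ (aeval (R := ℂ) x).range :=
    Algebra.FiniteType.of_surjective (aeval (R := ℂ) x).rangeRestrict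
      (AlgHom.rangeRestrict_surjective _)
  have hle : ringKrullDim (aeval (R := ℂ) x).range ≤ k := by
    refine le_trans ?_ ((zariskiDim_eq_ringKrullDim hX).symm.le.trans hk)
    refine ringKrullDim_le_of_surjective (Ideal.Quotient.lift (vanishingIdeal ℂ X)
      (aeval (R := ℂ) x).rangeRestrict.toRingHom fun p hp => Subtype.ext (hx p hp)) ?_
    exact Ideal.Quotient.lift_surjective_of_surjective _ _ (AlgHom.rangeRestrict_surjective _)
  obtain ⟨T, hT, h⟩ := exists_finset_of_ringKrullDim_le (aeval (R := ℂ) x).range.val hle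
  exact ⟨T, hT, fun i => h ⟨x i, MvPolynomial.X i, by simp⟩⟩

theorem zariskiDim_le_natCard [Finite σ] (X : Set (σ → ℂ)) : zariskiDim X ≤ Nat.card σ := by
  classical
  have := Fintype.ofFinite σ
  refine (zariskiDim_mono (Set.subset_univ X)).trans (zariskiDim_le_of_forall_point isClosed_univ
    fun K _ _ x _ => ⟨Finset.univ.image x, ?_, fun i => isAlgebraic_adjoin_of_mem ?_⟩)
  · simpa using Finset.card_image_le (s := Finset.univ) (f := x)
  · exact IntermediateField.subset_adjoin _ _ (by simp)

theorem zariskiDim_nonneg {X : Set (σ → ℂ)} (hX : X.Nonempty) : 0 ≤ zariskiDim X := by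
  have : Nonempty X := hX.to_subtype
  obtain ⟨x, hx⟩ := hX
  have : Nonempty (IrreducibleCloseds X) :=
    ⟨⟨closure {⟨x, hx⟩}, isIrreducible_singleton.closure, isClosed_closure⟩⟩
  exact Order.krullDim_nonneg

theorem exists_natCast_eq_zariskiDim [Finite σ] {X : Set (σ → ℂ)} (hX : X.Nonempty) :
    ∃ n : ℕ, zariskiDim X = n := by
  have h1 := zariskiDim_nonneg hX
  have h2 := zariskiDim_le_natCard X
  generalize zariskiDim X = d at *
  induction d with
  | bot => simp at h1
  | coe d =>
    induction d with
    | top => exact absurd h2 (not_le.2 (WithBot.coe_lt_coe.2 (ENat.natCast_lt_top (Nat.card σ))))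
    | coe d => exact ⟨d, rfl⟩

theorem zariskiDim_prodSet_le [Finite σ] [Finite τ] {X : Set (σ → ℂ)} {Y : Set (τ → ℂ)}
    (hX : IsClosed X) (hY : IsClosed Y) {m n : ℕ} (hm : zariskiDim X ≤ m) (hn : zariskiDim Y ≤ n) :
    zariskiDim (prodSet X Y) ≤ (m + n : ℕ) := by
  classical
  refine zariskiDim_le_of_forall_point (isClosed_prodSet hX hY) fun K _ _ z hz => ?_
  obtain ⟨S, hS, hS'⟩ := exists_finset_of_zariskiDim_le hX hm (x := fun i => z (Sum.inl i))
    fun p hp => by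
      have := hz (rename Sum.inl p) fun w hw => by
        rw [aeval_rename]
        exact hp _ hw.1
      rwa [aeval_rename] at this
  obtain ⟨T, hT, hT'⟩ := exists_finset_of_zariskiDim_le hY hn (x := fun i => z (Sum.inr i))
    fun p hp => by
      have := hz (rename Sum.inr p) fun w hw => by
        rw [aeval_rename]
        exact hp _ hw.2
      rwa [aeval_rename] at this
  refine ⟨S ∪ T, (Finset.card_union_le _ _).trans (add_le_add hS hT), ?_⟩
  rintro (i | i)
  · exact (hS' i).adjoin_mono (by simp)
  · exact (hT' i).adjoin_mono (by simp)

/-- A chain in `X` from `V` to `V'` and a chain in `Y` from `W` to `W'` are combined to one from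
`V × W` over `V' × W` to `V' × W'`. -/
theorem le_zariskiDim_prodSet {X : Set (σ → ℂ)} {Y : Set (τ → ℂ)}
    (hX : IsClosed X) (hY : IsClosed Y) {m n : ℕ} (hm : m ≤ zariskiDim X) (hn : n ≤ zariskiDim Y) :
    (m + n : ℕ) ≤ zariskiDim (prodSet X Y) := by
  obtain ⟨s, rfl, hs⟩ := exists_ltSeries_of_le_zariskiDim hX hm
  obtain ⟨t, rfl, ht⟩ := exists_ltSeries_of_le_zariskiDim hY hn
  let f (V : IrreducibleCloseds (σ → ℂ)) (W : IrreducibleCloseds (τ → ℂ)) :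
      IrreducibleCloseds (σ ⊕ τ → ℂ) :=
    ⟨prodSet V W, isIrreducible_prodSet V.isIrreducible W.isIrreducible,
      isClosed_prodSet V.isClosed W.isClosed⟩
  have hf₁ : ∀ W, StrictMono fun V => f V W := by
    intro W V V' h
    refine lt_of_le_not_ge (fun z hz => ⟨h.le hz.1, hz.2⟩) fun hle => h.not_ge fun x hx => ?_
    obtain ⟨y, hy⟩ := W.isIrreducible.nonempty
    exact (hle (show (Sum.elim x y : σ ⊕ τ → ℂ) ∈ prodSet V' W from ⟨hx, hy⟩)).1
  have hf₂ : ∀ V, StrictMono (f V) := by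
    intro V W W' h
    refine lt_of_le_not_ge (fun z hz => ⟨hz.1, h.le hz.2⟩) fun hle => h.not_ge fun y hy => ?_
    obtain ⟨x, hx⟩ := V.isIrreducible.nonempty
    exact (hle (show (Sum.elim x y : σ ⊕ τ → ℂ) ∈ prodSet V W' from ⟨hx, hy⟩)).2
  let u := (s.map _ (hf₁ t.head)).smash (t.map _ (hf₂ s.last)) rfl
  have hu : (u.last : Set (σ ⊕ τ → ℂ)) ⊆ prodSet X Y := by
    have : u.last = f s.last t.last := by
      refine (RelSeries.last_smash _).trans ?_
      exact LTSeries.last_map ..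
    rw [this]
    exact fun z hz => ⟨hs hz.1, ht hz.2⟩
  exact length_le_zariskiDim u hu

end Zariski

/-! ### Homogeneous Noetherian spaces -/

open TopologicalSpace in
/-- A connected Noetherian space with transitive homeomorphism group is irreducible: some point has
an irreducible open neighbourhood, hence every point does, and then each irreducible component is
open. -/
theorem isIrreducible_univ_of_homogeneous {Z : Type*} [TopologicalSpace Z] [NoetherianSpace Z]
    [ConnectedSpace Z] (hZ : ∀ x y : Z, ∃ e : Z ≃ₜ Z, e x = y) :
    _root_.IsIrreducible (Set.univ : Set Z) := by
  obtain ⟨x₀⟩ := (inferInstance : Nonempty Z)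
  have hloc : ∀ x : Z, ∃ U : Set Z, IsOpen U ∧ x ∈ U ∧ _root_.IsIrreducible U := by
    obtain ⟨o, ho, ⟨y, hy⟩, hoC⟩ :=
      NoetherianSpace.exists_isOpen_nonempty_subset_irreducibleComponent
        (irreducibleComponent x₀) (irreducibleComponent_mem_irreducibleComponents x₀)
    intro x
    obtain ⟨e, he⟩ := hZ y x
    refine ⟨e '' o, e.isOpenMap _ ho, ⟨y, hy, he⟩, ?_⟩
    refine _root_.IsIrreducible.image ⟨⟨y, hy⟩, ?_⟩ e e.continuous.continuousOn
    exact (isIrreducible_irreducibleComponent (x := x₀)).isPreirreducible.open_subset ho hoC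
  let C := irreducibleComponent x₀
  have hCirr : _root_.IsIrreducible C := isIrreducible_irreducibleComponent
  have hopen : IsOpen C := by
    rw [isOpen_iff_forall_mem_open]
    intro x hx
    obtain ⟨U, hU, hxU, hUirr⟩ := hloc x
    refine ⟨U, ?_, hU, hxU⟩
    have hsub : C ⊆ closure U := by
      have := subset_closure_inter_of_isPreirreducible_of_isOpen hCirr.isPreirreducible hU
        ⟨x, hx, hxU⟩
      exact this.trans (closure_mono Set.inter_subset_right)
    have hmax := (irreducibleComponent_mem_irreducibleComponents x₀).2 hUirr.closure hsub
    exact subset_closure.trans hmax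
  have : C = Set.univ := IsClopen.eq_univ ⟨isClosed_irreducibleComponent, hopen⟩ hCirr.nonempty
  rw [← this]
  exact hCirr

namespace LinearAlgebraicGroup

open MvPolynomial Zariski TopologicalSpace

attribute [local instance] zariskiTopology

/-! ### The varieties of a linear algebraic group -/

/-- The variables for the coordinates of `GL_n`. -/
abbrev CoordIndex (n : ℕ) : Type := (Fin n × Fin n) ⊕ Unit

/-- The matrix whose entries are the coordinate functions. -/
noncomputable def genericMatrix (n : ℕ) : Matrix (Fin n) (Fin n) (MvPolynomial (CoordIndex n) ℂ) :=
  Matrix.of fun i j => MvPolynomial.X (Sum.inl (i, j))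

theorem eval_genericMatrix {n : ℕ} (g : GL (Fin n) ℂ) :
    (genericMatrix n).map (eval (glCoords g)) = (g : Matrix (Fin n) (Fin n) ℂ) := by
  ext i j
  simp [genericMatrix, glCoords]

theorem glCoords_injective {n : ℕ} : Function.Injective (glCoords (n := n)) := fun _ _ hgh =>
  Units.ext (Matrix.ext fun i j => congrFun hgh (Sum.inl (i, j)))

theorem glPairCoords_injective {n : ℕ} : Function.Injective (glPairCoords (n := n)) := by
  rintro ⟨a, b⟩ ⟨c, d⟩ h
  obtain ⟨h1, h2⟩ := Sum.elim_eq_iff.1 h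
  exact Prod.ext (glCoords_injective h1) (glCoords_injective h2)

/-- The variety of points of `G`, in affine space. -/
def variety (G : LinearAlgebraicGroup) : Set (CoordIndex G.n → ℂ) :=
  glCoords '' (G.points : Set (GL (Fin G.n) ℂ))

/-- The variety of commuting pairs of `G`, in affine space. -/
def commutingVariety (G : LinearAlgebraicGroup) : Set (CoordIndex G.n ⊕ CoordIndex G.n → ℂ) :=
  glPairCoords '' G.commutingPairs

variable (G : LinearAlgebraicGroup)

theorem isClosed_variety : IsClosed G.variety := G.isClosed

/-- The polynomial equations `x y = y x`. -/
noncomputable def commutator (n : ℕ) :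
    Matrix (Fin n) (Fin n) (MvPolynomial (CoordIndex n ⊕ CoordIndex n) ℂ) :=
  (genericMatrix n).map (rename Sum.inl) * (genericMatrix n).map (rename Sum.inr) -
    (genericMatrix n).map (rename Sum.inr) * (genericMatrix n).map (rename Sum.inl)

theorem map_commutator {n : ℕ} {K : Type} [CommRing K] [Algebra ℂ K]
    (z : CoordIndex n ⊕ CoordIndex n → K) :
    (commutator n).map (aeval z) =
      (Matrix.of fun i j => z (Sum.inl (Sum.inl (i, j)))) *
        (Matrix.of fun i j => z (Sum.inr (Sum.inl (i, j)))) -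
      (Matrix.of fun i j => z (Sum.inr (Sum.inl (i, j)))) *
        (Matrix.of fun i j => z (Sum.inl (Sum.inl (i, j)))) := by
  ext i j
  simp [commutator, genericMatrix, Matrix.mul_apply]

theorem commutingVariety_eq : G.commutingVariety =
    prodSet G.variety G.variety ∩ {z | ∀ ij : Fin G.n × Fin G.n,
      eval z (commutator G.n ij.1 ij.2) = 0} := by
  have key : ∀ a b : GL (Fin G.n) ℂ, (∀ ij : Fin G.n × Fin G.n,
      eval (glPairCoords (a, b)) (commutator G.n ij.1 ij.2) = 0) ↔ a * b = b * a := by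
    intro a b
    have h := map_commutator (glPairCoords (a, b))
    have h' : (commutator G.n).map (aeval (glPairCoords (a, b))) =
      (a : Matrix (Fin G.n) (Fin G.n) ℂ) * b - b * a := h
    rw [← Units.val_inj, Units.val_mul, Units.val_mul, ← sub_eq_zero, ← h', ← Matrix.ext_iff]
    simp [MvPolynomial.aeval_eq_eval]
  ext z
  constructor
  · rintro ⟨⟨a, b⟩, ⟨ha, hb, hab⟩, rfl⟩
    exact ⟨⟨⟨a, ha, rfl⟩, ⟨b, hb, rfl⟩⟩, (key a b).2 hab⟩
  · rintro ⟨⟨⟨a, ha, haz⟩, ⟨b, hb, hbz⟩⟩, hz⟩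
    have : glPairCoords (a, b) = z := by
      ext (i | i)
      exacts [congrFun haz i, congrFun hbz i]
    subst this
    exact ⟨(a, b), ⟨ha, hb, (key a b).1 hz⟩, rfl⟩

theorem isClosed_commutingVariety : IsClosed G.commutingVariety := by
  rw [commutingVariety_eq]
  exact (isClosed_prodSet G.isClosed_variety G.isClosed_variety).inter
    (isClosed_setOf_forall_eval_eq_zero _)

theorem variety_nonempty : G.variety.Nonempty := ⟨_, 1, G.points.one_mem, rfl⟩

theorem commutingVariety_nonempty : G.commutingVariety.Nonempty :=
  ⟨_, (1, 1), ⟨G.points.one_mem, G.points.one_mem, rfl⟩, rfl⟩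

theorem zariskiDim_variety : zariskiDim G.variety = G.dim := by
  obtain ⟨n, hn⟩ := exists_natCast_eq_zariskiDim G.variety_nonempty
  have : G.dim = n := by
    unfold dim
    rw [show zariskiDim (glCoords '' (G.points : Set (GL (Fin G.n) ℂ))) = n from hn]
    rfl
  rw [hn, this]

theorem zariskiDim_commutingVariety : zariskiDim G.commutingVariety = G.commutingDim := by
  obtain ⟨n, hn⟩ := exists_natCast_eq_zariskiDim G.commutingVariety_nonempty
  have : G.commutingDim = n := by
    unfold commutingDim
    rw [show zariskiDim (glPairCoords '' G.commutingPairs) = n from hn]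
    rfl
  rw [hn, this]

theorem commutingDim_le : G.commutingDim ≤ 2 * G.dim := by
  have h := zariskiDim_prodSet_le G.isClosed_variety G.isClosed_variety G.zariskiDim_variety.le
    G.zariskiDim_variety.le
  have h2 := (zariskiDim_mono (commutingVariety_eq G ▸ Set.inter_subset_left)).trans h
  rw [zariskiDim_commutingVariety] at h2
  have : G.commutingDim ≤ G.dim + G.dim := by exact_mod_cast h2
  omega

/-! ### Connected groups are irreducible -/

/-- The polynomial map that describes left multiplication by `h`. -/
noncomputable def leftMulPoly {n : ℕ} (h : GL (Fin n) ℂ) :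
    CoordIndex n → MvPolynomial (CoordIndex n) ℂ :=
  Sum.elim
    (fun ij => ((h : Matrix (Fin n) (Fin n) ℂ).map C * genericMatrix n :
      Matrix (Fin n) (Fin n) (MvPolynomial (CoordIndex n) ℂ)) ij.1 ij.2)
    fun u => C (h : Matrix (Fin n) (Fin n) ℂ).det⁻¹ * MvPolynomial.X (Sum.inr u)

theorem polyMap_leftMulPoly {n : ℕ} (h g : GL (Fin n) ℂ) :
    polyMap (leftMulPoly h) (glCoords g) = glCoords (h * g) := by
  ext (⟨i, j⟩ | u)
  · simp [polyMap, leftMulPoly, genericMatrix, glCoords, Matrix.mul_apply]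
  · simp [polyMap, leftMulPoly, glCoords, mul_comm]

/-- Left multiplications act transitively on the points. -/
theorem isIrreducible_variety (hG : G.IsConnected) : _root_.IsIrreducible G.variety := by
  have : ConnectedSpace G.variety := isConnected_iff_connectedSpace.1 hG
  have hirr : _root_.IsIrreducible (Set.univ : Set G.variety) := by
    refine isIrreducible_univ_of_homogeneous ?_
    rintro ⟨_, x, hx, rfl⟩ ⟨_, y, hy, rfl⟩
    let f (h : G.points) : G.variety → G.variety := fun v => ⟨polyMap (leftMulPoly h.1) v, by
      obtain ⟨_, g, hg, rfl⟩ := v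
      rw [polyMap_leftMulPoly]
      exact ⟨_, G.points.mul_mem h.2 hg, rfl⟩⟩
    have hf : ∀ h h' : G.points, h * h' = 1 → Function.LeftInverse (f h) (f h') := by
      rintro h h' hh ⟨_, g, hg, rfl⟩
      apply Subtype.ext
      simp only [f, polyMap_leftMulPoly]
      rw [← mul_assoc, show (h : GL (Fin G.n) ℂ) * h' = 1 from congrArg Subtype.val hh, one_mul]
    have hcont : ∀ h, Continuous (f h) := fun h =>
      ((continuous_polyMap _).comp continuous_subtype_val).subtype_mk _
    let h : G.points := ⟨y, hy⟩ * ⟨x, hx⟩⁻¹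
    refine ⟨⟨⟨f h, f h⁻¹, hf _ _ (inv_mul_cancel h), hf _ _ (mul_inv_cancel h)⟩, hcont _, hcont _⟩,
      Subtype.ext ?_⟩
    change polyMap (leftMulPoly h.1) (glCoords x) = glCoords y
    rw [polyMap_leftMulPoly]
    simp [h]
  have := hirr.image Subtype.val continuous_subtype_val.continuousOn
  rwa [Set.image_univ, Subtype.range_coe] at this

end LinearAlgebraicGroup

namespace LinearAlgebraicGroup

open MvPolynomial Zariski TopologicalSpace

attribute [local instance] zariskiTopology

/-! ### The dimension of the commuting variety exceeds that of the group -/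

/-- The average of the powers of a complex matrix `A` of finite order `m` is the projection onto the
fixed vectors of `A`.  Its trace is a natural number `r ≤ n`, and `A = 1` if it equals `n`. -/
theorem eq_one_of_trace_average {n m : ℕ} (hm : 0 < m) {A : Matrix (Fin n) (Fin n) ℂ}
    (hA : A ^ m = 1) :
    (∃ r ∈ Finset.range (n + 1), (∑ k ∈ Finset.range m, A ^ k).trace = m * (r : ℂ)) ∧
      ((∑ k ∈ Finset.range m, A ^ k).trace = m * (n : ℂ) → A = 1) := by
  have hm0 : (m : ℂ) ≠ 0 := by exact_mod_cast hm.ne'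
  set S := ∑ k ∈ Finset.range m, A ^ k with hS
  have hAS : A * S = S := by
    have := (Finset.sum_range_succ' (fun k => A ^ k) m).symm.trans
      (Finset.sum_range_succ (fun k => A ^ k) m)
    rw [hA, pow_zero] at this
    rw [hS, Finset.mul_sum]
    simpa [pow_succ'] using this
  have hpow : ∀ k, A ^ k * S = S := fun k => by
    induction k with
    | zero => simp
    | succ k ih => rw [pow_succ, mul_assoc, hAS, ih]
  have hSS : S * S = (m : ℂ) • S := by
    nth_rewrite 1 [hS]
    rw [Finset.sum_mul, Finset.sum_congr rfl fun k _ => hpow k]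
    simp [Nat.cast_smul_eq_nsmul]
  set P := (m : ℂ)⁻¹ • S with hP
  have hPP : P * P = P := by
    rw [hP, smul_mul_smul_comm, hSS, smul_smul]
    congr 1
    field_simp
  have hSP : S.trace = m * P.trace := by
    rw [hP, Matrix.trace_smul, smul_eq_mul, mul_inv_cancel_left₀ hm0]
  have hidem : IsIdempotentElem (Matrix.toLin' P) := by
    rw [IsIdempotentElem, Module.End.mul_eq_comp, ← Matrix.toLin'_mul, hPP]
  constructor
  · refine ⟨Module.finrank ℂ (LinearMap.range (Matrix.toLin' P)), ?_, ?_⟩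
    · rw [Finset.mem_range, Nat.lt_succ_iff]
      simpa using Submodule.finrank_le (LinearMap.range (Matrix.toLin' P))
    · rw [hSP, ← (LinearMap.IsIdempotentElem.isProj_range _ hidem).trace, Matrix.trace_toLin'_eq]
  · intro htr
    have htr' : P.trace = n := mul_left_cancel₀ hm0 (hSP.symm.trans htr)
    have h0 : LinearMap.trace ℂ _ (1 - Matrix.toLin' P) = 0 := by
      rw [map_sub, Matrix.trace_toLin'_eq, htr']
      simp
    have h1 := (LinearMap.IsIdempotentElem.trace_eq_zero_iff hidem.one_sub).1 h0
    have h2 : P = 1 := by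
      apply Matrix.toLin'.injective
      rw [Matrix.toLin'_one]
      exact (sub_eq_zero.1 h1).symm
    have h3 : A * P = P := by rw [hP, mul_smul_comm, hAS]
    rwa [h2, mul_one] at h3

variable (G : LinearAlgebraicGroup)

/-- The polynomial map that describes the `k`-th power. -/
noncomputable def powPoly (n k : ℕ) : CoordIndex n → MvPolynomial (CoordIndex n) ℂ :=
  Sum.elim (fun ij => (genericMatrix n ^ k) ij.1 ij.2) fun u => MvPolynomial.X (Sum.inr u) ^ k

theorem eval_genericMatrix_pow {n : ℕ} (g : GL (Fin n) ℂ) (k : ℕ) :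
    (genericMatrix n ^ k).map (eval (glCoords g)) = (g : Matrix (Fin n) (Fin n) ℂ) ^ k := by
  rw [Matrix.map_pow, eval_genericMatrix]

theorem polyMap_powPoly {n : ℕ} (k : ℕ) (g : GL (Fin n) ℂ) :
    polyMap (powPoly n k) (glCoords g) = glCoords (g ^ k) := by
  ext (⟨i, j⟩ | u)
  · have := congrFun (congrFun (eval_genericMatrix_pow g k) i) j
    simpa [polyMap, powPoly, glCoords] using this
  · simp [polyMap, powPoly, glCoords]

/-- A polynomial with finitely many values on an irreducible set is constant on this set. -/
theorem exists_forall_eval_eq_of_forall_mem {σ : Type} {X : Set (σ → ℂ)}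
    (hX : _root_.IsIrreducible X) (p : MvPolynomial σ ℂ) (s : Finset ℂ)
    (h : ∀ x ∈ X, eval x p ∈ s) :
    ∃ c, ∀ x ∈ X, eval x p = c := by
  have hprime := isPrime_vanishingIdeal hX
  have hmem : ∏ c ∈ s, (p - C c) ∈ vanishingIdeal ℂ X := fun x hx => by
    rw [MvPolynomial.aeval_eq_eval, map_prod]
    exact Finset.prod_eq_zero (h x hx) (by simp)
  obtain ⟨c, -, hc⟩ := (hprime.prod_mem_iff).1 hmem
  exact ⟨c, fun x hx => by simpa [MvPolynomial.aeval_eq_eval, sub_eq_zero] using hc x hx⟩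

/-- An irreducible group of finite exponent is trivial: the trace of the average of the powers of
`g` takes finitely many values, hence has the same value for all `g` as for `g = 1`. -/
theorem eq_one_of_forall_pow_eq_one (hG : _root_.IsIrreducible G.variety) {m : ℕ} (hm : 0 < m)
    (h : ∀ g ∈ G.points, g ^ m = 1) {g : GL (Fin G.n) ℂ} (hg : g ∈ G.points) : g = 1 := by
  let p : MvPolynomial (CoordIndex G.n) ℂ :=
    (∑ k ∈ Finset.range m, genericMatrix G.n ^ k).trace
  have hp : ∀ g : GL (Fin G.n) ℂ, eval (glCoords g) p =
      (∑ k ∈ Finset.range m, (g : Matrix (Fin G.n) (Fin G.n) ℂ) ^ k).trace := by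
    intro g
    simp only [p, ← eval_genericMatrix_pow, Matrix.trace_sum, map_sum]
    simp [Matrix.trace]
  have hval : ∀ g ∈ G.points, (g : Matrix (Fin G.n) (Fin G.n) ℂ) ^ m = 1 := fun g hg => by
    rw [← Units.val_pow_eq_pow_val, h g hg, Units.val_one]
  obtain ⟨c, hc⟩ := exists_forall_eval_eq_of_forall_mem hG p
    ((Finset.range (G.n + 1)).image fun r : ℕ => m * (r : ℂ)) (by
      rintro _ ⟨g, hg, rfl⟩
      obtain ⟨r, hr, hr'⟩ := (eq_one_of_trace_average hm (hval g hg)).1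
      exact Finset.mem_image.2 ⟨r, hr, by rw [hp, hr']⟩)
  have h1 : c = m * (G.n : ℂ) := by
    rw [← hc _ ⟨1, G.points.one_mem, rfl⟩, hp]
    simp only [Units.val_one, one_pow, Finset.sum_const, Finset.card_range, Matrix.trace_smul,
      Matrix.trace_one, Fintype.card_fin]
    exact nsmul_eq_mul _ _
  refine Units.ext ((eq_one_of_trace_average hm (hval g hg)).2 ?_)
  rw [← hp, hc _ ⟨g, hg, rfl⟩, h1]

theorem zariskiDim_singleton_le {σ : Type} [Finite σ] (x : σ → ℂ) : zariskiDim {x} ≤ (0 : ℕ) := by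
  have hcl : IsClosed ({x} : Set (σ → ℂ)) := by
    convert isClosed_setOf_forall_eval_eq_zero fun i =>
      (MvPolynomial.X i - C (x i) : MvPolynomial σ ℂ)
    ext y
    simp [sub_eq_zero, funext_iff]
  refine zariskiDim_le_of_forall_point hcl fun K _ _ y hy => ⟨∅, le_rfl, fun i => ?_⟩
  have := hy (MvPolynomial.X i - C (x i)) (by rintro _ rfl; simp)
  have hi : y i = algebraMap ℂ K (x i) := by
    simpa [sub_eq_zero] using this
  rw [hi]
  exact isAlgebraic_adjoin_of_mem (IntermediateField.algebraMap_mem _ _)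

/-- The map `x ↦ (x, x ^ k)`, whose image is the graph of the `k`-th power map. -/
noncomputable def powGraph (n k : ℕ) (x : CoordIndex n → ℂ) : CoordIndex n ⊕ CoordIndex n → ℂ :=
  polyMap (Sum.elim MvPolynomial.X (powPoly n k)) x

theorem powGraph_glCoords {n : ℕ} (k : ℕ) (g : GL (Fin n) ℂ) :
    powGraph n k (glCoords g) = glPairCoords (g, g ^ k) := by
  unfold glPairCoords
  rw [← polyMap_powPoly]
  ext (i | i) <;> simp [powGraph, polyMap]

theorem powGraph_inl {n k : ℕ} (x : CoordIndex n → ℂ) (i) : powGraph n k x (Sum.inl i) = x i := by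
  simp [powGraph, polyMap]

theorem isClosed_image_powGraph {n : ℕ} (k : ℕ) {X : Set (CoordIndex n → ℂ)} (hX : IsClosed X) :
    IsClosed (powGraph n k '' X) := by
  have h1 := hX.preimage (continuous_polyMap (σ := CoordIndex n ⊕ CoordIndex n)
    fun i => MvPolynomial.X (Sum.inl i))
  have h2 := isClosed_setOf_forall_eval_eq_zero fun i : CoordIndex n =>
    (MvPolynomial.X (Sum.inr i) - rename Sum.inl (powPoly n k i) :
      MvPolynomial (CoordIndex n ⊕ CoordIndex n) ℂ)
  convert h1.inter h2 using 1
  ext z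
  constructor
  · rintro ⟨x, hx, rfl⟩
    refine ⟨?_, fun i => ?_⟩
    · have : polyMap (fun i => MvPolynomial.X (Sum.inl i)) (powGraph n k x) = x := by
        ext i
        simp [polyMap, powGraph]
      exact Set.mem_preimage.2 (this.symm ▸ hx)
    · rw [map_sub, eval_rename, eval_X, sub_eq_zero]
      simp only [powGraph, polyMap, Sum.elim_inr]
      congr 2
      ext j
      simp [polyMap]
  · rintro ⟨hx, hz⟩
    refine ⟨_, hx, ?_⟩
    ext (i | i)
    · simp [powGraph, polyMap]
    · have := hz i
      rw [map_sub, eval_rename, eval_X, sub_eq_zero] at this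
      rw [this]
      simp only [powGraph, polyMap, Sum.elim_inr]
      congr 2
      ext j
      simp [polyMap]

/-- If `dim C(G) ≤ dim G`, then the graphs of the power maps are irreducible components of `C(G)`;
as there are infinitely many exponents and finitely many components, two graphs coincide. -/
theorem exists_pow_eq_one (hG : _root_.IsIrreducible G.variety) (hdim : G.commutingDim ≤ G.dim) :
    ∃ m, 0 < m ∧ ∀ g ∈ G.points, g ^ m = 1 := by
  -- The graph of the `k`-th power map over an irreducible closed set `V`.
  let Γ (k : ℕ) (V : IrreducibleCloseds (CoordIndex G.n → ℂ)) :
      IrreducibleCloseds (CoordIndex G.n ⊕ CoordIndex G.n → ℂ) :=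
    ⟨powGraph G.n k '' V, V.isIrreducible.image _ (continuous_polyMap _).continuousOn,
      isClosed_image_powGraph k V.isClosed⟩
  have hinj : ∀ k, Function.Injective (powGraph G.n k) := fun k x y hxy => funext fun i => by
    rw [← powGraph_inl (k := k) x, hxy, powGraph_inl]
  have hΓ : ∀ k, StrictMono (Γ k) := fun k V W hVW =>
    lt_of_le_not_ge (Set.image_mono hVW.le) fun hle =>
      hVW.not_ge ((Set.image_subset_image_iff (hinj k)).1 hle)
  have hΓC : ∀ k, powGraph G.n k '' G.variety ⊆ G.commutingVariety := by
    rintro k _ ⟨_, ⟨g, hg, rfl⟩, rfl⟩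
    rw [powGraph_glCoords]
    exact ⟨_, ⟨hg, G.points.pow_mem hg k, (pow_succ' g k).symm.trans (pow_succ g k)⟩, rfl⟩
  obtain ⟨s, hs, hsG⟩ := exists_ltSeries_of_le_zariskiDim G.isClosed_variety
    G.zariskiDim_variety.ge
  let W : IrreducibleCloseds (CoordIndex G.n → ℂ) := ⟨G.variety, hG, G.isClosed_variety⟩
  -- A larger irreducible closed set would give a chain of length `dim G + 1` in `C(G)`.
  have hmax : ∀ k (Z : IrreducibleCloseds (CoordIndex G.n ⊕ CoordIndex G.n → ℂ)),
      (Z : Set _) ⊆ G.commutingVariety → Γ k W ≤ Z → Γ k W = Z := by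
    intro k Z hZ hle
    by_contra hne
    have hlt : (s.map _ (hΓ k)).last < Z := by
      rw [LTSeries.last_map]
      exact lt_of_le_of_lt ((hΓ k).monotone (show s.last ≤ W from hsG)) (lt_of_le_of_ne hle hne)
    have hlen := length_le_zariskiDim (X := G.commutingVariety)
      (RelSeries.snoc (s.map _ (hΓ k)) Z hlt) (by rw [RelSeries.last_snoc]; exact hZ)
    rw [zariskiDim_commutingVariety] at hlen
    have : s.length + 1 ≤ G.commutingDim := by exact_mod_cast hlen
    omega
  -- `C(G)` is the union of a finite set `S` of irreducible closed sets.
  obtain ⟨S, hSfin, hScl, hSirr, hSeq⟩ :=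
    NoetherianSpace.exists_finite_set_isClosed_irreducible G.isClosed_commutingVariety
  have hmem : ∀ k, powGraph G.n k '' G.variety ∈ S := by
    intro k
    obtain ⟨Z, hZS, hZ⟩ := isIrreducible_iff_sUnion_isClosed.1 (Γ k W).isIrreducible hSfin.toFinset
      (fun z hz => hScl z (hSfin.mem_toFinset.1 hz)) (by
        rw [hSfin.coe_toFinset, ← hSeq]
        exact hΓC k)
    rw [hSfin.mem_toFinset] at hZS
    have := hmax k ⟨Z, hSirr Z hZS, hScl Z hZS⟩ (hSeq ▸ Set.subset_sUnion_of_mem hZS) hZ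
    rw [show powGraph G.n k '' G.variety = Z from congrArg SetLike.coe this]
    exact hZS
  have hnot : ¬ Function.Injective fun k => powGraph G.n k '' G.variety := fun hinj =>
    Set.infinite_of_injective_forall_mem hinj hmem hSfin
  obtain ⟨k, l, hkl, hne⟩ : ∃ k l, powGraph G.n k '' G.variety = powGraph G.n l '' G.variety ∧
      k < l := by
    simp only [Function.Injective] at hnot
    push Not at hnot
    obtain ⟨k, l, h, hne⟩ := hnot
    rcases hne.lt_or_gt with hlt | hlt
    exacts [⟨k, l, h, hlt⟩, ⟨l, k, h.symm, hlt⟩]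
  refine ⟨l - k, by omega, fun g hg => ?_⟩
  have : powGraph G.n k (glCoords g) ∈ powGraph G.n l '' G.variety := hkl ▸ ⟨_, ⟨g, hg, rfl⟩, rfl⟩
  obtain ⟨_, ⟨h, hh, rfl⟩, heq⟩ := this
  rw [powGraph_glCoords, powGraph_glCoords] at heq
  have := glPairCoords_injective heq
  simp only [Prod.mk.injEq] at this
  obtain ⟨rfl, hpow⟩ := this
  rw [pow_sub _ hne.le, hpow, mul_inv_cancel]

theorem dim_lt_commutingDim (hG : _root_.IsIrreducible G.variety) (hdim : 0 < G.dim) :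
    G.dim < G.commutingDim := by
  by_contra! hle
  obtain ⟨m, hm, h⟩ := G.exists_pow_eq_one hG hle
  have hsub : G.variety ⊆ {glCoords 1} := by
    rintro _ ⟨g, hg, rfl⟩
    rw [G.eq_one_of_forall_pow_eq_one hG hm h hg]
    rfl
  have := (zariskiDim_mono hsub).trans (zariskiDim_singleton_le _)
  rw [zariskiDim_variety] at this
  have : G.dim ≤ 0 := by exact_mod_cast this
  omega

theorem commutingProbability_mem (hG : G.IsConnected) :
    G.commutingProbability ∈ Set.range ((↑) : ℚ → ℝ) ∩ Set.Ioc (1 / 2) 1 := by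
  unfold commutingProbability
  split_ifs with h
  · exact ⟨⟨1, by simp⟩, by norm_num, le_rfl⟩
  · have hpos : 0 < G.dim := Nat.pos_of_ne_zero h
    have h1 : (G.dim : ℝ) < G.commutingDim := by
      exact_mod_cast G.dim_lt_commutingDim (G.isIrreducible_variety hG) hpos
    have h2 : (G.commutingDim : ℝ) ≤ 2 * G.dim := by exact_mod_cast G.commutingDim_le
    have h3 : (0 : ℝ) < G.dim := by exact_mod_cast hpos
    refine ⟨⟨(G.commutingDim : ℚ) / (2 * G.dim), by push_cast; rfl⟩, ?_, ?_⟩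
    · rw [lt_div_iff₀ (by positivity)]
      linarith
    · rw [div_le_one (by positivity)]
      exact h2

end LinearAlgebraicGroup

namespace LinearAlgebraicGroup

open MvPolynomial Zariski TopologicalSpace

attribute [local instance] zariskiTopology

/-! ### Products of linear algebraic groups -/

section Product

variable {m n : ℕ}

/-- The block diagonal matrix with blocks `A` and `B`. -/
def blockDiag {R : Type*} [Zero R] (A : Matrix (Fin m) (Fin m) R) (B : Matrix (Fin n) (Fin n) R) :
    Matrix (Fin (m + n)) (Fin (m + n)) R :=
  Matrix.reindex finSumFinEquiv finSumFinEquiv (Matrix.fromBlocks A 0 0 B)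

/-- Block diagonal matrices, as a homomorphism of monoids. -/
def blockDiagHom (m n : ℕ) (R : Type*) [CommRing R] :
    Matrix (Fin m) (Fin m) R × Matrix (Fin n) (Fin n) R →*
      Matrix (Fin (m + n)) (Fin (m + n)) R where
  toFun x := blockDiag x.1 x.2
  map_one' := by simp [blockDiag, Matrix.fromBlocks_one]
  map_mul' x y := by
    simp [blockDiag, Matrix.submatrix_mul_equiv, Matrix.fromBlocks_multiply]

theorem det_blockDiag {R : Type*} [CommRing R] (A : Matrix (Fin m) (Fin m) R)
    (B : Matrix (Fin n) (Fin n) R) : (blockDiag A B).det = A.det * B.det := by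
  rw [blockDiag, Matrix.det_reindex_self, Matrix.det_fromBlocks_zero₂₁]

/-- The embedding `GL_m × GL_n → GL_{m+n}` by block diagonal matrices. -/
def blockGL (m n : ℕ) : GL (Fin m) ℂ × GL (Fin n) ℂ →* GL (Fin (m + n)) ℂ :=
  (Units.map (blockDiagHom m n ℂ)).comp MulEquiv.prodUnits.symm.toMonoidHom

theorem coe_blockGL (x : GL (Fin m) ℂ × GL (Fin n) ℂ) :
    (blockGL m n x : Matrix (Fin (m + n)) (Fin (m + n)) ℂ) =
      blockDiag (x.1 : Matrix (Fin m) (Fin m) ℂ) (x.2 : Matrix (Fin n) (Fin n) ℂ) := rfl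

/-- The coordinates of a block diagonal matrix, as polynomials in those of its blocks. -/
noncomputable def blockPoly (m n : ℕ) :
    CoordIndex (m + n) → MvPolynomial (CoordIndex m ⊕ CoordIndex n) ℂ :=
  Sum.elim
    (fun ij => blockDiag ((genericMatrix m).map (rename Sum.inl))
      ((genericMatrix n).map (rename Sum.inr)) ij.1 ij.2)
    fun u => MvPolynomial.X (Sum.inl (Sum.inr u)) * MvPolynomial.X (Sum.inr (Sum.inr u))

/-- The coordinates of the upper left block `A` of a block diagonal matrix.  The inverse determinant
of `A` is that of the whole matrix times the determinant of the other block. -/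
noncomputable def fstPoly (m n : ℕ) : CoordIndex m → MvPolynomial (CoordIndex (m + n)) ℂ :=
  Sum.elim (fun ij => genericMatrix (m + n) (Fin.castAdd n ij.1) (Fin.castAdd n ij.2))
    fun u => MvPolynomial.X (Sum.inr u) *
      (Matrix.of fun i j : Fin n => genericMatrix (m + n) (Fin.natAdd m i) (Fin.natAdd m j)).det

/-- The coordinates of the lower right block of a block diagonal matrix. -/
noncomputable def sndPoly (m n : ℕ) : CoordIndex n → MvPolynomial (CoordIndex (m + n)) ℂ :=
  Sum.elim (fun ij => genericMatrix (m + n) (Fin.natAdd m ij.1) (Fin.natAdd m ij.2))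
    fun u => MvPolynomial.X (Sum.inr u) *
      (Matrix.of fun i j : Fin m => genericMatrix (m + n) (Fin.castAdd n i) (Fin.castAdd n j)).det

@[simp] theorem blockDiag_castAdd_castAdd {R : Type*} [Zero R] (A : Matrix (Fin m) (Fin m) R)
    (B : Matrix (Fin n) (Fin n) R) (i j : Fin m) :
    blockDiag A B (Fin.castAdd n i) (Fin.castAdd n j) = A i j := by
  simp [blockDiag]

@[simp] theorem blockDiag_castAdd_natAdd {R : Type*} [Zero R] (A : Matrix (Fin m) (Fin m) R)
    (B : Matrix (Fin n) (Fin n) R) (i : Fin m) (j : Fin n) :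
    blockDiag A B (Fin.castAdd n i) (Fin.natAdd m j) = 0 := by
  simp [blockDiag]

@[simp] theorem blockDiag_natAdd_castAdd {R : Type*} [Zero R] (A : Matrix (Fin m) (Fin m) R)
    (B : Matrix (Fin n) (Fin n) R) (i : Fin n) (j : Fin m) :
    blockDiag A B (Fin.natAdd m i) (Fin.castAdd n j) = 0 := by
  simp [blockDiag]

@[simp] theorem blockDiag_natAdd_natAdd {R : Type*} [Zero R] (A : Matrix (Fin m) (Fin m) R)
    (B : Matrix (Fin n) (Fin n) R) (i j : Fin n) :
    blockDiag A B (Fin.natAdd m i) (Fin.natAdd m j) = B i j := by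
  simp [blockDiag]

theorem det_coe_ne_zero (g : GL (Fin n) ℂ) : (g : Matrix (Fin n) (Fin n) ℂ).det ≠ 0 :=
  ((Matrix.isUnit_iff_isUnit_det _).1 g.isUnit).ne_zero

theorem polyMap_blockPoly (a : GL (Fin m) ℂ) (b : GL (Fin n) ℂ) :
    polyMap (blockPoly m n) (Sum.elim (glCoords a) (glCoords b)) =
      glCoords (blockGL m n (a, b)) := by
  ext (⟨i, j⟩ | u)
  · induction i using Fin.addCases <;> induction j using Fin.addCases <;>
      simp [polyMap, blockPoly, glCoords, coe_blockGL, genericMatrix]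
  · simp [polyMap, blockPoly, glCoords, coe_blockGL, det_blockDiag, mul_comm]

theorem polyMap_fstPoly (a : GL (Fin m) ℂ) (b : GL (Fin n) ℂ) :
    polyMap (fstPoly m n) (glCoords (blockGL m n (a, b))) = glCoords a := by
  ext (⟨i, j⟩ | u)
  · simp [polyMap, fstPoly, glCoords, coe_blockGL, genericMatrix]
  · have h : eval (glCoords (blockGL m n (a, b))) (Matrix.of fun i j : Fin n =>
        genericMatrix (m + n) (Fin.natAdd m i) (Fin.natAdd m j)).det =
        (b : Matrix (Fin n) (Fin n) ℂ).det := by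
      rw [RingHom.map_det]
      congr 1
      ext i j
      simp [genericMatrix, glCoords, coe_blockGL]
    have hb := det_coe_ne_zero b
    simp only [polyMap, fstPoly, Sum.elim_inr, map_mul, eval_X, h]
    simp [glCoords, coe_blockGL, det_blockDiag]
    field_simp

theorem polyMap_sndPoly (a : GL (Fin m) ℂ) (b : GL (Fin n) ℂ) :
    polyMap (sndPoly m n) (glCoords (blockGL m n (a, b))) = glCoords b := by
  ext (⟨i, j⟩ | u)
  · simp [polyMap, sndPoly, glCoords, coe_blockGL, genericMatrix]
  · have h : eval (glCoords (blockGL m n (a, b))) (Matrix.of fun i j : Fin m =>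
        genericMatrix (m + n) (Fin.castAdd n i) (Fin.castAdd n j)).det =
        (a : Matrix (Fin m) (Fin m) ℂ).det := by
      rw [RingHom.map_det]
      congr 1
      ext i j
      simp [genericMatrix, glCoords, coe_blockGL]
    have ha := det_coe_ne_zero a
    simp only [polyMap, sndPoly, Sum.elim_inr, map_mul, eval_X, h]
    simp [glCoords, coe_blockGL, det_blockDiag]
    field_simp

end Product

theorem glCoords_image_blockGL (G H : LinearAlgebraicGroup) :
    glCoords '' ((G.points.prod H.points).map (blockGL G.n H.n) : Set (GL (Fin (G.n + H.n)) ℂ)) =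
      polyMap (blockPoly G.n H.n) '' prodSet G.variety H.variety := by
  rw [prodSet_eq_image]
  ext z
  constructor
  · rintro ⟨_, ⟨⟨a, b⟩, ⟨ha, hb⟩, rfl⟩, rfl⟩
    exact ⟨_, ⟨(glCoords a, glCoords b), ⟨⟨a, ha, rfl⟩, ⟨b, hb, rfl⟩⟩, rfl⟩, polyMap_blockPoly a b⟩
  · rintro ⟨_, ⟨⟨_, _⟩, ⟨⟨a, ha, rfl⟩, ⟨b, hb, rfl⟩⟩, rfl⟩, rfl⟩
    exact ⟨_, ⟨(a, b), ⟨ha, hb⟩, rfl⟩, (polyMap_blockPoly a b).symm⟩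

/-- The product of two linear algebraic groups, embedded by block diagonal matrices. -/
noncomputable def prod (G H : LinearAlgebraicGroup) : LinearAlgebraicGroup where
  n := G.n + H.n
  points := (G.points.prod H.points).map (blockGL G.n H.n)
  isClosed := by
    change IsClosed _
    rw [glCoords_image_blockGL]
    have h1 := G.isClosed_variety.preimage (continuous_polyMap (fstPoly G.n H.n))
    have h2 := H.isClosed_variety.preimage (continuous_polyMap (sndPoly G.n H.n))
    have h3 := isClosed_setOf_forall_eval_eq_zero fun ij : Fin G.n × Fin H.n =>
      genericMatrix (G.n + H.n) (Fin.castAdd H.n ij.1) (Fin.natAdd G.n ij.2)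
    have h4 := isClosed_setOf_forall_eval_eq_zero fun ij : Fin H.n × Fin G.n =>
      genericMatrix (G.n + H.n) (Fin.natAdd G.n ij.1) (Fin.castAdd H.n ij.2)
    convert (h1.inter h2).inter (h3.inter h4) using 1
    ext z
    constructor
    · rw [← glCoords_image_blockGL]
      rintro ⟨_, ⟨⟨a, b⟩, ⟨ha, hb⟩, rfl⟩, rfl⟩
      refine ⟨⟨?_, ?_⟩, ?_, ?_⟩
      · rw [Set.mem_preimage, polyMap_fstPoly]
        exact ⟨a, ha, rfl⟩
      · rw [Set.mem_preimage, polyMap_sndPoly]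
        exact ⟨b, hb, rfl⟩
      · intro ij
        simp [genericMatrix, glCoords, coe_blockGL]
      · intro ij
        simp [genericMatrix, glCoords, coe_blockGL]
    · rintro ⟨⟨⟨a, ha, haz⟩, ⟨b, hb, hbz⟩⟩, h3, h4⟩
      rw [← glCoords_image_blockGL]
      refine ⟨_, ⟨(a, b), ⟨ha, hb⟩, rfl⟩, ?_⟩
      have hA : ∀ i j, (a : Matrix (Fin G.n) (Fin G.n) ℂ) i j =
          z (Sum.inl (Fin.castAdd H.n i, Fin.castAdd H.n j)) := fun i j => by
        have := congrFun haz (Sum.inl (i, j))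
        simpa [glCoords, polyMap, fstPoly, genericMatrix] using this
      have hB : ∀ i j, (b : Matrix (Fin H.n) (Fin H.n) ℂ) i j =
          z (Sum.inl (Fin.natAdd G.n i, Fin.natAdd G.n j)) := fun i j => by
        have := congrFun hbz (Sum.inl (i, j))
        simpa [glCoords, polyMap, sndPoly, genericMatrix] using this
      ext (⟨i, j⟩ | u)
      · induction i using Fin.addCases <;> induction j using Fin.addCases
        · simp [glCoords, coe_blockGL, hA]
        · simpa [glCoords, coe_blockGL, genericMatrix] using (h3 (_, _)).symm
        · simpa [glCoords, coe_blockGL, genericMatrix] using (h4 (_, _)).symm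
        · simp [glCoords, coe_blockGL, hB]
      · have := congrFun haz (Sum.inr u)
        simp only [glCoords, polyMap, fstPoly, Sum.elim_inr, map_mul, eval_X,
          RingHom.map_det] at this
        have hb' : (eval z).mapMatrix (Matrix.of fun i j : Fin H.n =>
            genericMatrix (G.n + H.n) (Fin.natAdd G.n i) (Fin.natAdd G.n j)) = b := by
          ext i j
          simp [genericMatrix, hB]
        rw [hb'] at this
        have hb0 := det_coe_ne_zero b
        simp only [glCoords, Sum.elim_inr, coe_blockGL, det_blockDiag, mul_inv, this]
        field_simp

section

variable (G H : LinearAlgebraicGroup)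

theorem variety_prod : (G.prod H).variety =
    polyMap (blockPoly G.n H.n) '' prodSet G.variety H.variety :=
  glCoords_image_blockGL G H

theorem isIrreducible_variety_prod (hG : _root_.IsIrreducible G.variety)
    (hH : _root_.IsIrreducible H.variety) : _root_.IsIrreducible (G.prod H).variety := by
  rw [variety_prod]
  exact (isIrreducible_prodSet hG hH).image _ (continuous_polyMap _).continuousOn

theorem dim_prod : (G.prod H).dim = G.dim + H.dim := by
  have h : zariskiDim (G.prod H).variety = zariskiDim (prodSet G.variety H.variety) := by
    have key : ∀ z ∈ prodSet G.variety H.variety, polyMap (Sum.elim (fstPoly G.n H.n)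
        (sndPoly G.n H.n)) (polyMap (blockPoly G.n H.n) z) = z := by
      rw [prodSet_eq_image]
      rintro _ ⟨⟨_, _⟩, ⟨⟨a, ha, rfl⟩, ⟨b, hb, rfl⟩⟩, rfl⟩
      rw [polyMap_blockPoly]
      ext (i | i)
      · exact congrFun (polyMap_fstPoly a b) i
      · exact congrFun (polyMap_sndPoly a b) i
    exact (congrArg zariskiDim (variety_prod G H)).trans (zariskiDim_image_polyMap _ _ key)
  rw [zariskiDim_variety] at h
  have h1 := zariskiDim_prodSet_le G.isClosed_variety H.isClosed_variety G.zariskiDim_variety.le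
    H.zariskiDim_variety.le
  have h2 := le_zariskiDim_prodSet G.isClosed_variety H.isClosed_variety G.zariskiDim_variety.ge
    H.zariskiDim_variety.ge
  exact_mod_cast h.trans (le_antisymm h1 h2)

/-- The coordinates of a pair of block diagonal matrices, as polynomials in those of the pairs of
upper left and of lower right blocks. -/
noncomputable def pairBlockPoly (m n : ℕ) : CoordIndex (m + n) ⊕ CoordIndex (m + n) →
    MvPolynomial ((CoordIndex m ⊕ CoordIndex m) ⊕ (CoordIndex n ⊕ CoordIndex n)) ℂ :=
  Sum.elim (fun i => rename (Sum.map Sum.inl Sum.inl) (blockPoly m n i))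
    fun i => rename (Sum.map Sum.inr Sum.inr) (blockPoly m n i)

/-- The coordinates of the pairs of blocks of a pair of block diagonal matrices. -/
noncomputable def pairUnblockPoly (m n : ℕ) :
    (CoordIndex m ⊕ CoordIndex m) ⊕ (CoordIndex n ⊕ CoordIndex n) →
      MvPolynomial (CoordIndex (m + n) ⊕ CoordIndex (m + n)) ℂ :=
  Sum.elim
    (Sum.elim (fun i => rename Sum.inl (fstPoly m n i)) fun i => rename Sum.inr (fstPoly m n i))
    (Sum.elim (fun i => rename Sum.inl (sndPoly m n i)) fun i => rename Sum.inr (sndPoly m n i))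

theorem polyMap_pairBlockPoly {m n : ℕ} (a a' : GL (Fin m) ℂ) (b b' : GL (Fin n) ℂ) :
    polyMap (pairBlockPoly m n) (Sum.elim (glPairCoords (a, a')) (glPairCoords (b, b'))) =
      glPairCoords (blockGL m n (a, b), blockGL m n (a', b')) := by
  unfold glPairCoords
  ext (i | i)
  · simp only [polyMap, pairBlockPoly, Sum.elim_inl, eval_rename, ← polyMap_blockPoly]
    congr 2
    ext (j | j) <;> rfl
  · simp only [polyMap, pairBlockPoly, Sum.elim_inr, eval_rename, ← polyMap_blockPoly]
    congr 2
    ext (j | j) <;> rfl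

theorem polyMap_pairUnblockPoly {m n : ℕ} (a a' : GL (Fin m) ℂ) (b b' : GL (Fin n) ℂ) :
    polyMap (pairUnblockPoly m n) (glPairCoords (blockGL m n (a, b), blockGL m n (a', b'))) =
      Sum.elim (glPairCoords (a, a')) (glPairCoords (b, b')) := by
  unfold glPairCoords
  ext ((i | i) | (i | i))
  · simp only [polyMap, pairUnblockPoly, Sum.elim_inl, eval_rename, Sum.elim_comp_inl]
    exact congrFun (polyMap_fstPoly a b) i
  · simp only [polyMap, pairUnblockPoly, Sum.elim_inl, Sum.elim_inr, eval_rename, Sum.elim_comp_inr]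
    exact congrFun (polyMap_fstPoly a' b') i
  · simp only [polyMap, pairUnblockPoly, Sum.elim_inl, Sum.elim_inr, eval_rename, Sum.elim_comp_inl]
    exact congrFun (polyMap_sndPoly a b) i
  · simp only [polyMap, pairUnblockPoly, Sum.elim_inr, eval_rename, Sum.elim_comp_inr]
    exact congrFun (polyMap_sndPoly a' b') i

theorem blockGL_injective (m n : ℕ) : Function.Injective (blockGL m n) := by
  rintro ⟨a, b⟩ ⟨c, d⟩ h
  refine Prod.ext (glCoords_injective ?_) (glCoords_injective ?_)
  · rw [← polyMap_fstPoly a b, h, polyMap_fstPoly]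
  · rw [← polyMap_sndPoly a b, h, polyMap_sndPoly]

theorem commutingVariety_prod : (G.prod H).commutingVariety =
    polyMap (pairBlockPoly G.n H.n) '' prodSet G.commutingVariety H.commutingVariety := by
  rw [prodSet_eq_image]
  ext z
  constructor
  · rintro ⟨⟨_, _⟩, ⟨⟨⟨a, b⟩, ⟨ha, hb⟩, rfl⟩, ⟨⟨a', b'⟩, ⟨ha', hb'⟩, rfl⟩, hcomm⟩, rfl⟩
    have hc : (a, b) * (a', b') = (a', b') * (a, b) := by
      apply blockGL_injective
      rw [map_mul, map_mul]
      exact hcomm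
    rw [Prod.mk_mul_mk, Prod.mk_mul_mk, Prod.mk.injEq] at hc
    exact ⟨_, ⟨(glPairCoords (a, a'), glPairCoords (b, b')), ⟨⟨_, ⟨ha, ha', hc.1⟩, rfl⟩,
      ⟨_, ⟨hb, hb', hc.2⟩, rfl⟩⟩, rfl⟩, polyMap_pairBlockPoly a a' b b'⟩
  · rintro ⟨_, ⟨⟨_, _⟩, ⟨⟨⟨a, a'⟩, ⟨ha, ha', hac⟩, rfl⟩, ⟨⟨b, b'⟩, ⟨hb, hb', hbc⟩, rfl⟩⟩, rfl⟩, rfl⟩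
    refine ⟨_, ⟨⟨(a, b), ⟨ha, hb⟩, rfl⟩, ⟨(a', b'), ⟨ha', hb'⟩, rfl⟩, ?_⟩,
      (polyMap_pairBlockPoly a a' b b').symm⟩
    change blockGL _ _ (a, b) * blockGL _ _ (a', b') = blockGL _ _ (a', b') * blockGL _ _ (a, b)
    rw [← map_mul, ← map_mul, Prod.mk_mul_mk, Prod.mk_mul_mk]
    exact congrArg _ (Prod.ext hac hbc)

theorem commutingDim_prod : (G.prod H).commutingDim = G.commutingDim + H.commutingDim := by
  have h : zariskiDim (G.prod H).commutingVariety =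
      zariskiDim (prodSet G.commutingVariety H.commutingVariety) := by
    have key : ∀ z ∈ prodSet G.commutingVariety H.commutingVariety,
        polyMap (pairUnblockPoly G.n H.n) (polyMap (pairBlockPoly G.n H.n) z) = z := by
      rw [prodSet_eq_image]
      rintro _ ⟨⟨_, _⟩, ⟨⟨⟨a, a'⟩, -, rfl⟩, ⟨⟨b, b'⟩, -, rfl⟩⟩, rfl⟩
      rw [polyMap_pairBlockPoly, polyMap_pairUnblockPoly]
    exact (congrArg zariskiDim (commutingVariety_prod G H)).trans
      (zariskiDim_image_polyMap _ _ key)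
  rw [zariskiDim_commutingVariety] at h
  have h1 := zariskiDim_prodSet_le G.isClosed_commutingVariety H.isClosed_commutingVariety
    G.zariskiDim_commutingVariety.le H.zariskiDim_commutingVariety.le
  have h2 := le_zariskiDim_prodSet G.isClosed_commutingVariety H.isClosed_commutingVariety
    G.zariskiDim_commutingVariety.ge H.zariskiDim_commutingVariety.ge
  exact_mod_cast h.trans (le_antisymm h1 h2)

theorem isNilpotent_prod (hG : G.IsNilpotent) (hH : H.IsNilpotent) : (G.prod H).IsNilpotent := by
  unfold IsNilpotent at *
  let f : G.points × H.points →* (G.prod H).points :=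
    ((blockGL G.n H.n).comp (G.points.subtype.prodMap H.points.subtype)).codRestrict _ fun x =>
      ⟨(x.1.1, x.2.1), ⟨x.1.2, x.2.2⟩, rfl⟩
  refine Group.nilpotent_of_surjective f ?_
  rintro ⟨_, ⟨a, b⟩, ⟨ha, hb⟩, rfl⟩
  exact ⟨(⟨a, ha⟩, ⟨b, hb⟩), rfl⟩

end

/-! ### Normal subgroups of unipotent elements -/

/-- Every subgroup of unipotent elements that is normalized by `S` is trivial, whether closed and
connected or not. Unlike reductivity, this property is visibly inherited by products. -/
def HasNoUnipotentNormalSubgroup {n : ℕ} (S : Subgroup (GL (Fin n) ℂ)) : Prop :=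
  ∀ U ≤ S, (∀ g ∈ S, ∀ u ∈ U, g * u * g⁻¹ ∈ U) →
    (∀ u ∈ U, _root_.IsNilpotent ((u : Matrix (Fin n) (Fin n) ℂ) - 1)) → U = ⊥

theorem HasNoUnipotentNormalSubgroup.isReductive {G : LinearAlgebraicGroup}
    (h : HasNoUnipotentNormalSubgroup G.points) : G.IsReductive := by
  intro U hU _ _ hn hu
  refine h U hU (fun g hg u huU => ?_) hu
  exact hn.conj_mem ⟨u, hU huU⟩ huU ⟨g, hg⟩

theorem blockDiag_sub_one_pow {m n : ℕ} (A : Matrix (Fin m) (Fin m) ℂ)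
    (B : Matrix (Fin n) (Fin n) ℂ) (k : ℕ) :
    (blockDiag A B - 1) ^ k = blockDiag ((A - 1) ^ k) ((B - 1) ^ k) := by
  have h : blockDiag A B - 1 = blockDiag (A - 1) (B - 1) := by
    have h1 : (1 : Matrix (Fin (m + n)) (Fin (m + n)) ℂ) = blockDiag 1 1 :=
      ((blockDiagHom m n ℂ).map_one).symm
    rw [h1]
    ext i j
    induction i using Fin.addCases <;> induction j using Fin.addCases <;> simp
  rw [h]
  exact ((blockDiagHom m n ℂ).map_pow (A - 1, B - 1) k).symm

/-- A normal subgroup of unipotent elements of a product has trivial projections to the factors. -/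
theorem HasNoUnipotentNormalSubgroup.map_blockGL {m n : ℕ} {S : Subgroup (GL (Fin m) ℂ)}
    {T : Subgroup (GL (Fin n) ℂ)} (hS : HasNoUnipotentNormalSubgroup S)
    (hT : HasNoUnipotentNormalSubgroup T) :
    HasNoUnipotentNormalSubgroup ((S.prod T).map (blockGL m n)) := by
  intro U hU hconj hunip
  have hnil : ∀ a b, blockGL m n (a, b) ∈ U →
      _root_.IsNilpotent ((a : Matrix (Fin m) (Fin m) ℂ) - 1) ∧
        _root_.IsNilpotent ((b : Matrix (Fin n) (Fin n) ℂ) - 1) := by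
    intro a b hab
    obtain ⟨k, hk⟩ := hunip _ hab
    rw [coe_blockGL, blockDiag_sub_one_pow] at hk
    refine ⟨⟨k, ?_⟩, ⟨k, ?_⟩⟩
    · ext i j
      simpa using congrFun (congrFun hk (Fin.castAdd _ i)) (Fin.castAdd _ j)
    · ext i j
      simpa using congrFun (congrFun hk (Fin.natAdd _ i)) (Fin.natAdd _ j)
  have hmem : ∀ a b, blockGL m n (a, b) ∈ U → a ∈ S ∧ b ∈ T := by
    intro a b hab
    obtain ⟨⟨a', b'⟩, h, heq⟩ := hU hab
    have := blockGL_injective _ _ heq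
    rw [Prod.mk.injEq] at this
    exact ⟨this.1 ▸ h.1, this.2 ▸ h.2⟩
  have hconj' : ∀ x ∈ S.prod T, ∀ y, blockGL m n y ∈ U → blockGL m n (x * y * x⁻¹) ∈ U := by
    intro x hx y hy
    rw [map_mul, map_mul, map_inv]
    exact hconj _ ⟨x, hx, rfl⟩ _ hy
  have h1 := hS ((U.comap (blockGL m n)).map (MonoidHom.fst _ _))
    (by rintro _ ⟨⟨a, b⟩, hab, rfl⟩; exact (hmem a b hab).1)
    (by
      rintro g hg _ ⟨⟨a, b⟩, hab, rfl⟩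
      exact ⟨(g, 1) * (a, b) * (g, 1)⁻¹, hconj' (g, 1) ⟨hg, T.one_mem⟩ _ hab, by simp⟩)
    (by rintro _ ⟨⟨a, b⟩, hab, rfl⟩; exact (hnil a b hab).1)
  have h2 := hT ((U.comap (blockGL m n)).map (MonoidHom.snd _ _))
    (by rintro _ ⟨⟨a, b⟩, hab, rfl⟩; exact (hmem a b hab).2)
    (by
      rintro g hg _ ⟨⟨a, b⟩, hab, rfl⟩
      exact ⟨(1, g) * (a, b) * (1, g)⁻¹, hconj' (1, g) ⟨S.one_mem, hg⟩ _ hab, by simp⟩)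
    (by rintro _ ⟨⟨a, b⟩, hab, rfl⟩; exact (hnil a b hab).2)
  rw [eq_bot_iff]
  intro u hu
  obtain ⟨⟨a, b⟩, -, rfl⟩ := hU hu
  have ha : a = 1 := Subgroup.mem_bot.1 (h1 ▸ ⟨(a, b), hu, rfl⟩)
  have hb : b = 1 := Subgroup.mem_bot.1 (h2 ▸ ⟨(a, b), hu, rfl⟩)
  rw [ha, hb, Subgroup.mem_bot]
  exact map_one _

/-! ### Realizing rational numbers -/

/-- The group of `0 × 0` matrices. -/
noncomputable def trivial : LinearAlgebraicGroup where
  n := 0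
  points := ⊤
  isClosed := by
    change IsClosed _
    have : glCoords '' ((⊤ : Subgroup (GL (Fin 0) ℂ)) : Set (GL (Fin 0) ℂ)) =
        {x | eval x (MvPolynomial.X (Sum.inr ()) - 1 : MvPolynomial (CoordIndex 0) ℂ) = 0} := by
      ext x
      constructor
      · rintro ⟨g, -, rfl⟩
        simp [glCoords]
      · intro hx
        refine ⟨1, Subgroup.mem_top _, ?_⟩
        ext (⟨i, j⟩ | u)
        · exact i.elim0
        · have : x (Sum.inr ()) = 1 := by simpa [sub_eq_zero] using hx
          rw [this]
          simp [glCoords]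
    rw [this]
    exact isClosed_setOf_eval_eq_zero _

theorem variety_trivial : trivial.variety = {glCoords 1} := by
  ext x
  constructor
  · rintro ⟨g, -, rfl⟩
    exact congrArg glCoords (Subsingleton.elim (α := GL (Fin 0) ℂ) g 1)
  · rintro rfl
    exact ⟨1, Subgroup.mem_top _, rfl⟩

theorem dim_trivial : trivial.dim = 0 := by
  have h := (zariskiDim_variety trivial).symm.le.trans
    ((zariskiDim_mono variety_trivial.le).trans (zariskiDim_singleton_le _))
  exact Nat.le_zero.1 (by exact_mod_cast h)

theorem commutingDim_trivial : trivial.commutingDim = 0 := by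
  have := trivial.commutingDim_le
  rw [dim_trivial] at this
  omega

/-- The pairs `(dim G, dim C(G))` for the irreducible groups `G` with a property that holds for the
trivial group and is inherited by products form a monoid. -/
def dimPairs (P : LinearAlgebraicGroup → Prop) (h1 : P trivial)
    (hmul : ∀ G H, P G → P H → P (G.prod H)) : AddSubmonoid (ℕ × ℕ) where
  carrier := {d | ∃ G : LinearAlgebraicGroup, _root_.IsIrreducible G.variety ∧ P G ∧
    (G.dim, G.commutingDim) = d}
  zero_mem' := ⟨trivial, by rw [variety_trivial]; exact isIrreducible_singleton, h1, by
    rw [dim_trivial, commutingDim_trivial]; rfl⟩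
  add_mem' := by
    rintro _ _ ⟨G, hG, hPG, rfl⟩ ⟨H, hH, hPH, rfl⟩
    exact ⟨G.prod H, isIrreducible_variety_prod G H hG hH, hmul _ _ hPG hPH, by
      rw [dim_prod, commutingDim_prod]; rfl⟩

/-- If the property `P` holds for a one-dimensional commutative group and for groups whose commuting
probability comes close to `1 / 2`, then products of powers of these realize each rational number
in `(1 / 2, 1]`. -/
theorem subset_commutingProbabilities (P : LinearAlgebraicGroup → Prop) (h1 : P trivial)
    (hmul : ∀ G H, P G → P H → P (G.prod H)) (hT : (1, 2) ∈ dimPairs P h1 hmul)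
    (hsmall : ∀ ε : ℝ, 0 < ε → ∃ d c : ℕ, 0 < d ∧ (d, c) ∈ dimPairs P h1 hmul ∧
      (c : ℝ) ≤ (1 / 2 + ε) * (2 * d)) :
    Set.range ((↑) : ℚ → ℝ) ∩ Set.Ioc (1 / 2) 1 ⊆ commutingProbabilities P := by
  rintro _ ⟨⟨r, rfl⟩, hr, hr1⟩
  have key : ∀ d c : ℕ, 0 < d → (d, c) ∈ dimPairs P h1 hmul → (c : ℝ) = r * (2 * d) →
      (r : ℝ) ∈ commutingProbabilities P := by
    rintro d c hd ⟨G, hG, hPG, hdc⟩ hc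
    rw [Prod.mk.injEq] at hdc
    refine ⟨G, hG.isConnected, hPG, ?_⟩
    rw [commutingProbability, if_neg (by omega), hdc.1, hdc.2, hc]
    have : (d : ℝ) ≠ 0 := by exact_mod_cast hd.ne'
    field_simp
  obtain ⟨d, c, hd, hmem, hc⟩ := hsmall (r - 1 / 2) (by linarith)
  have hc' : (c : ℝ) ≤ r * (2 * d) := by linarith
  -- Write `r = u / v` with `v = r.den`.
  have hv : 0 < r.den := r.pos
  have hrv : (r : ℝ) = r.num / r.den := by exact_mod_cast (Rat.num_div_den r).symm
  have hvR : (0 : ℝ) < r.den := by exact_mod_cast hv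
  have hnum : 0 ≤ r.num := by
    rw [Rat.num_nonneg]
    have : (0 : ℝ) < r := by linarith
    exact_mod_cast this.le
  obtain ⟨u, hu⟩ := Int.eq_ofNat_of_zero_le hnum
  have hruv : (r : ℝ) = u / r.den := by rw [hrv, hu]; simp
  generalize r.den = v at hv hvR hruv
  rw [hruv] at hc' hr1
  have huv : u ≤ v := by
    rw [div_le_one hvR] at hr1
    exact_mod_cast hr1
  rcases huv.eq_or_lt with rfl | hlt
  · refine key 1 2 one_pos hT ?_
    rw [hruv, div_self hvR.ne']
    norm_num
  -- Write `v = u + e`.  The pair `2 e • (d, c) + b • (1, 2)` has ratio `u / v` for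
  -- `b = 2 u d - v c`, which is not negative because `c / (2 d) ≤ u / v`.
  · have hle : v * c ≤ 2 * u * d := by
      rw [div_mul_eq_mul_div, le_div_iff₀ hvR] at hc'
      have : ((v * c : ℕ) : ℝ) ≤ (2 * u * d : ℕ) := by push_cast; linarith
      exact_mod_cast this
    obtain ⟨e, rfl⟩ := Nat.exists_eq_add_of_le hlt.le
    obtain ⟨b, hb⟩ := Nat.exists_eq_add_of_le hle
    have hmem' := (dimPairs P h1 hmul).add_mem ((dimPairs P h1 hmul).nsmul_mem hmem (2 * e))
      ((dimPairs P h1 hmul).nsmul_mem hT b)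
    refine key (2 * e * d + b) (2 * e * c + b * 2) ?_ (by simpa using hmem') ?_
    · have : 0 < e := by omega
      positivity
    · have hbR : (2 * u * d : ℝ) = (u + e) * c + b := by exact_mod_cast hb
      rw [hruv]
      push_cast at hvR ⊢
      field_simp
      linear_combination (-(e : ℝ)) * hbR

theorem isNilpotent_trivial : trivial.IsNilpotent := by
  unfold IsNilpotent
  have : Subsingleton trivial.points := ⟨fun a b =>
    Subtype.ext (Subsingleton.elim (α := GL (Fin 0) ℂ) a.1 b.1)⟩
  infer_instance

theorem hasNoUnipotentNormalSubgroup_trivial : HasNoUnipotentNormalSubgroup trivial.points :=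
  fun U _ _ _ => (Subgroup.eq_bot_iff_forall U).2 fun u _ =>
    Subsingleton.elim (α := GL (Fin 0) ℂ) u 1

end LinearAlgebraicGroup

/-! ### Commuting matrices over extension fields -/

section CommutingMatrices

variable {K : Type} [Field K]

open Polynomial in
/-- The structure theorem for modules over `K[X]`: every endomorphism is, in a suitable basis, a
block diagonal matrix of companion matrices. -/
theorem exists_basis_toMatrix_companion {n : ℕ} (f : Module.End K (Fin n → K)) :
    ∃ (b : Module.Basis (Fin n) K (Fin n → K)) (T : Finset K), T.card ≤ n ∧
      ∀ i j, LinearMap.toMatrix b b f i j ∈ (T : Set K) ∪ {0, 1} ∨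
        -LinearMap.toMatrix b b f i j ∈ T := by
  classical
  obtain ⟨ι, _, p, hp, e, ⟨E⟩⟩ := Module.equiv_directSum_of_isTorsion
    (Module.AEval.isTorsion_of_finiteDimensional K (Fin n → K) f)
  let q : ι → K[X] := fun i => p i ^ e i
  have hq : ∀ i, q i ≠ 0 := fun i => pow_ne_zero _ (hp i).ne_zero
  let pb : ∀ i, PowerBasis K (AdjoinRoot (q i)) := fun i => AdjoinRoot.powerBasis (hq i)
  let B : Module.Basis (Σ i, Fin (pb i).dim) K (Π₀ i, AdjoinRoot (q i)) :=
    DFinsupp.basis fun i => (pb i).basis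
  have hB : ∀ (w : Π₀ i, AdjoinRoot (q i)) (s : Σ i, Fin (pb i).dim),
      B.repr w s = (pb s.1).basis.repr (w s.1) s.2 := fun w s => rfl
  let E' : (Fin n → K) ≃ₗ[K] Π₀ i, AdjoinRoot (q i) :=
    (Module.AEval'.of f).trans (E.restrictScalars K)
  have hE : ∀ v i, E' (f v) i = AdjoinRoot.root (q i) * E' v i := by
    intro v i
    have h1 : E' (f v) = (X : K[X]) • (E (Module.AEval'.of f v)) := by
      rw [← map_smul, Module.AEval'.X_smul_of]
      rfl
    rw [h1]
    rfl
  let b₀ := B.map E'.symm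
  have hcard : Fintype.card (Σ i, Fin (pb i).dim) = n := by
    rw [← Module.finrank_eq_card_basis b₀, Module.finrank_fin_fun]
  let ε : (Σ i, Fin (pb i).dim) ≃ Fin n := Fintype.equivFinOfCardEq hcard
  refine ⟨b₀.reindex ε, Finset.univ.image fun s : Σ i, Fin (pb i).dim =>
    (pb s.1).minpolyGen.coeff s.2, ?_, fun i j => ?_⟩
  · exact Finset.card_image_le.trans (by rw [Finset.card_univ, hcard])
  · obtain ⟨⟨i, a⟩, rfl⟩ := ε.surjective i
    obtain ⟨⟨j, c⟩, rfl⟩ := ε.surjective j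
    have hentry : LinearMap.toMatrix (b₀.reindex ε) (b₀.reindex ε) f (ε ⟨i, a⟩) (ε ⟨j, c⟩) =
        (pb i).basis.repr (AdjoinRoot.root (q i) * B ⟨j, c⟩ i) a := by
      rw [LinearMap.toMatrix_apply]
      simp only [Module.Basis.repr_reindex_apply, Equiv.symm_apply_apply,
        Module.Basis.reindex_apply, b₀, Module.Basis.map_repr, LinearEquiv.trans_apply,
        LinearEquiv.symm_symm, Module.Basis.map_apply, hB, hE, LinearEquiv.apply_symm_apply]
    rw [hentry]
    by_cases hij : j = i
    · subst hij
      have h1 : B ⟨j, c⟩ j = (pb j).basis c := by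
        apply (pb j).basis.repr.injective
        ext d
        rw [← hB _ ⟨j, d⟩, Module.Basis.repr_self, Module.Basis.repr_self, Finsupp.single_apply,
          Finsupp.single_apply]
        simp
      have h2 := Algebra.leftMulMatrix_eq_repr_mul (pb j).basis (pb j).gen a c
      rw [PowerBasis.leftMulMatrix] at h2
      have h3 : (pb j).gen = AdjoinRoot.root (q j) := AdjoinRoot.powerBasis_gen _
      rw [h1, ← h3, ← h2, Matrix.of_apply]
      split_ifs
      · right
        simp only [neg_neg, Finset.mem_image, Finset.mem_univ, true_and]
        exact ⟨⟨j, a⟩, rfl⟩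
      · simp
      · simp
    · have h1 : B ⟨j, c⟩ i = 0 := by
        apply (pb i).basis.repr.injective
        ext d
        rw [← hB _ ⟨i, d⟩]
        simp [hij]
      rw [h1]
      simp

/-- A subspace of a coordinate space projects isomorphically to a suitable coordinate subspace: a
minimal set of coordinates that separates the points of the subspace will do. -/
theorem exists_finset_coordinates {I : Type} [Fintype I] [DecidableEq I] (W : Submodule K (I → K)) :
    ∃ (S : Finset I) (u : I → I → K), (∀ w ∈ W, (∀ s ∈ S, w s = 0) → w = 0) ∧
      ∀ s ∈ S, u s ∈ W ∧ u s s = 1 ∧ ∀ t ∈ S, t ≠ s → u s t = 0 := by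
  let P : Finset I → Prop := fun S => ∀ w ∈ W, (∀ s ∈ S, w s = 0) → w = 0
  have hP : P Finset.univ := fun w _ h => funext fun i => h i (Finset.mem_univ i)
  obtain ⟨S, hS⟩ := exists_minimal_of_wellFoundedLT P ⟨_, hP⟩
  have hu : ∀ s, ∃ u : I → K, s ∈ S → u ∈ W ∧ u s = 1 ∧ ∀ t ∈ S, t ≠ s → u t = 0 := by
    intro s
    by_cases hs : s ∈ S
    · have hnot : ¬ P (S.erase s) := fun h =>
        Finset.notMem_erase s S (hS.le_of_le h (Finset.erase_subset s S) hs)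
      simp only [P] at hnot
      push Not at hnot
      obtain ⟨w, hw, hw0, hne⟩ := hnot
      have hws : w s ≠ 0 := fun h0 => hne <| hS.prop w hw fun t ht => by
        by_cases hts : t = s
        · rwa [hts]
        · exact hw0 t (Finset.mem_erase.2 ⟨hts, ht⟩)
      exact ⟨(w s)⁻¹ • w, fun _ => ⟨W.smul_mem _ hw, by simp [hws], fun t ht hts => by
        simp [hw0 t (Finset.mem_erase.2 ⟨hts, ht⟩)]⟩⟩
    · exact ⟨0, fun h => absurd h hs⟩
  choose u hu using hu
  exact ⟨S, u, hS.prop, hu⟩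

variable [Algebra ℂ K]

/-- Two commuting `n × n` matrices over an extension field of `ℂ` have all entries in a subfield
generated by `n + n ^ 2` elements.  In a suitable basis the first matrix has at most `n` entries
other than `0`, `1`; the base change matrix can be chosen in an affine family with as many
complex coordinates as the dimension of the centralizer, and this is also the number of
parameters for the second matrix. -/
theorem exists_finset_entries_mem_adjoin {n : ℕ} {x y : Matrix (Fin n) (Fin n) K}
    (hxy : x * y = y * x) : ∃ T : Finset K, T.card ≤ n + n * n ∧
      (∀ i j, x i j ∈ IntermediateField.adjoin ℂ (T : Set K)) ∧
      ∀ i j, y i j ∈ IntermediateField.adjoin ℂ (T : Set K) := by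
  classical
  obtain ⟨b, T₁, hT₁, hJ⟩ := exists_basis_toMatrix_companion (Matrix.toLin' x)
  set J := LinearMap.toMatrix b b (Matrix.toLin' x) with hJdef
  let g : Matrix (Fin n) (Fin n) K := (Pi.basisFun K (Fin n)).toMatrix b
  have hxg : x * g = g * J := by
    have h1 : LinearMap.toMatrix (Pi.basisFun K (Fin n)) (Pi.basisFun K (Fin n)) (Matrix.toLin' x) =
        x := by
      rw [← Matrix.toLin_eq_toLin', LinearMap.toMatrix_toLin]
    have h2 := linearMap_toMatrix_mul_basis_toMatrix b (Pi.basisFun K (Fin n))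
      (Pi.basisFun K (Fin n)) (Matrix.toLin' x)
    have h3 := basis_toMatrix_mul_linearMap_toMatrix b (Pi.basisFun K (Fin n)) b
      (Matrix.toLin' x)
    rw [h1] at h2
    rw [h2, h3]
  have hg : g.det ≠ 0 := by
    have : IsUnit g.det := Module.Basis.isUnit_det _ b
    exact this.ne_zero
  -- The solutions `h` of `x h = h J`.
  let W : Submodule K (Fin n × Fin n → K) :=
    { carrier := {w | x * Matrix.of (fun i j => w (i, j)) = Matrix.of (fun i j => w (i, j)) * J}
      zero_mem' := by
        have : (Matrix.of fun i j => (0 : Fin n × Fin n → K) (i, j)) = 0 := rfl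
        simp only [Set.mem_ofPred_eq, this, mul_zero, zero_mul]
      add_mem' := by
        intro v w hv hw
        have : (Matrix.of fun i j => (v + w) (i, j)) =
          (Matrix.of fun i j => v (i, j)) + Matrix.of fun i j => w (i, j) := rfl
        simp only [Set.mem_ofPred_eq] at hv hw ⊢
        rw [this, mul_add, add_mul, hv, hw]
      smul_mem' := by
        intro c w hw
        have : (Matrix.of fun i j => (c • w) (i, j)) = c • Matrix.of fun i j => w (i, j) := rfl
        simp only [Set.mem_ofPred_eq] at hw ⊢
        rw [this, mul_smul_comm, smul_mul_assoc, hw] }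
  have hWmem : ∀ w : Matrix (Fin n) (Fin n) K, (fun ij : Fin n × Fin n => w ij.1 ij.2) ∈ W ↔
      x * w = w * J := fun w => Iff.rfl
  obtain ⟨S, u, hinj, hu⟩ := exists_finset_coordinates W
  have hext : ∀ v ∈ W, ∀ w ∈ W, (∀ s ∈ S, v s = w s) → v = w := fun v hv w hw h =>
    sub_eq_zero.1 (hinj _ (W.sub_mem hv hw) fun s hs => sub_eq_zero.2 (h s hs))
  let comb : (Fin n × Fin n → K) → Fin n × Fin n → K := fun c => ∑ s ∈ S, c s • u s
  have hcombW : ∀ c, comb c ∈ W := fun c => W.sum_mem fun s hs => W.smul_mem _ (hu s hs).1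
  have hcombS : ∀ c, ∀ s ∈ S, comb c s = c s := by
    intro c s hs
    simp only [comb, Finset.sum_apply, Pi.smul_apply, smul_eq_mul]
    rw [Finset.sum_eq_single s]
    · rw [(hu s hs).2.1, mul_one]
    · intro t ht hts
      rw [(hu t ht).2.2 s hs hts.symm, mul_zero]
    · exact fun h => absurd hs h
  -- An invertible solution whose coordinates in `S` are complex numbers.
  obtain ⟨c, hc⟩ : ∃ c : Fin n × Fin n → ℂ,
      (Matrix.of fun i j => comb (fun s => algebraMap ℂ K (c s)) (i, j)).det ≠ 0 := by
    let D : MvPolynomial (Fin n × Fin n) K :=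
      (Matrix.of fun i j : Fin n => ∑ s ∈ S, MvPolynomial.X s * MvPolynomial.C (u s (i, j))).det
    have hD : ∀ c, MvPolynomial.eval c D = (Matrix.of fun i j => comb c (i, j)).det := by
      intro c
      simp only [D, RingHom.map_det]
      congr 1
      ext i j
      simp [comb]
    by_contra! hcon
    have hD0 : D = 0 := by
      refine MvPolynomial.funext_set (fun _ => Set.range (algebraMap ℂ K))
        (fun _ => Set.infinite_range_of_injective (algebraMap ℂ K).injective) fun z hz => ?_
      choose c hc using fun s => hz s (Set.mem_univ s)
      rw [hD, map_zero, ← hcon c]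
      simp only [hc]
    apply hg
    have hgW : (fun ij : Fin n × Fin n => g ij.1 ij.2) ∈ W := hxg
    have := hD fun ij => g ij.1 ij.2
    rw [hD0, map_zero, hext _ (hcombW _) _ hgW (hcombS _)] at this
    exact this.symm
  set h : Matrix (Fin n) (Fin n) K :=
    Matrix.of fun i j => comb (fun s => algebraMap ℂ K (c s)) (i, j) with hh
  have hhW : x * h = h * J := hcombW _
  let w := y * h
  have hwW : x * w = w * J := by
    simp only [w]
    rw [← mul_assoc, hxy, mul_assoc, hhW, mul_assoc]
  let T₂ : Finset K := Sᶜ.image fun s => h s.1 s.2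
  let T₃ : Finset K := S.image fun s => w s.1 s.2
  refine ⟨T₁ ∪ (T₂ ∪ T₃), ?_, ?_⟩
  · have h2 : T₂.card ≤ Sᶜ.card := Finset.card_image_le
    have h3 : T₃.card ≤ S.card := Finset.card_image_le
    have h4 : Sᶜ.card + S.card = n * n := by
      rw [add_comm, Finset.card_add_card_compl]
      simp
    have h5 := Finset.card_union_le T₁ (T₂ ∪ T₃)
    have h6 := Finset.card_union_le T₂ T₃
    omega
  set L := IntermediateField.adjoin ℂ ((T₁ ∪ (T₂ ∪ T₃) : Finset K) : Set K) with hL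
  have hsub : ∀ t ∈ T₁ ∪ (T₂ ∪ T₃), t ∈ L := fun t ht =>
    IntermediateField.subset_adjoin _ _ (Finset.mem_coe.2 ht)
  have hJL : ∀ i j, J i j ∈ L := by
    intro i j
    rcases hJ i j with (h | h | h) | h
    · exact hsub _ (Finset.mem_union_left _ h)
    · rw [h]; exact L.zero_mem
    · rw [h]; exact L.one_mem
    · rw [← neg_neg (J i j)]
      exact L.neg_mem (hsub _ (Finset.mem_union_left _ h))
  have hhL : ∀ i j, h i j ∈ L := by
    intro i j
    by_cases hs : (i, j) ∈ S
    · have : h i j = algebraMap ℂ K (c (i, j)) := hcombS _ _ hs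
      rw [this]
      exact L.algebraMap_mem _
    · exact hsub _ (Finset.mem_union_right _ (Finset.mem_union_left _
        (Finset.mem_image.2 ⟨(i, j), Finset.mem_compl.2 hs, rfl⟩)))
  -- Lift everything to matrices over `L`.
  let J' : Matrix (Fin n) (Fin n) L := Matrix.of fun i j => ⟨J i j, hJL i j⟩
  let h' : Matrix (Fin n) (Fin n) L := Matrix.of fun i j => ⟨h i j, hhL i j⟩
  let φ : L →+* K := algebraMap L K
  have hJ' : J'.map φ = J := by ext i j; rfl
  have hh' : h'.map φ = h := by ext i j; rfl
  have hdet : IsUnit h'.det := by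
    rw [isUnit_iff_ne_zero]
    intro h0
    apply hc
    rw [← hh']
    exact (RingHom.map_det φ h').symm.trans (by rw [h0, map_zero])
  have hinv : h * (h'⁻¹).map φ = 1 := by
    rw [← hh', ← Matrix.map_mul, Matrix.mul_nonsing_inv _ hdet]
    simp
  have hxL : x = (h' * J' * h'⁻¹).map φ := by
    rw [Matrix.map_mul, Matrix.map_mul, hJ', hh', ← hhW, mul_assoc, hinv, mul_one]
  -- A linear retraction of `K` onto `L` shows that the solution `w` is defined over `L`.
  obtain ⟨π, hπ⟩ := LinearMap.exists_leftInverse_of_injective (Algebra.linearMap L K)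
    (LinearMap.ker_eq_bot.2 φ.injective)
  have hπL : ∀ a : L, π (φ a) = a := fun a => LinearMap.congr_fun hπ a
  have hwL : w = (w.map π).map φ := by
    have hmem : x * (w.map π).map φ = (w.map π).map φ * J := by
      have e1 : (h' * J' * h'⁻¹) * w.map π = w.map π * J' := by
        have := congrArg (fun M : Matrix (Fin n) (Fin n) K => M.map π) hwW
        rw [hxL] at this
        ext1 i j
        have hij := congrFun (congrFun this i) j
        simp only [Matrix.map_apply, Matrix.mul_apply, map_sum] at hij ⊢
        refine Eq.trans ?_ (hij.trans ?_)
        · refine Finset.sum_congr rfl fun k _ => ?_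
          rw [← map_sum φ, ← smul_eq_mul, ← map_smul π, Algebra.smul_def]
        · refine Finset.sum_congr rfl fun k _ => ?_
          rw [mul_comm (w i k), show J k j = φ (J' k j) from rfl, ← Algebra.smul_def, map_smul,
            smul_eq_mul, mul_comm]
      rw [hxL, ← Matrix.map_mul, e1, Matrix.map_mul, hJ']
    have heq := hext (fun ij => w ij.1 ij.2) hwW (fun ij => φ (π (w ij.1 ij.2))) hmem fun s hs => by
      have : w s.1 s.2 ∈ L := hsub _ (Finset.mem_union_right _ (Finset.mem_union_right _
        (Finset.mem_image.2 ⟨s, hs, rfl⟩)))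
      exact congrArg φ (hπL ⟨_, this⟩).symm
    ext i j
    exact congrFun heq (i, j)
  have hyL : y = (w.map π * h'⁻¹).map φ := by
    rw [Matrix.map_mul, ← hwL]
    simp only [w]
    rw [mul_assoc, hinv, mul_one]
  refine ⟨fun i j => ?_, fun i j => ?_⟩
  · rw [hxL]
    exact ((h' * J' * h'⁻¹) i j).2
  · rw [hyL]
    exact ((w.map π * h'⁻¹) i j).2

end CommutingMatrices

namespace LinearAlgebraicGroup

open MvPolynomial Zariski TopologicalSpace

attribute [local instance] zariskiTopology

/-! ### Points of the commuting variety over extension fields -/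

/-- A bound for the dimension of the commuting variety, in terms of pairs of commuting matrices over
extension fields that satisfy the equations of `G`. -/
theorem commutingDim_le_of_forall_matrix (G : LinearAlgebraicGroup) {k : ℕ}
    (h : ∀ (K : Type) [Field K] [Algebra ℂ K] (x y : Matrix (Fin G.n) (Fin G.n) K),
      (∀ p : MvPolynomial (Fin G.n × Fin G.n) ℂ,
        (∀ g ∈ G.points, eval (fun ij => (g : Matrix (Fin G.n) (Fin G.n) ℂ) ij.1 ij.2) p = 0) →
        aeval (fun ij => x ij.1 ij.2) p = 0) →
      (∀ p : MvPolynomial (Fin G.n × Fin G.n) ℂ,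
        (∀ g ∈ G.points, eval (fun ij => (g : Matrix (Fin G.n) (Fin G.n) ℂ) ij.1 ij.2) p = 0) →
        aeval (fun ij => y ij.1 ij.2) p = 0) →
      x * y = y * x → ∃ T : Finset K, T.card ≤ k ∧
        (∀ i j, x i j ∈ IntermediateField.adjoin ℂ (T : Set K)) ∧
        ∀ i j, y i j ∈ IntermediateField.adjoin ℂ (T : Set K)) : G.commutingDim ≤ k := by
  classical
  have h' : zariskiDim G.commutingVariety ≤ k := by
    refine zariskiDim_le_of_forall_point (isClosed_commutingVariety _) fun K _ _ z hz => ?_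
    let x : Matrix (Fin G.n) (Fin G.n) K := Matrix.of fun i j => z (Sum.inl (Sum.inl (i, j)))
    let y : Matrix (Fin G.n) (Fin G.n) K := Matrix.of fun i j => z (Sum.inr (Sum.inl (i, j)))
    have hxy : x * y = y * x := by
      have h1 : (commutator G.n).map (aeval z) = 0 := by
        ext i j
        refine hz _ fun w hw => ?_
        rw [commutingVariety_eq] at hw
        exact hw.2 (i, j)
      rw [map_commutator] at h1
      exact sub_eq_zero.1 h1
    have hdet : ∀ (f : CoordIndex G.n → CoordIndex G.n ⊕ CoordIndex G.n),
        (∀ w ∈ G.commutingVariety, w ∘ f ∈ G.variety) →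
        (Matrix.of fun i j => z (f (Sum.inl (i, j)))).det * z (f (Sum.inr ())) = 1 := by
      intro f hf
      have h1 := hz (rename f ((genericMatrix G.n).det * MvPolynomial.X (Sum.inr ()) - 1))
        fun w hw => by
          rw [aeval_rename]
          obtain ⟨g, -, hg⟩ := hf w hw
          rw [← hg, map_sub, map_mul, AlgHom.map_det, map_one, aeval_X, sub_eq_zero]
          have : (aeval (glCoords g)).mapMatrix (genericMatrix G.n) =
            (g : Matrix (Fin G.n) (Fin G.n) ℂ) := eval_genericMatrix g
          rw [this]
          exact mul_inv_cancel₀ (det_coe_ne_zero g)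
      rw [aeval_rename, map_sub, map_mul, AlgHom.map_det, map_one, aeval_X, sub_eq_zero] at h1
      rw [← h1]
      congr 2
      ext i j
      simp [genericMatrix]
    have hpoint : ∀ (f : CoordIndex G.n → CoordIndex G.n ⊕ CoordIndex G.n),
        (∀ w ∈ G.commutingVariety, w ∘ f ∈ G.variety) →
        ∀ p : MvPolynomial (Fin G.n × Fin G.n) ℂ,
        (∀ g ∈ G.points, eval (fun ij => (g : Matrix (Fin G.n) (Fin G.n) ℂ) ij.1 ij.2) p = 0) →
        aeval (fun ij => z (f (Sum.inl ij))) p = 0 := by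
      intro f hf p hp
      have h1 := hz (rename (f ∘ Sum.inl) p) fun w hw => by
        rw [aeval_rename]
        obtain ⟨g, hg, hgw⟩ := hf w hw
        rw [← Function.comp_assoc, ← hgw]
        exact hp g hg
      rwa [aeval_rename] at h1
    have hl : ∀ w ∈ G.commutingVariety, w ∘ Sum.inl ∈ G.variety := fun w hw => by
      rw [commutingVariety_eq] at hw
      exact hw.1.1
    have hr : ∀ w ∈ G.commutingVariety, w ∘ Sum.inr ∈ G.variety := fun w hw => by
      rw [commutingVariety_eq] at hw
      exact hw.1.2
    obtain ⟨T, hT, hTx, hTy⟩ := h K x y (hpoint _ hl) (hpoint _ hr) hxy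
    have hdetmem : ∀ (L : IntermediateField ℂ K) (M : Matrix (Fin G.n) (Fin G.n) K) (t : K),
        (∀ i j, M i j ∈ L) → M.det * t = 1 → t ∈ L := by
      intro L M t hM ht
      rw [← inv_eq_of_mul_eq_one_right ht, Matrix.det_apply]
      refine L.inv_mem (L.sum_mem fun σ _ => ?_)
      rw [Units.smul_def]
      exact L.zsmul_mem (L.prod_mem fun i _ => hM _ _) _
    refine ⟨T, hT, fun i => isAlgebraic_adjoin_of_mem ?_⟩
    rcases i with (⟨i, j⟩ | u) | (⟨i, j⟩ | u)
    · exact hTx i j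
    · exact hdetmem _ _ _ hTx (hdet _ hl)
    · exact hTy i j
    · exact hdetmem _ _ _ hTy (hdet _ hr)
  rw [zariskiDim_commutingVariety] at h'
  exact_mod_cast h'

/-! ### The general linear group -/

/-- The general linear group. -/
noncomputable def generalLinear (n : ℕ) : LinearAlgebraicGroup where
  n := n
  points := ⊤
  isClosed := by
    change IsClosed _
    have key : ∀ x : CoordIndex n → ℂ, eval x (genericMatrix n).det =
        (Matrix.of fun i j => x (Sum.inl (i, j))).det := fun x => by
      rw [RingHom.map_det]
      congr 1
      ext i j
      simp [genericMatrix]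
    have : glCoords '' ((⊤ : Subgroup (GL (Fin n) ℂ)) : Set (GL (Fin n) ℂ)) =
        {x | eval x (MvPolynomial.X (Sum.inr ()) * (genericMatrix n).det - 1 :
          MvPolynomial (CoordIndex n) ℂ) = 0} := by
      ext x
      simp only [Set.mem_ofPred_eq, map_sub, map_mul, eval_X, key, map_one, sub_eq_zero]
      constructor
      · rintro ⟨g, -, rfl⟩
        exact inv_mul_cancel₀ (det_coe_ne_zero g)
      · intro hx
        have hdet := right_ne_zero_of_mul (hx.symm ▸ one_ne_zero)
        refine ⟨Matrix.GeneralLinearGroup.mkOfDetNeZero _ hdet, Subgroup.mem_top _, ?_⟩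
        ext (⟨i, j⟩ | u)
        · rfl
        · exact (eq_inv_of_mul_eq_one_left hx).symm
    rw [this]
    exact isClosed_setOf_eval_eq_zero _

/-- A polynomial in the matrix entries and the inverse determinant becomes a polynomial in the
entries after multiplication by a power of the determinant. -/
theorem exists_clear_denominator {n : ℕ} (p : MvPolynomial (CoordIndex n) ℂ) :
    ∃ (k : ℕ) (q : MvPolynomial (Fin n × Fin n) ℂ), ∀ (K : Type) [Field K] [Algebra ℂ K]
      (M : Matrix (Fin n) (Fin n) K), M.det ≠ 0 →
      aeval (fun ij => M ij.1 ij.2) q =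
        M.det ^ k * aeval (Sum.elim (fun ij => M ij.1 ij.2) fun _ => M.det⁻¹) p := by
  induction p using MvPolynomial.induction_on with
  | C a => exact ⟨0, C a, fun K _ _ M _ => by simp⟩
  | add p₁ p₂ h₁ h₂ =>
    obtain ⟨k₁, q₁, h₁⟩ := h₁
    obtain ⟨k₂, q₂, h₂⟩ := h₂
    let D : MvPolynomial (Fin n × Fin n) ℂ :=
      (Matrix.of fun i j => (MvPolynomial.X (i, j) : MvPolynomial (Fin n × Fin n) ℂ)).det
    refine ⟨k₁ + k₂, D ^ k₂ * q₁ + D ^ k₁ * q₂, fun K _ _ M hM => ?_⟩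
    have hD : aeval (fun ij => M ij.1 ij.2) D = M.det := by
      simp only [D, AlgHom.map_det]
      congr 1
      ext i j
      simp
    simp only [map_add, map_mul, map_pow, hD, h₁ K M hM, h₂ K M hM]
    ring
  | mul_X p i h =>
    obtain ⟨k, q, h⟩ := h
    rcases i with ij | u
    · refine ⟨k, q * MvPolynomial.X ij, fun K _ _ M hM => ?_⟩
      simp only [map_mul, aeval_X, h K M hM, Sum.elim_inl]
      ring
    · refine ⟨k + 1, q, fun K _ _ M hM => ?_⟩
      simp only [map_mul, aeval_X, h K M hM, Sum.elim_inr]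
      rw [pow_succ, mul_comm _ M.det⁻¹, mul_assoc, mul_inv_cancel_left₀ hM]

/-- A polynomial in the matrix entries that vanishes on all invertible matrices is zero. -/
theorem eq_zero_of_forall_det_ne_zero {n : ℕ} {q : MvPolynomial (Fin n × Fin n) ℂ}
    (h : ∀ M : Matrix (Fin n) (Fin n) ℂ, M.det ≠ 0 → eval (fun ij => M ij.1 ij.2) q = 0) :
    q = 0 := by
  let D : MvPolynomial (Fin n × Fin n) ℂ :=
    (Matrix.of fun i j => (MvPolynomial.X (i, j) : MvPolynomial (Fin n × Fin n) ℂ)).det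
  have hD : ∀ M : Matrix (Fin n) (Fin n) ℂ, eval (fun ij => M ij.1 ij.2) D = M.det := by
    intro M
    simp only [D, RingHom.map_det]
    congr 1
    ext i j
    simp
  have hprod : q * D = 0 := by
    refine MvPolynomial.funext fun x => ?_
    have hx : x = fun ij : Fin n × Fin n => (Matrix.of fun i j => x (i, j)) ij.1 ij.2 := rfl
    rw [hx, map_mul, hD, map_zero]
    by_cases hdet : (Matrix.of fun i j => x (i, j)).det = 0
    · rw [hdet, mul_zero]
    · rw [h _ hdet, zero_mul]
  refine (mul_eq_zero.1 hprod).resolve_right fun h0 => ?_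
  have := hD 1
  rw [h0] at this
  simp at this

/-- `GL_n` is a nonempty open subset of the affine space of matrices. -/
theorem isIrreducible_variety_generalLinear (n : ℕ) :
    _root_.IsIrreducible (generalLinear n).variety := by
  rw [isIrreducible_iff_forall]
  refine ⟨variety_nonempty _, fun p₁ p₂ h => ?_⟩
  obtain ⟨k₁, q₁, h₁⟩ := exists_clear_denominator p₁
  obtain ⟨k₂, q₂, h₂⟩ := exists_clear_denominator p₂
  have hq : q₁ * q₂ = 0 := eq_zero_of_forall_det_ne_zero fun M hM => by
    have h' := h (glCoords (Matrix.GeneralLinearGroup.mkOfDetNeZero M hM))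
      ⟨_, Subgroup.mem_top _, rfl⟩
    have e₁ := h₁ ℂ M hM
    have e₂ := h₂ ℂ M hM
    simp only [MvPolynomial.aeval_eq_eval] at e₁ e₂
    rw [map_mul]
    erw [e₁, e₂]
    rw [mul_mul_mul_comm]
    exact mul_eq_zero_of_right _ h'
  have key : ∀ (k : ℕ) (p : MvPolynomial (CoordIndex n) ℂ), (∀ (K : Type) [Field K] [Algebra ℂ K]
      (M : Matrix (Fin n) (Fin n) K), M.det ≠ 0 →
      aeval (fun ij => M ij.1 ij.2) (0 : MvPolynomial (Fin n × Fin n) ℂ) =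
        M.det ^ k * aeval (Sum.elim (fun ij => M ij.1 ij.2) fun _ => M.det⁻¹) p) →
      ∀ x ∈ (generalLinear n).variety, eval x p = 0 := by
    rintro k p hp _ ⟨g, -, rfl⟩
    let M : Matrix (Fin n) (Fin n) ℂ := Units.val g
    have hM : M.det ≠ 0 := det_coe_ne_zero g
    have := hp ℂ M hM
    rw [map_zero] at this
    exact (mul_eq_zero.1 this.symm).resolve_left (pow_ne_zero _ hM)
  rcases mul_eq_zero.1 hq with rfl | rfl
  · exact Or.inl (key k₁ p₁ h₁)
  · exact Or.inr (key k₂ p₂ h₂)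

/-- The generic invertible matrix is a point with algebraically independent coordinates. -/
theorem sq_le_dim_generalLinear (n : ℕ) : n * n ≤ (generalLinear n).dim := by
  let R := MvPolynomial (Fin n × Fin n) ℂ
  let K := FractionRing R
  let M : Matrix (Fin n) (Fin n) K := Matrix.of fun i j => algebraMap R K (MvPolynomial.X (i, j))
  have hind : AlgebraicIndependent ℂ fun ij : Fin n × Fin n => M ij.1 ij.2 := by
    have : aeval (fun ij : Fin n × Fin n => M ij.1 ij.2) = IsScalarTower.toAlgHom ℂ R K := by
      ext i
      simp only [aeval_X]
      rfl
    rw [AlgebraicIndependent, this]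
    exact IsFractionRing.injective R K
  have hdet : M.det ≠ 0 := by
    intro h0
    let D : R := (Matrix.of fun i j => (MvPolynomial.X (i, j) : R)).det
    have hD : algebraMap R K D = 0 := by
      rw [← h0, RingHom.map_det]
      rfl
    have hD0 : D = 0 := (IsFractionRing.injective R K) (by rw [hD, map_zero])
    have h1 : eval (fun ij : Fin n × Fin n => (1 : Matrix (Fin n) (Fin n) ℂ) ij.1 ij.2) D = 1 := by
      simp only [D, RingHom.map_det]
      rw [← Matrix.det_one (n := Fin n) (R := ℂ)]
      congr 1
      ext i j
      simp
    rw [hD0] at h1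
    simp at h1
  obtain ⟨T, hT, hTx⟩ := exists_finset_of_zariskiDim_le (isClosed_variety _)
    (zariskiDim_variety (generalLinear n)).le (K := K)
    (x := Sum.elim (fun ij => M ij.1 ij.2) fun _ => M.det⁻¹) fun p hp => by
      obtain ⟨k, q, hq⟩ := exists_clear_denominator p
      have hq0 : q = 0 := eq_zero_of_forall_det_ne_zero fun N hN => by
        have h1 := hp (glCoords (Matrix.GeneralLinearGroup.mkOfDetNeZero N hN))
          ⟨_, Subgroup.mem_top _, rfl⟩
        have h2 := hq ℂ N hN
        erw [h1] at h2
        rwa [mul_zero] at h2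
      have h3 := hq K M hdet
      rw [hq0, map_zero] at h3
      exact (mul_eq_zero.1 h3.symm).resolve_left (pow_ne_zero _ hdet)
  have := card_le_of_algebraicIndependent hind T fun ij => hTx (Sum.inl ij)
  simp only [Fintype.card_prod, Fintype.card_fin] at this
  exact this.trans hT

theorem commutingDim_generalLinear_le (n : ℕ) : (generalLinear n).commutingDim ≤ n + n * n :=
  commutingDim_le_of_forall_matrix _ fun _ _ _ _ _ _ _ hxy =>
    exists_finset_entries_mem_adjoin (n := n) hxy

theorem dim_generalLinear_one : (generalLinear 1).dim = 1 ∧ (generalLinear 1).commutingDim = 2 := by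
  have h1 := sq_le_dim_generalLinear 1
  have h2 := commutingDim_generalLinear_le 1
  have h3 := (generalLinear 1).dim_lt_commutingDim
    (isIrreducible_variety_generalLinear 1) (by omega)
  omega

/-- A nilpotent endomorphism has no eigenvector for a nonzero eigenvalue. -/
theorem mulVec_eq_zero_of_eq_smul {n : ℕ} {N : Matrix (Fin n) (Fin n) ℂ}
    (hN : _root_.IsNilpotent N)
    {v : Fin n → ℂ} {c : ℂ} (h : N *ᵥ v = c • v) : N *ᵥ v = 0 := by
  obtain ⟨k, hk⟩ := hN
  have hpow : ∀ j, N ^ j *ᵥ v = c ^ j • v := by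
    intro j
    induction j with
    | zero => simp
    | succ j ih => rw [pow_succ, ← Matrix.mulVec_mulVec, h, Matrix.mulVec_smul, ih, smul_smul,
        pow_succ']
  have := hpow k
  rw [hk, Matrix.zero_mulVec] at this
  rcases smul_eq_zero.1 this.symm with h0 | h0
  · rw [h, eq_zero_of_pow_eq_zero h0, zero_smul]
  · rw [h0, Matrix.mulVec_zero]

/-- If `u = 1 + N` lies in a normal subgroup of unipotent elements, then so does
`u (g u g⁻¹)`, hence `tr (N g N g⁻¹) = 0` for all `g`.  For the transvections `g = 1 + x yᵀ` with
`yᵀ x = 0` this trace is `-(yᵀ N x) ^ 2`, which forces `N x` to be a multiple of `x`. -/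
theorem hasNoUnipotentNormalSubgroup_top (n : ℕ) :
    HasNoUnipotentNormalSubgroup (⊤ : Subgroup (GL (Fin n) ℂ)) := by
  intro U _ hconj hunip
  rw [Subgroup.eq_bot_iff_forall]
  intro u hu
  set N : Matrix (Fin n) (Fin n) ℂ := (u : Matrix (Fin n) (Fin n) ℂ) - 1 with hN
  have huN : (u : Matrix (Fin n) (Fin n) ℂ) = 1 + N := by rw [hN, add_sub_cancel]
  have hnil : _root_.IsNilpotent N := hunip u hu
  have htr : ∀ M : Matrix (Fin n) (Fin n) ℂ, _root_.IsNilpotent M → M.trace = 0 := fun M hM =>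
    (Matrix.isNilpotent_trace_of_isNilpotent hM).eq_zero
  have hdot : ∀ x y : Fin n → ℂ, y ⬝ᵥ x = 0 → y ⬝ᵥ (N *ᵥ x) = 0 := by
    intro x y hxy
    set E := Matrix.vecMulVec x y with hE
    have hEE : E * E = 0 := by
      rw [hE, Matrix.vecMulVec_mul_vecMulVec, hxy]
      simp
    let g : GL (Fin n) ℂ := ⟨1 + E, 1 - E, by noncomm_ring; simp [hEE], by noncomm_ring; simp [hEE]⟩
    have hw := htr _ (hunip _ (U.mul_mem hu (hconj g (Subgroup.mem_top g) u hu)))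
    have hexp : ((u * (g * u * g⁻¹) : GL (Fin n) ℂ) : Matrix (Fin n) (Fin n) ℂ) - 1 =
        N + (1 + E) * (N * (1 - E)) + N * N + N * E * N - N * N * E - N * E * (N * E) := by
      have : ((u * (g * u * g⁻¹) : GL (Fin n) ℂ) : Matrix (Fin n) (Fin n) ℂ) =
        (1 + N) * ((1 + E) * (1 + N) * (1 - E)) := by rw [← huN]; rfl
      rw [this, sub_eq_iff_eq_add]
      have : (1 + E) * (1 + N) * (1 - E) = 1 + (1 + E) * (N * (1 - E)) := by
        noncomm_ring
        simp [hEE]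
      rw [this]
      noncomm_ring
    have h1 : ((1 + E) * (N * (1 - E))).trace = 0 := by
      rw [Matrix.trace_mul_comm]
      have : N * (1 - E) * (1 + E) = N := by
        rw [mul_assoc]
        have : (1 - E) * (1 + E) = 1 := by noncomm_ring; simp [hEE]
        rw [this, mul_one]
      rw [this, htr N hnil]
    have h2 : (N * E * N).trace = (N * N * E).trace := by
      rw [Matrix.trace_mul_comm, mul_assoc]
    have h3 : (N * N).trace = 0 := htr _ (by
      rw [← pow_two]
      exact hnil.pow_succ 1)
    rw [hexp] at hw
    simp only [Matrix.trace_add, Matrix.trace_sub, htr N hnil, h1, h2, h3] at hw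
    have h4 : (N * E * (N * E)).trace = (y ⬝ᵥ (N *ᵥ x)) * (y ⬝ᵥ (N *ᵥ x)) := by
      rw [hE, Matrix.mul_vecMulVec, Matrix.vecMulVec_mul_vecMulVec]
      simp [Matrix.trace_vecMulVec, dotProduct_comm]
    rw [h4] at hw
    exact mul_self_eq_zero.1 (by linear_combination -hw)
  have hzero : ∀ v, N *ᵥ v = 0 := by
    intro v
    by_cases hv : v = 0
    · rw [hv, Matrix.mulVec_zero]
    obtain ⟨i, hi⟩ := Function.ne_iff.1 hv
    -- By `hdot`, the vector `N v` is a multiple of `v`.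
    refine mulVec_eq_zero_of_eq_smul hnil (c := (N *ᵥ v) i / v i) (funext fun j => ?_)
    have := hdot v (Pi.single j (v i) - Pi.single i (v j)) (by
      rw [sub_dotProduct, single_dotProduct, single_dotProduct, mul_comm, sub_self])
    rw [sub_dotProduct, single_dotProduct, single_dotProduct, sub_eq_zero] at this
    have hi' : v i ≠ 0 := hi
    rw [Pi.smul_apply, smul_eq_mul]
    field_simp
    linear_combination this
  have hN0 : N = 0 := Matrix.ext_of_mulVec_single fun i => by rw [hzero, Matrix.zero_mulVec]
  exact Units.ext (by rw [huN, hN0, add_zero]; rfl)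

theorem hasNoUnipotentNormalSubgroup_generalLinear (n : ℕ) :
    HasNoUnipotentNormalSubgroup (generalLinear n).points :=
  hasNoUnipotentNormalSubgroup_top n

theorem isNilpotent_generalLinear_one : (generalLinear 1).IsNilpotent := by
  have hcomm : ∀ a b : GL (Fin 1) ℂ, a * b = b * a := fun a b => Units.ext (by
    ext i j
    fin_cases i
    fin_cases j
    simp [Matrix.mul_apply, mul_comm])
  let _ : CommGroup (generalLinear 1).points :=
    { (inferInstance : Group (generalLinear 1).points) with
      mul_comm := fun a b => Subtype.ext (hcomm a.1 b.1) }
  exact CommGroup.isNilpotent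

end LinearAlgebraicGroup

/-! ### Substitution of polynomials, modulo a power of the variable -/

namespace Substitution

open Polynomial

/-- The matrix of the substitution `u ↦ u(F)` on the polynomials without constant term, modulo
`X ^ (m + 2)`, in the basis `X, X ^ 2, …, X ^ (m + 1)`. -/
noncomputable def substMatrix {R : Type*} [CommRing R] (m : ℕ) (F : R[X]) :
    Matrix (Fin (m + 1)) (Fin (m + 1)) R :=
  Matrix.of fun p j => (F ^ ((j : ℕ) + 1)).coeff (p + 1)

section CommRing

variable {R S : Type*} [CommRing R] [CommRing S] {m : ℕ}

theorem substMatrix_apply (F : R[X]) (p j : Fin (m + 1)) :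
    substMatrix m F p j = (F ^ ((j : ℕ) + 1)).coeff (p + 1) := rfl

theorem substMatrix_map (φ : R →+* S) (F : R[X]) :
    substMatrix m (F.map φ) = (substMatrix m F).map φ := by
  ext p j
  simp [substMatrix_apply, ← Polynomial.map_pow]

theorem substMatrix_X : substMatrix m (X : R[X]) = 1 := by
  ext p j
  simp [substMatrix_apply, coeff_X_pow, Matrix.one_apply, Fin.ext_iff]

theorem substMatrix_congr {F H : R[X]} (h : ∀ d < m + 2, F.coeff d = H.coeff d) :
    substMatrix m F = substMatrix m H := by
  have hdvd : X ^ (m + 2) ∣ F - H := X_pow_dvd_iff.2 fun d hd => by rw [coeff_sub, h d hd, sub_self]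
  ext p j
  have := X_pow_dvd_iff.1 (hdvd.trans (sub_dvd_pow_sub_pow F H (j + 1))) (p + 1) (by omega)
  rw [coeff_sub, sub_eq_zero] at this
  exact this

theorem coeff_pow_eq_zero {F : R[X]} (hF : F.coeff 0 = 0) {d k : ℕ} (h : d < k) :
    (F ^ k).coeff d = 0 :=
  X_pow_dvd_iff.1 (pow_dvd_pow_of_dvd (X_dvd_iff.2 hF) k) d h

theorem coeff_pow_self {F : R[X]} (hF : F.coeff 0 = 0) (k : ℕ) :
    (F ^ k).coeff k = F.coeff 1 ^ k := by
  obtain ⟨f, rfl⟩ := X_dvd_iff.2 hF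
  rw [mul_pow, coeff_X_pow_mul', if_pos le_rfl, Nat.sub_self, coeff_zero_eq_eval_zero, eval_pow,
    ← coeff_zero_eq_eval_zero, coeff_X_mul]

theorem coeff_comp_eq_sum (U F : R[X]) (d : ℕ) {N : ℕ} (hN : U.natDegree < N) :
    (U.comp F).coeff d = ∑ k ∈ Finset.range N, U.coeff k * (F ^ k).coeff d := by
  rw [Polynomial.comp, eval₂_eq_sum_range' _ hN, finsetSum_coeff]
  simp

theorem coeff_comp_of_coeff_zero {U F : R[X]} (hU : U.coeff 0 = 0) (hF : F.coeff 0 = 0)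
    (p : Fin (m + 1)) : (U.comp F).coeff (p + 1) =
      ∑ j : Fin (m + 1), substMatrix m F p j * U.coeff (j + 1) := by
  rw [coeff_comp_eq_sum U F _ (N := (m + 2) + (U.natDegree + 1)) (by omega),
    Finset.sum_range_add, Finset.sum_eq_zero (s := Finset.range (U.natDegree + 1)), add_zero,
    Finset.sum_range_succ', hU, zero_mul, add_zero, Finset.sum_range]
  · exact Finset.sum_congr rfl fun j _ => mul_comm _ _
  · intro k _
    rw [coeff_pow_eq_zero hF (by omega), mul_zero]

theorem coeff_comp_zero {U F : R[X]} (hU : U.coeff 0 = 0) (hF : F.coeff 0 = 0) :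
    (U.comp F).coeff 0 = 0 := by
  rw [coeff_zero_eq_eval_zero, eval_comp, ← coeff_zero_eq_eval_zero, hF, ← coeff_zero_eq_eval_zero,
    hU]

theorem substMatrix_mul {F H : R[X]} (hF : F.coeff 0 = 0) (hH : H.coeff 0 = 0) :
    substMatrix m F * substMatrix m H = substMatrix m (H.comp F) := by
  ext p j
  rw [substMatrix_apply, ← pow_comp, coeff_comp_of_coeff_zero (coeff_pow_eq_zero hH (by omega)) hF,
    Matrix.mul_apply]
  rfl

theorem coeff_comp_one {U F : R[X]} (hU : U.coeff 0 = 0) (hF : F.coeff 0 = 0) :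
    (U.comp F).coeff 1 = U.coeff 1 * F.coeff 1 := by
  have : (U.comp F).coeff 1 = ∑ j : Fin 1, substMatrix 0 F 0 j * U.coeff (j + 1) :=
    coeff_comp_of_coeff_zero (m := 0) hU hF 0
  rw [this, Fin.sum_univ_one, substMatrix_apply, mul_comm]
  simp

theorem det_substMatrix {F : R[X]} (h0 : F.coeff 0 = 0) (h1 : F.coeff 1 = 1) :
    (substMatrix m F).det = 1 := by
  rw [Matrix.det_of_isLowerTriangular]
  · exact Finset.prod_eq_one fun j _ => by rw [substMatrix_apply, coeff_pow_self h0, h1, one_pow]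
  · intro i j hij
    rw [substMatrix_apply]
    have : (i : ℕ) < j := hij
    exact coeff_pow_eq_zero h0 (by omega)

/-- The polynomial whose coefficients are the entries of the first column. -/
noncomputable def columnPoly (A : Matrix (Fin (m + 1)) (Fin (m + 1)) R) : R[X] :=
  ∑ i : Fin (m + 1), monomial (i + 1) (A i 0)

theorem coeff_columnPoly_zero (A : Matrix (Fin (m + 1)) (Fin (m + 1)) R) :
    (columnPoly A).coeff 0 = 0 := by
  simp [columnPoly, coeff_monomial]

theorem coeff_columnPoly_succ (A : Matrix (Fin (m + 1)) (Fin (m + 1)) R) (i : Fin (m + 1)) :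
    (columnPoly A).coeff (i + 1) = A i 0 := by
  simp [columnPoly, coeff_monomial, Fin.val_inj]

theorem coeff_columnPoly_of_le (A : Matrix (Fin (m + 1)) (Fin (m + 1)) R) {d : ℕ} (hd : m + 2 ≤ d) :
    (columnPoly A).coeff d = 0 := by
  rw [columnPoly, finsetSum_coeff]
  exact Finset.sum_eq_zero fun i _ => by rw [coeff_monomial, if_neg (by omega)]

theorem columnPoly_map (φ : R →+* S) (A : Matrix (Fin (m + 1)) (Fin (m + 1)) R) :
    columnPoly (A.map φ) = (columnPoly A).map φ := by
  simp [columnPoly, Polynomial.map_sum]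

theorem substMatrix_columnPoly_substMatrix {F : R[X]} (hF : F.coeff 0 = 0) :
    substMatrix m (columnPoly (substMatrix m F)) = substMatrix m F := by
  refine substMatrix_congr fun d hd => ?_
  rcases d with _ | d
  · rw [coeff_columnPoly_zero, hF]
  · have := coeff_columnPoly_succ (substMatrix m F) ⟨d, by omega⟩
    simpa [substMatrix_apply] using this

/-- If `P` and `Q` agree to order `k` and `U` vanishes to order `e`, then the first coefficient
where `U ∘ P` and `U ∘ Q` can differ is the one of degree `k + e - 1`, and the difference there is
given by the leading terms. -/
theorem coeff_comp_sub_comp {P Q U : R[X]} {k e : ℕ} (hP0 : P.coeff 0 = 0) (hP1 : P.coeff 1 = 1)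
    (hQ0 : Q.coeff 0 = 0) (hQ1 : Q.coeff 1 = 1) (hk : 0 < k) (hPQ : ∀ d < k, P.coeff d = Q.coeff d)
    (he : 0 < e) (hU : ∀ d < e, U.coeff d = 0) :
    (U.comp P).coeff (k + e - 1) - (U.comp Q).coeff (k + e - 1) =
      e * U.coeff e * (P.coeff k - Q.coeff k) := by
  obtain ⟨p, rfl⟩ := X_dvd_iff.2 hP0
  obtain ⟨q, rfl⟩ := X_dvd_iff.2 hQ0
  obtain ⟨k, rfl⟩ := Nat.exists_eq_add_of_lt hk
  simp only [zero_add, coeff_X_mul] at hP1 hQ1 hPQ ⊢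
  have hp1 : p.coeff 0 = 1 := by simpa using coeff_X_mul p 0 ▸ hP1
  have hq1 : q.coeff 0 = 1 := by simpa using coeff_X_mul q 0 ▸ hQ1
  obtain ⟨r, hr⟩ : X ^ k ∣ p - q := X_pow_dvd_iff.2 fun d hd => by
    have := hPQ (d + 1) (by omega)
    rw [coeff_X_mul, coeff_X_mul] at this
    rw [coeff_sub, this, sub_self]
  have hr0 : p.coeff k - q.coeff k = r.coeff 0 := by
    rw [← coeff_sub, hr, coeff_X_pow_mul', if_pos le_rfl, Nat.sub_self]
  have hpow : ∀ d, (X * p) ^ d - (X * q) ^ d =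
      X ^ (k + d) * (r * ∑ i ∈ Finset.range d, p ^ i * q ^ (d - 1 - i)) := fun d => by
    rw [mul_pow, mul_pow, ← mul_sub, ← Commute.mul_geom_sum₂ (Commute.all p q) d, hr]
    ring
  have hN : U.natDegree < (U.natDegree + 1) + (e + 1) := by omega
  rw [coeff_comp_eq_sum U _ _ hN, coeff_comp_eq_sum U _ _ hN, ← Finset.sum_sub_distrib]
  rw [Finset.sum_eq_single e]
  · rw [← mul_sub, ← coeff_sub, hpow, coeff_X_pow_mul', if_pos (by omega), hr0,
      show k + 1 + e - 1 - (k + e) = 0 by omega, mul_coeff_zero]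
    have : (∑ i ∈ Finset.range e, p ^ i * q ^ (e - 1 - i)).coeff 0 = e := by
      rw [finsetSum_coeff]
      have hc : ∀ (P : R[X]) (i : ℕ), (P ^ i).coeff 0 = P.coeff 0 ^ i := fun P i =>
        map_pow constantCoeff P i
      simp [mul_coeff_zero, hc, hp1, hq1]
    rw [this]
    ring
  · intro d _ hd
    rw [← mul_sub, ← coeff_sub, hpow]
    rcases lt_or_gt_of_ne hd with h | h
    · rw [hU d h, zero_mul]
    · rw [coeff_X_pow_mul', if_neg (by omega), mul_zero]
  · intro h
    exact absurd (Finset.mem_range.2 (by omega)) h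

end CommRing

/-- Suppose that the substitutions `F = X + a X ^ e + ⋯` and `H = X + ⋯` commute, up to degree
`m + 1`.
The coefficient of degree `k + e - 1` in `H ∘ F - F ∘ H` is the sum of `(k - e) a` times the
coefficient of degree `k` in `H` and a polynomial in the coefficients of `F` and the lower
coefficients of `H`.  Hence all coefficients of `H` are determined successively by those of
degree `e` and those of degree greater than `m + 2 - e`. -/
theorem coeff_mem_of_comp_comm {K : Type} [Field K] [Algebra ℂ K] {L : IntermediateField ℂ K}
    {m e : ℕ} {F H : K[X]} (hF0 : F.coeff 0 = 0) (hF1 : F.coeff 1 = 1) (hH0 : H.coeff 0 = 0)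
    (hH1 : H.coeff 1 = 1) (hcomm : ∀ d < m + 2, (H.comp F).coeff d = (F.comp H).coeff d)
    (he : 2 ≤ e) (hFe : F.coeff e ≠ 0) (hFlt : ∀ d, 2 ≤ d → d < e → F.coeff d = 0)
    (hFL : ∀ d, F.coeff d ∈ L) (hHe : H.coeff e ∈ L) (hHL : ∀ d, m + 2 < d + e → H.coeff d ∈ L) :
    ∀ d, H.coeff d ∈ L := by
  intro k
  induction k using Nat.strong_induction_on with
  | _ k ih =>
  rcases lt_or_ge (m + 2) (k + e) with hk | hk
  · exact hHL k hk
  rcases eq_or_ne k e with rfl | hke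
  · exact hHe
  rcases lt_or_ge k 2 with hk2 | hk2
  · interval_cases k
    · rw [hH0]; exact L.zero_mem
    · rw [hH1]; exact L.one_mem
  -- The part of `H` of degree less than `k`, whose coefficients are in `L` by induction.
  let H' : K[X] := ∑ j ∈ Finset.range k, monomial j (H.coeff j)
  have hH' : ∀ d, H'.coeff d = if d < k then H.coeff d else 0 := fun d => by
    simp [H', coeff_monomial]
  have hlt : ∀ d < k, H.coeff d = H'.coeff d := fun d hd => by rw [hH', if_pos hd]
  have e1 := coeff_comp_sub_comp (P := F) (Q := X) (U := H - H') (k := e) (e := k) hF0 hF1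
    coeff_X_zero coeff_X_one (by omega) (fun d hd => by
      rcases lt_or_ge d 2 with h2 | h2
      · interval_cases d
        · rw [hF0, coeff_X_zero]
        · rw [hF1, coeff_X_one]
      · rw [hFlt d h2 hd, coeff_X_of_ne_one (by omega)])
    (by omega) (fun d hd => by rw [coeff_sub, hlt d hd, sub_self])
  have e2 := coeff_comp_sub_comp (P := H) (Q := H') (U := F - X) (k := k) (e := e) hH0 hH1
    (by rw [← hlt 0 (by omega), hH0]) (by rw [← hlt 1 (by omega), hH1]) (by omega) hlt (by omega)
    (fun d hd => by
      rcases lt_or_ge d 2 with h2 | h2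
      · interval_cases d
        · rw [coeff_sub, hF0, coeff_X_zero, sub_self]
        · rw [coeff_sub, hF1, coeff_X_one, sub_self]
      · rw [coeff_sub, hFlt d h2 hd, coeff_X_of_ne_one (by omega), sub_self])
  have e3 := hcomm (k + e - 1) (by omega)
  rw [add_comm e k] at e1
  simp only [sub_comp, coeff_sub, comp_X, X_comp, hH' k, lt_irrefl, if_false, sub_zero,
    coeff_X_of_ne_one (show e ≠ 1 by omega)] at e1 e2
  have key : ((e : K) - k) * F.coeff e * H.coeff k =
      (H'.comp F).coeff (k + e - 1) - (F.comp H').coeff (k + e - 1) := by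
    linear_combination e1 - e2 - e3
  have hlift : ∀ {P : K[X]}, (∀ d, P.coeff d ∈ L) → ∃ P' : L[X], P'.map (algebraMap L K) = P :=
    fun {P} hP => (Polynomial.mem_lifts P).1 ((Polynomial.lifts_iff_coeff_lifts P).2 fun d =>
      ⟨⟨_, hP d⟩, rfl⟩)
  obtain ⟨F₀, hF₀⟩ := hlift hFL
  obtain ⟨H₀, hH₀⟩ := hlift (P := H') fun d => by
    rw [hH']
    split_ifs with h
    · exact ih d h
    · exact L.zero_mem
  have hR : (H'.comp F).coeff (k + e - 1) - (F.comp H').coeff (k + e - 1) ∈ L := by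
    rw [← hF₀, ← hH₀, ← map_comp, ← map_comp, coeff_map, coeff_map]
    exact L.sub_mem (SetLike.coe_mem _) (SetLike.coe_mem _)
  have : CharZero K := charZero_of_injective_algebraMap (algebraMap ℂ K).injective
  have hne : ((e : K) - k) ≠ 0 := sub_ne_zero.2 fun h => hke (Nat.cast_injective h).symm
  have hLe : ((e : K) - k) * F.coeff e ∈ L :=
    L.mul_mem (L.sub_mem (natCast_mem L e) (natCast_mem L k)) (hFL e)
  rw [eq_div_of_mul_eq (mul_ne_zero hne hFe) ((mul_comm _ _).trans key)]
  exact L.div_mem hR hLe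

end Substitution

/-! ### Unitriangular groups are nilpotent -/

section Unitriangular

variable {n : ℕ}

/-- The matrices whose entries vanish above the `k`-th lower diagonal. -/
def lowerDiagonals (n k : ℕ) : Submodule ℂ (Matrix (Fin n) (Fin n) ℂ) where
  carrier := {A | ∀ i j : Fin n, (i : ℕ) < j + k → A i j = 0}
  zero_mem' := fun _ _ _ => rfl
  add_mem' := fun hA hB i j h => by rw [Matrix.add_apply, hA i j h, hB i j h, add_zero]
  smul_mem' := fun c A hA i j h => by rw [Matrix.smul_apply, hA i j h, smul_zero]

theorem mul_mem_lowerDiagonals {k l : ℕ} {A B : Matrix (Fin n) (Fin n) ℂ}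
    (hA : A ∈ lowerDiagonals n k) (hB : B ∈ lowerDiagonals n l) :
    A * B ∈ lowerDiagonals n (k + l) := by
  intro i j h
  rw [Matrix.mul_apply]
  refine Finset.sum_eq_zero fun s _ => ?_
  rcases lt_or_ge (i : ℕ) (s + k) with h1 | h1
  · rw [hA i s h1, zero_mul]
  · rw [hB s j (by omega), mul_zero]

theorem lowerDiagonals_anti {k l : ℕ} (h : k ≤ l) : lowerDiagonals n l ≤ lowerDiagonals n k :=
  fun _ hA i j hij => hA i j (by omega)

theorem one_mem_lowerDiagonals : (1 : Matrix (Fin n) (Fin n) ℂ) ∈ lowerDiagonals n 0 :=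
  fun i j h => Matrix.one_apply_ne (by rintro rfl; omega)

/-- The elements `g` such that `g - 1` vanishes above the `(k + 1)`-st lower diagonal form a
descending central series, because of `[g, x] - 1 = ((g - 1) (x - 1) - (x - 1) (g - 1)) g⁻¹ x⁻¹`. -/
theorem isNilpotent_of_sub_one_mem_lowerDiagonals (S : Subgroup (GL (Fin n) ℂ))
    (hS : ∀ g ∈ S, (g : Matrix (Fin n) (Fin n) ℂ) - 1 ∈ lowerDiagonals n 1) :
    Group.IsNilpotent S := by
  have h0 : ∀ g ∈ S, (g : Matrix (Fin n) (Fin n) ℂ) ∈ lowerDiagonals n 0 := fun g hg => by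
    rw [← sub_add_cancel (g : Matrix (Fin n) (Fin n) ℂ) 1]
    exact (lowerDiagonals n 0).add_mem (lowerDiagonals_anti zero_le_one (hS g hg))
      one_mem_lowerDiagonals
  let H : ℕ → Subgroup S := fun k =>
    { carrier := {g | ((g : GL (Fin n) ℂ) : Matrix (Fin n) (Fin n) ℂ) - 1 ∈
        lowerDiagonals n (k + 1)}
      one_mem' := by
        simp only [Set.mem_ofPred_eq, OneMemClass.coe_one, Units.val_one, sub_self]
        exact zero_mem _
      mul_mem' := by
        intro a b ha hb
        have : ((a * b : S) : GL (Fin n) ℂ).val - 1 = a.1.val * (b.1.val - 1) + (a.1.val - 1) := by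
          rw [Subgroup.coe_mul, Units.val_mul]
          noncomm_ring
        change _ ∈ lowerDiagonals n (k + 1)
        rw [this]
        refine add_mem ?_ ha
        have := mul_mem_lowerDiagonals (h0 _ a.2) hb
        rwa [zero_add] at this
      inv_mem' := by
        intro a ha
        have : ((a⁻¹ : S) : GL (Fin n) ℂ).val - 1 = -((a⁻¹ : S).1.val * (a.1.val - 1)) := by
          have h : (a⁻¹ : S).1.val * a.1.val = 1 := by
            rw [Subgroup.coe_inv, Units.inv_mul]
          rw [mul_sub, h, mul_one, neg_sub]
        change _ ∈ lowerDiagonals n (k + 1)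
        rw [this]
        refine neg_mem ?_
        have := mul_mem_lowerDiagonals (h0 _ a⁻¹.2) ha
        rwa [zero_add] at this }
  refine (Subgroup.nilpotent_iff_finite_descending_central_series S).2 ⟨n, H, ⟨?_, ?_⟩, ?_⟩
  · rw [eq_top_iff]
    exact fun g _ => hS _ g.2
  · intro g k hg x
    have hmul : ((g * x * g⁻¹ * x⁻¹ : S) : GL (Fin n) ℂ).val - 1 =
        ((g.1.val - 1) * (x.1.val - 1) - (x.1.val - 1) * (g.1.val - 1)) *
          ((g⁻¹ : S).1.val * (x⁻¹ : S).1.val) := by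
      have e1 : (g.1.val - 1) * (x.1.val - 1) - (x.1.val - 1) * (g.1.val - 1) =
        g.1.val * x.1.val - x.1.val * g.1.val := by noncomm_ring
      have hx' : x.1.val * (x⁻¹ : S).1.val = 1 := by rw [Subgroup.coe_inv, Units.mul_inv]
      have hg' : g.1.val * (g⁻¹ : S).1.val = 1 := by rw [Subgroup.coe_inv, Units.mul_inv]
      rw [e1, sub_mul]
      have e2 : x.1.val * g.1.val * ((g⁻¹ : S).1.val * (x⁻¹ : S).1.val) = 1 := by
        rw [mul_assoc, ← mul_assoc g.1.val, hg', one_mul, hx']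
      rw [e2, Subgroup.coe_mul, Subgroup.coe_mul, Subgroup.coe_mul, Units.val_mul, Units.val_mul,
        Units.val_mul, mul_assoc (g.1.val * x.1.val)]
    change _ ∈ lowerDiagonals n (k + 1 + 1)
    rw [commutatorElement_def, hmul]
    have e3 : (g.1.val - 1) * (x.1.val - 1) - (x.1.val - 1) * (g.1.val - 1) ∈
        lowerDiagonals n (k + 1 + 1) := by
      refine sub_mem (mul_mem_lowerDiagonals hg (hS _ x.2)) ?_
      rw [add_comm]
      exact mul_mem_lowerDiagonals (hS _ x.2) hg
    have := mul_mem_lowerDiagonals e3 (mul_mem_lowerDiagonals (h0 _ g⁻¹.2) (h0 _ x⁻¹.2))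
    exact this
  · rw [Subgroup.eq_bot_iff_forall]
    intro g hg
    refine Subtype.ext (Units.ext (sub_eq_zero.1 ?_))
    ext i j
    exact hg i j (by omega)

end Unitriangular

namespace LinearAlgebraicGroup

open MvPolynomial Zariski TopologicalSpace Substitution

attribute [local instance] zariskiTopology

/-! ### The group of substitutions -/

section

variable (m : ℕ)

/-- The group of the substitutions `X ↦ X + a₂ X ^ 2 + ⋯ + a_{m + 1} X ^ (m + 1)` modulo
`X ^ (m + 2)`, as a matrix group. -/
noncomputable def substGroup : Subgroup (GL (Fin (m + 1)) ℂ) where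
  carrier := {g | ∃ F : Polynomial ℂ, F.coeff 0 = 0 ∧ F.coeff 1 = 1 ∧
    (g : Matrix (Fin (m + 1)) (Fin (m + 1)) ℂ) = substMatrix m F}
  one_mem' := ⟨Polynomial.X, Polynomial.coeff_X_zero, Polynomial.coeff_X_one, substMatrix_X.symm⟩
  mul_mem' := by
    rintro g h ⟨F, hF0, hF1, hF⟩ ⟨H, hH0, hH1, hH⟩
    exact ⟨H.comp F, coeff_comp_zero hH0 hF0, by rw [coeff_comp_one hH0 hF0, hF1, hH1, mul_one],
      by rw [Units.val_mul, hF, hH, substMatrix_mul hF0 hH0]⟩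
  inv_mem' := by
    rintro g ⟨F, hF0, hF1, hF⟩
    -- The coefficients of the inverse substitution form the first column of the inverse matrix.
    let A : Matrix (Fin (m + 1)) (Fin (m + 1)) ℂ := (g⁻¹ : GL (Fin (m + 1)) ℂ).val
    let H := columnPoly A
    have hH0 : H.coeff 0 = 0 := coeff_columnPoly_zero A
    have hgA : substMatrix m F * A = 1 := by rw [← hF]; exact g.mul_inv
    have hcomp : ∀ p : Fin (m + 1), (H.comp F).coeff (p + 1) =
        (1 : Matrix (Fin (m + 1)) (Fin (m + 1)) ℂ) p 0 := by
      intro p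
      rw [coeff_comp_of_coeff_zero hH0 hF0, ← hgA, Matrix.mul_apply]
      exact Finset.sum_congr rfl fun j _ => by rw [coeff_columnPoly_succ]
    have hX : substMatrix m (H.comp F) = 1 := by
      rw [← substMatrix_X]
      refine substMatrix_congr fun d hd => ?_
      rcases d with _ | d
      · rw [coeff_comp_zero hH0 hF0, Polynomial.coeff_X_zero]
      · have := hcomp ⟨d, by omega⟩
        rw [this, Polynomial.coeff_X, Matrix.one_apply]
        simp [Fin.ext_iff, eq_comm]
    refine ⟨H, hH0, ?_, ?_⟩
    · have h1 := coeff_comp_one hH0 hF0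
      rw [hF1, mul_one] at h1
      rw [← h1]
      simpa using hcomp 0
    · rw [← substMatrix_mul hF0 hH0] at hX
      exact (Matrix.inv_eq_right_inv hgA).symm.trans (Matrix.inv_eq_right_inv hX)

variable {m}

/-- The elements of the group are described by equations between the entries of a matrix. -/
theorem mem_substGroup_iff {g : GL (Fin (m + 1)) ℂ} : g ∈ substGroup m ↔
    (g : Matrix (Fin (m + 1)) (Fin (m + 1)) ℂ) 0 0 = 1 ∧
      (g : Matrix (Fin (m + 1)) (Fin (m + 1)) ℂ) =
        substMatrix m (columnPoly (g : Matrix (Fin (m + 1)) (Fin (m + 1)) ℂ)) := by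
  constructor
  · rintro ⟨F, hF0, hF1, hF⟩
    rw [hF, substMatrix_columnPoly_substMatrix hF0]
    exact ⟨by simpa [substMatrix_apply] using hF1, rfl⟩
  · rintro ⟨h1, h2⟩
    refine ⟨_, coeff_columnPoly_zero _, ?_, h2⟩
    rw [← h1]
    exact coeff_columnPoly_succ _ 0

theorem map_columnPoly_genericMatrix {n : ℕ} {K : Type} [CommRing K]
    (φ : MvPolynomial (CoordIndex (n + 1)) ℂ →+* K) :
    substMatrix n (columnPoly ((genericMatrix (n + 1)).map φ)) =
      (substMatrix n (columnPoly (genericMatrix (n + 1)))).map φ := by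
  rw [columnPoly_map, substMatrix_map]

theorem isClosed_image_substGroup :
    IsClosed (glCoords '' (substGroup m : Set (GL (Fin (m + 1)) ℂ))) := by
  have : glCoords '' (substGroup m : Set (GL (Fin (m + 1)) ℂ)) =
      ({x | eval x (MvPolynomial.X (Sum.inl (0, 0)) - 1) = 0} ∩
        {x | ∀ ij : Fin (m + 1) × Fin (m + 1), eval x (genericMatrix (m + 1) ij.1 ij.2 -
          substMatrix m (columnPoly (genericMatrix (m + 1))) ij.1 ij.2) = 0}) ∩
        {x | eval x (MvPolynomial.X (Sum.inr ()) - 1) = 0} := by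
    have key : ∀ x : CoordIndex (m + 1) → ℂ, ∀ A : Matrix (Fin (m + 1)) (Fin (m + 1)) ℂ,
        (genericMatrix (m + 1)).map (eval x) = A →
        ((∀ ij : Fin (m + 1) × Fin (m + 1), eval x (genericMatrix (m + 1) ij.1 ij.2 -
          substMatrix m (columnPoly (genericMatrix (m + 1))) ij.1 ij.2) = 0) ↔
            A = substMatrix m (columnPoly A)) := by
      rintro x _ rfl
      rw [map_columnPoly_genericMatrix, ← Matrix.ext_iff]
      simp [sub_eq_zero]
    ext x
    constructor
    · rintro ⟨g, hg, rfl⟩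
      obtain ⟨h1, h2⟩ := mem_substGroup_iff.1 hg
      refine ⟨⟨by simpa [glCoords, sub_eq_zero] using h1,
        (key _ _ (eval_genericMatrix g)).2 h2⟩, ?_⟩
      obtain ⟨F, hF0, hF1, hF⟩ := hg
      simp [glCoords, hF, det_substMatrix hF0 hF1]
    · rintro ⟨⟨h1, h2⟩, h3⟩
      let A : Matrix (Fin (m + 1)) (Fin (m + 1)) ℂ := Matrix.of fun i j => x (Sum.inl (i, j))
      have hA : (genericMatrix (m + 1)).map (eval x) = A := by
        ext i j
        simp [genericMatrix, A]
      have hA2 := (key x A hA).1 h2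
      have hA1 : A 0 0 = 1 := by simpa [sub_eq_zero, A] using h1
      have hdet : A.det = 1 := by
        rw [hA2]
        exact det_substMatrix (coeff_columnPoly_zero _) ((coeff_columnPoly_succ A 0).trans hA1)
      refine ⟨Matrix.GeneralLinearGroup.mkOfDetNeZero A (by rw [hdet]; exact one_ne_zero),
        mem_substGroup_iff.2 ⟨hA1, hA2⟩, ?_⟩
      have hx : x (Sum.inr ()) = 1 := by simpa [sub_eq_zero] using h3
      ext (⟨i, j⟩ | u)
      · rfl
      · have : A.det⁻¹ = x (Sum.inr u) := by rw [hdet, inv_one, hx]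
        exact this
  rw [this]
  exact ((isClosed_setOf_eval_eq_zero _).inter (isClosed_setOf_forall_eval_eq_zero _)).inter
    (isClosed_setOf_eval_eq_zero _)

variable (m) in
/-- The group of substitutions as a linear algebraic group. -/
noncomputable def substitutionGroup : LinearAlgebraicGroup where
  n := m + 1
  points := substGroup m
  isClosed := isClosed_image_substGroup

theorem isNilpotent_substitutionGroup : (substitutionGroup m).IsNilpotent := by
  refine isNilpotent_of_sub_one_mem_lowerDiagonals (substGroup m) ?_
  rintro g ⟨F, hF0, hF1, hF⟩ i j hij
  rw [hF, Matrix.sub_apply, substMatrix_apply]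
  rcases eq_or_ne i j with rfl | hne
  · rw [coeff_pow_self hF0, hF1, one_pow, Matrix.one_apply_eq, sub_self]
  · have : (i : ℕ) ≠ j := fun h => hne (Fin.ext h)
    rw [coeff_pow_eq_zero hF0 (by omega), Matrix.one_apply_ne hne, sub_zero]

variable (m) in
/-- The substitution with indeterminate coefficients. -/
noncomputable def genericSubst : Polynomial (MvPolynomial (Fin m) ℂ) :=
  Polynomial.X + ∑ i : Fin m, Polynomial.monomial (i + 2) (MvPolynomial.X i)

theorem coeff_genericSubst_zero : (genericSubst m).coeff 0 = 0 := by
  simp [genericSubst, Polynomial.coeff_monomial]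

theorem coeff_genericSubst_one : (genericSubst m).coeff 1 = 1 := by
  simp [genericSubst, Polynomial.coeff_monomial]

theorem coeff_genericSubst_add_two (i : Fin m) :
    (genericSubst m).coeff (i + 2) = MvPolynomial.X i := by
  simp [genericSubst, Polynomial.coeff_monomial, Fin.val_inj, Polynomial.coeff_X]

variable (m) in
/-- The coordinates of a substitution, as polynomials in its coefficients. -/
noncomputable def substPoly : CoordIndex (m + 1) → MvPolynomial (Fin m) ℂ :=
  Sum.elim (fun ij => substMatrix m (genericSubst m) ij.1 ij.2) fun _ => 1

/-- The variety of the group is the image of an affine space. -/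
theorem variety_substitutionGroup :
    glCoords '' (substGroup m : Set (GL (Fin (m + 1)) ℂ)) = polyMap (substPoly m) '' Set.univ := by
  have key : ∀ (c : Fin m → ℂ) (g : GL (Fin (m + 1)) ℂ),
      (g : Matrix (Fin (m + 1)) (Fin (m + 1)) ℂ) =
        substMatrix m ((genericSubst m).map (eval c)) → polyMap (substPoly m) c = glCoords g := by
    intro c g hg
    have hdet : (g : Matrix (Fin (m + 1)) (Fin (m + 1)) ℂ).det = 1 := by
      rw [hg]
      exact det_substMatrix (by rw [Polynomial.coeff_map, coeff_genericSubst_zero, map_zero])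
        (by rw [Polynomial.coeff_map, coeff_genericSubst_one, map_one])
    ext (⟨i, j⟩ | u)
    · have : glCoords g (Sum.inl (i, j)) = (g : Matrix (Fin (m + 1)) (Fin (m + 1)) ℂ) i j := rfl
      rw [this, hg, substMatrix_map]
      rfl
    · simp [polyMap, substPoly, glCoords, hdet]
  ext x
  constructor
  · rintro ⟨g, ⟨F, hF0, hF1, hF⟩, rfl⟩
    refine ⟨fun i => F.coeff (i + 2), Set.mem_univ _, key _ _ ?_⟩
    rw [hF]
    refine substMatrix_congr fun d hd => ?_
    rw [Polynomial.coeff_map]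
    rcases d with _ | _ | d
    · rw [coeff_genericSubst_zero, map_zero, hF0]
    · rw [coeff_genericSubst_one, map_one, hF1]
    · have := coeff_genericSubst_add_two (⟨d, by omega⟩ : Fin m)
      rw [this, eval_X]
  · rintro ⟨c, -, rfl⟩
    have h0 : ((genericSubst m).map (eval c)).coeff 0 = 0 := by
      rw [Polynomial.coeff_map, coeff_genericSubst_zero, map_zero]
    have h1 : ((genericSubst m).map (eval c)).coeff 1 = 1 := by
      rw [Polynomial.coeff_map, coeff_genericSubst_one, map_one]
    exact ⟨Matrix.GeneralLinearGroup.mkOfDetNeZero (substMatrix m ((genericSubst m).map (eval c)))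
      (by rw [det_substMatrix h0 h1]; exact one_ne_zero), ⟨_, h0, h1, rfl⟩, (key _ _ rfl).symm⟩

theorem isIrreducible_variety_substitutionGroup :
    _root_.IsIrreducible (substitutionGroup m).variety := by
  have : _root_.IsIrreducible (polyMap (substPoly m) '' Set.univ) := by
    refine _root_.IsIrreducible.image ?_ _ (continuous_polyMap _).continuousOn
    rw [isIrreducible_iff_forall]
    refine ⟨Set.univ_nonempty, fun p q h => ?_⟩
    have hpq : p * q = 0 := MvPolynomial.funext fun x => by
      rw [map_mul, map_zero]
      exact h x (Set.mem_univ x)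
    rcases mul_eq_zero.1 hpq with rfl | rfl
    · exact Or.inl fun x _ => map_zero _
    · exact Or.inr fun x _ => map_zero _
  rw [← variety_substitutionGroup] at this
  exact this

/-- The coefficients of the generic substitution are algebraically independent. -/
theorem le_dim_substitutionGroup : m ≤ (substitutionGroup m).dim := by
  let K := FractionRing (MvPolynomial (Fin m) ℂ)
  let ι : MvPolynomial (Fin m) ℂ →ₐ[ℂ] K := IsScalarTower.toAlgHom ℂ _ K
  have hι : Function.Injective ι := IsFractionRing.injective _ K
  have hind : AlgebraicIndependent ℂ fun i : Fin m => ι (MvPolynomial.X i) := by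
    have : aeval (fun i : Fin m => ι (MvPolynomial.X i)) = ι := by
      ext i
      simp only [aeval_X]
    rw [AlgebraicIndependent, this]
    exact hι
  have hcomp : ∀ p : MvPolynomial (CoordIndex (m + 1)) ℂ,
      aeval (fun i => ι (substPoly m i)) p = ι (aeval (substPoly m) p) := fun p => by
    rw [← AlgHom.comp_apply, MvPolynomial.comp_aeval]
  obtain ⟨T, hT, hTx⟩ := exists_finset_of_zariskiDim_le (isClosed_variety _)
    (zariskiDim_variety (substitutionGroup m)).le (K := K) (x := fun i => ι (substPoly m i))
    fun p hp => by
      have h1 : aeval (substPoly m) p = 0 := MvPolynomial.funext fun c => by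
        have h2 := hp (polyMap (substPoly m) c) (by
          have : polyMap (substPoly m) c ∈ polyMap (substPoly m) '' Set.univ :=
            ⟨c, Set.mem_univ c, rfl⟩
          rw [← variety_substitutionGroup] at this
          exact this)
        rw [map_zero, ← h2]
        exact (eval_polyMap _ _ _).symm
      exact (hcomp p).trans (by rw [h1, map_zero])
  have := card_le_of_algebraicIndependent hind T fun i => by
    have h1 := hTx ((Sum.inl (i.succ, 0) : CoordIndex (m + 1)))
    have h2 : substPoly m (Sum.inl (i.succ, 0)) = MvPolynomial.X i := by
      rw [← coeff_genericSubst_add_two]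
      simp [substPoly, substMatrix_apply, add_assoc]
    exact h2 ▸ h1
  rw [Fintype.card_fin] at this
  exact this.trans hT

/-- The commuting pairs of substitutions depend on at most `m + 2` parameters. -/
theorem commutingDim_substitutionGroup_le : (substitutionGroup m).commutingDim ≤ m + 2 := by
  classical
  refine commutingDim_le_of_forall_matrix _ fun K _ _ x y hx hy hxy => ?_
  -- The equations of the group hold over `K`.
  let A : Matrix (Fin (m + 1)) (Fin (m + 1)) (MvPolynomial (Fin (m + 1) × Fin (m + 1)) ℂ) :=
    Matrix.of fun i j => MvPolynomial.X (i, j)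
  have key : ∀ x : Matrix (Fin (m + 1)) (Fin (m + 1)) K,
      (∀ p : MvPolynomial (Fin (m + 1) × Fin (m + 1)) ℂ, (∀ g ∈ substGroup m,
        eval (fun ij => (g : Matrix (Fin (m + 1)) (Fin (m + 1)) ℂ) ij.1 ij.2) p = 0) →
        aeval (fun ij => x ij.1 ij.2) p = 0) →
      (columnPoly x).coeff 1 = 1 ∧ x = substMatrix m (columnPoly x) := by
    intro x hx
    constructor
    · have h1 := hx (MvPolynomial.X (0, 0) - 1) fun g hg => by
        rw [map_sub, eval_X, map_one, (mem_substGroup_iff.1 hg).1, sub_self]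
      rw [map_sub, aeval_X, map_one, sub_eq_zero] at h1
      exact (coeff_columnPoly_succ x 0).trans h1
    · have hAx : A.map (aeval (R := ℂ) fun ij : Fin (m + 1) × Fin (m + 1) => x ij.1 ij.2) = x := by
        ext i j
        simp [A]
      have h2 : ∀ i j, aeval (fun ij : Fin (m + 1) × Fin (m + 1) => x ij.1 ij.2)
          (A i j - substMatrix m (columnPoly A) i j) = 0 := fun i j => hx _ fun g hg => by
        have hAg : A.map (eval fun ij : Fin (m + 1) × Fin (m + 1) =>
            (g : Matrix (Fin (m + 1)) (Fin (m + 1)) ℂ) ij.1 ij.2) = g := by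
          ext i j
          simp [A]
        have h3 := congrFun (congrFun (mem_substGroup_iff.1 hg).2 i) j
        rw [← hAg, columnPoly_map, substMatrix_map] at h3
        rw [map_sub, sub_eq_zero]
        exact h3
      ext i j
      have h4 := h2 i j
      rw [map_sub, sub_eq_zero] at h4
      have h5 : substMatrix m (columnPoly x) = (substMatrix m (columnPoly A)).map
          (aeval (R := ℂ) fun ij : Fin (m + 1) × Fin (m + 1) => x ij.1 ij.2).toRingHom := by
        rw [← substMatrix_map, ← columnPoly_map]
        exact congrArg (fun B => substMatrix m (columnPoly B)) hAx.symm
      rw [h5]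
      refine Eq.trans ?_ h4
      exact (congrFun (congrFun hAx i) j).symm
  -- The parameters are the coefficients of `F` and those coefficients of `H` which are not
  -- determined by the commutation relation.
  have main : ∀ x y : Matrix (Fin (m + 1)) (Fin (m + 1)) K,
      (columnPoly x).coeff 1 = 1 → x = substMatrix m (columnPoly x) →
      (columnPoly y).coeff 1 = 1 → y = substMatrix m (columnPoly y) → x * y = y * x →
      ∃ T : Finset K, T.card ≤ m + 2 ∧
        (∀ i j, x i j ∈ IntermediateField.adjoin ℂ (T : Set K)) ∧
        ∀ i j, y i j ∈ IntermediateField.adjoin ℂ (T : Set K) := by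
    intro x y hF1 hx hH1 hy hxy
    set F := columnPoly x with hF
    set H := columnPoly y with hH
    have hF0 : F.coeff 0 = 0 := coeff_columnPoly_zero x
    have hH0 : H.coeff 0 = 0 := coeff_columnPoly_zero y
    have hcomm : ∀ d < m + 2, (H.comp F).coeff d = (F.comp H).coeff d := by
      intro d hd
      rcases d with _ | d
      · rw [coeff_comp_zero hH0 hF0, coeff_comp_zero hF0 hH0]
      · rw [hx, hy, substMatrix_mul hF0 hH0, substMatrix_mul hH0 hF0] at hxy
        simpa [substMatrix_apply] using congrFun (congrFun hxy ⟨d, by omega⟩) 0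
    have hentries : ∀ (L : IntermediateField ℂ K) (P : Polynomial K), (∀ d, P.coeff d ∈ L) →
        ∀ i j, substMatrix m P i j ∈ L := by
      intro L P hP i j
      obtain ⟨P', rfl⟩ := (Polynomial.mem_lifts (f := algebraMap L K) P).1
        ((Polynomial.lifts_iff_coeff_lifts P).2 fun d => ⟨⟨_, hP d⟩, rfl⟩)
      rw [substMatrix_map]
      exact (substMatrix m P' i j).2
    suffices h : ∃ T : Finset K, T.card ≤ m + 2 ∧
        (∀ d, F.coeff d ∈ IntermediateField.adjoin ℂ (T : Set K)) ∧
        ∀ d, H.coeff d ∈ IntermediateField.adjoin ℂ (T : Set K) by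
      obtain ⟨T, hT, hTF, hTH⟩ := h
      refine ⟨T, hT, ?_, ?_⟩
      · rw [hx]
        exact hentries _ _ hTF
      · rw [hy]
        exact hentries _ _ hTH
    have hmem : ∀ (T : Finset K) (P : Polynomial K), P.coeff 0 = 0 → P.coeff 1 = 1 →
        (∀ d, 2 ≤ d → P.coeff d = 0 ∨ P.coeff d ∈ T) →
        ∀ d, P.coeff d ∈ IntermediateField.adjoin ℂ (T : Set K) := by
      intro T P h0 h1 hP d
      rcases lt_or_ge d 2 with hd | hd
      · interval_cases d
        · rw [h0]; exact zero_mem _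
        · rw [h1]; exact one_mem _
      · rcases hP d hd with h | h
        · rw [h]; exact zero_mem _
        · exact IntermediateField.subset_adjoin _ _ (Finset.mem_coe.2 h)
    by_cases hall : ∀ d, 2 ≤ d → F.coeff d = 0
    · refine ⟨(Finset.Icc 2 (m + 1)).image H.coeff, ?_,
        hmem _ F hF0 hF1 fun d hd => Or.inl (hall d hd), hmem _ H hH0 hH1 fun d hd => ?_⟩
      · refine Finset.card_image_le.trans ?_
        rw [Nat.card_Icc]
        omega
      · rcases lt_or_ge d (m + 2) with h | h
        · exact Or.inr (Finset.mem_image_of_mem _ (Finset.mem_Icc.2 ⟨hd, by omega⟩))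
        · exact Or.inl (coeff_columnPoly_of_le y h)
    · have hex : ∃ d, 2 ≤ d ∧ F.coeff d ≠ 0 := by
        push Not at hall
        exact hall
      obtain ⟨he, hFe⟩ := Nat.find_spec hex
      have hFlt : ∀ d, 2 ≤ d → d < Nat.find hex → F.coeff d = 0 := fun d h2 hd =>
        not_not.1 fun hne => Nat.find_min hex hd ⟨h2, hne⟩
      generalize Nat.find hex = e at he hFe hFlt
      have hem : e < m + 2 := lt_of_not_ge fun h => hFe (coeff_columnPoly_of_le x h)
      let T₁ : Finset K := (Finset.Icc e (m + 1)).image F.coeff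
      let T₂ : Finset K := (Finset.Icc (m + 3 - e) (m + 1)).image H.coeff
      have hTF := hmem (insert (H.coeff e) (T₁ ∪ T₂)) F hF0 hF1 fun d hd => by
        rcases lt_or_ge d e with h | h
        · exact Or.inl (hFlt d hd h)
        rcases lt_or_ge d (m + 2) with h' | h'
        · exact Or.inr (Finset.mem_insert_of_mem (Finset.mem_union_left _
            (Finset.mem_image_of_mem _ (Finset.mem_Icc.2 ⟨h, by omega⟩))))
        · exact Or.inl (coeff_columnPoly_of_le x h')
      refine ⟨insert (H.coeff e) (T₁ ∪ T₂), ?_, hTF,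
        coeff_mem_of_comp_comm hF0 hF1 hH0 hH1 hcomm he hFe hFlt hTF ?_ fun d hd => ?_⟩
      · have h1 : T₁.card ≤ m + 2 - e := Finset.card_image_le.trans (by rw [Nat.card_Icc])
        have h2 : T₂.card ≤ e - 1 := Finset.card_image_le.trans (by rw [Nat.card_Icc]; omega)
        have h3 := Finset.card_union_le T₁ T₂
        have h4 := Finset.card_insert_le (H.coeff e) (T₁ ∪ T₂)
        omega
      · exact IntermediateField.subset_adjoin _ _ (Finset.mem_coe.2 (Finset.mem_insert_self _ _))
      · rcases lt_or_ge d (m + 2) with h | h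
        · exact IntermediateField.subset_adjoin _ _ (Finset.mem_coe.2 (Finset.mem_insert_of_mem
            (Finset.mem_union_right _ (Finset.mem_image_of_mem _
              (Finset.mem_Icc.2 ⟨by omega, by omega⟩)))))
        · rw [show H.coeff d = 0 from coeff_columnPoly_of_le y h]
          exact zero_mem _
  exact main x y (key x hx).1 (key x hx).2 (key y hy).1 (key y hy).2 hxy

end

end LinearAlgebraicGroup

namespace LinearAlgebraicGroup

/-! ### The values of the commuting probability -/

theorem commutingProbabilities_mono {P Q : LinearAlgebraicGroup → Prop} (h : ∀ G, P G → Q G) :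
    commutingProbabilities P ⊆ commutingProbabilities Q :=
  fun _ ⟨G, hG, hP, hx⟩ => ⟨G, hG, h G hP, hx⟩

theorem commutingProbabilities_subset (P : LinearAlgebraicGroup → Prop) :
    commutingProbabilities P ⊆ Set.range ((↑) : ℚ → ℝ) ∩ Set.Ioc (1 / 2) 1 := by
  rintro _ ⟨G, hG, -, rfl⟩
  exact G.commutingProbability_mem hG

/-- Here the groups `GL_k` are used. -/
theorem subset_commutingProbabilities_isReductive :
    Set.range ((↑) : ℚ → ℝ) ∩ Set.Ioc (1 / 2) 1 ⊆ commutingProbabilities IsReductive := by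
  refine (subset_commutingProbabilities (fun G => HasNoUnipotentNormalSubgroup G.points)
    hasNoUnipotentNormalSubgroup_trivial (fun G H hG hH => hG.map_blockGL hH)
    ⟨generalLinear 1, isIrreducible_variety_generalLinear 1,
      hasNoUnipotentNormalSubgroup_generalLinear 1, ?_⟩ fun ε hε => ?_).trans
    (commutingProbabilities_mono fun G hG => hG.isReductive)
  · rw [dim_generalLinear_one.1, dim_generalLinear_one.2]
  · obtain ⟨k, hk⟩ := exists_nat_gt (1 / ε)
    have hk' : 1 < k * ε := (div_lt_iff₀ hε).1 hk
    have hkpos : (0 : ℝ) < k := by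
      by_contra! h
      nlinarith
    have hd := sq_le_dim_generalLinear k
    have hc := commutingDim_generalLinear_le k
    have hdR : (k : ℝ) * k ≤ (generalLinear k).dim := by exact_mod_cast hd
    have hcR : ((generalLinear k).commutingDim : ℝ) ≤ k + k * k := by exact_mod_cast hc
    refine ⟨_, _, ?_, ⟨generalLinear k, isIrreducible_variety_generalLinear k,
      hasNoUnipotentNormalSubgroup_generalLinear k, rfl⟩, ?_⟩
    · have : (0 : ℝ) < (generalLinear k).dim := (by positivity : (0 : ℝ) < k * k).trans_le hdR
      exact_mod_cast this
    · nlinarith [mul_le_mul_of_nonneg_left hdR hε.le]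

/-- Here `GL_1` and the groups of substitutions are used. -/
theorem subset_commutingProbabilities_isNilpotent :
    Set.range ((↑) : ℚ → ℝ) ∩ Set.Ioc (1 / 2) 1 ⊆ commutingProbabilities IsNilpotent := by
  refine subset_commutingProbabilities IsNilpotent isNilpotent_trivial isNilpotent_prod
    ⟨generalLinear 1, isIrreducible_variety_generalLinear 1, isNilpotent_generalLinear_one, ?_⟩
    fun ε hε => ?_
  · rw [dim_generalLinear_one.1, dim_generalLinear_one.2]
  · obtain ⟨k, hk⟩ := exists_nat_gt (1 / ε)
    have hk' : 1 < k * ε := (div_lt_iff₀ hε).1 hk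
    have hkpos : (0 : ℝ) < k := by
      by_contra! h
      nlinarith
    have hd := le_dim_substitutionGroup (m := k)
    have hc := commutingDim_substitutionGroup_le (m := k)
    have hdR : (k : ℝ) ≤ (substitutionGroup k).dim := by exact_mod_cast hd
    have hcR : ((substitutionGroup k).commutingDim : ℝ) ≤ k + 2 := by exact_mod_cast hc
    refine ⟨_, _, ?_, ⟨substitutionGroup k, isIrreducible_variety_substitutionGroup,
      isNilpotent_substitutionGroup, rfl⟩, ?_⟩
    · exact_mod_cast hkpos.trans_le hdR
    · nlinarith [mul_le_mul_of_nonneg_left hdR hε.le]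

theorem IsNilpotent.isSolvable {G : LinearAlgebraicGroup} (h : G.IsNilpotent) : G.IsSolvable := by
  unfold IsNilpotent at h
  unfold IsSolvable
  infer_instance

end LinearAlgebraicGroup

/-! ### Limit points -/

theorem accPt_rat_inter_Ioc {a b α : ℝ} (hab : a < b) (hα : α ∈ Set.Icc a b) :
    AccPt α (𝓟 (Set.range ((↑) : ℚ → ℝ) ∩ Set.Ioc a b)) := by
  rw [accPt_iff_nhds]
  intro U hU
  obtain ⟨ε, hε, hεU⟩ := Metric.mem_nhds_iff.1 hU
  suffices h : ∃ q : ℚ, dist (q : ℝ) α < ε ∧ (q : ℝ) ∈ Set.Ioc a b ∧ (q : ℝ) ≠ α by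
    obtain ⟨q, h1, h2, h3⟩ := h
    exact ⟨q, ⟨hεU h1, ⟨q, rfl⟩, h2⟩, h3⟩
  rcases hα.1.eq_or_lt with rfl | hlt
  · obtain ⟨q, hq1, hq2⟩ := exists_rat_btwn (lt_min hab (lt_add_of_pos_right a hε))
    obtain ⟨hq2, hq3⟩ := lt_min_iff.1 hq2
    exact ⟨q, by rw [Real.dist_eq, abs_lt]; constructor <;> linarith, ⟨hq1, hq2.le⟩, hq1.ne'⟩
  · obtain ⟨q, hq1, hq2⟩ := exists_rat_btwn (max_lt hlt (sub_lt_self α hε))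
    obtain ⟨hq1, hq3⟩ := max_lt_iff.1 hq1
    exact ⟨q, by rw [Real.dist_eq, abs_lt]; constructor <;> linarith,
      ⟨hq1, hq2.le.trans hα.2⟩, hq2.ne⟩

theorem mainTheorem3 :
    (LinearAlgebraicGroup.commutingProbabilities LinearAlgebraicGroup.IsReductive
        = Set.range ((↑) : ℚ → ℝ) ∩ Set.Ioc (1 / 2) 1 ∧
      LinearAlgebraicGroup.commutingProbabilities LinearAlgebraicGroup.IsNilpotent
        = Set.range ((↑) : ℚ → ℝ) ∩ Set.Ioc (1 / 2) 1 ∧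
      LinearAlgebraicGroup.commutingProbabilities LinearAlgebraicGroup.IsSolvable
        = Set.range ((↑) : ℚ → ℝ) ∩ Set.Ioc (1 / 2) 1 ∧
      LinearAlgebraicGroup.commutingProbabilities (fun _ => True)
        = Set.range ((↑) : ℚ → ℝ) ∩ Set.Ioc (1 / 2) 1) ∧
    ∀ α ∈ Set.Icc (1 / 2 : ℝ) 1,
      AccPt α (𝓟 (LinearAlgebraicGroup.commutingProbabilities LinearAlgebraicGroup.IsReductive)) ∧
      AccPt α (𝓟 (LinearAlgebraicGroup.commutingProbabilities LinearAlgebraicGroup.IsNilpotent)) ∧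
      AccPt α (𝓟 (LinearAlgebraicGroup.commutingProbabilities LinearAlgebraicGroup.IsSolvable)) ∧
      AccPt α (𝓟 (LinearAlgebraicGroup.commutingProbabilities (fun _ => True))) := by

  have hR := Set.Subset.antisymm
    (LinearAlgebraicGroup.commutingProbabilities_subset LinearAlgebraicGroup.IsReductive)
    LinearAlgebraicGroup.subset_commutingProbabilities_isReductive
  have hN := Set.Subset.antisymm
    (LinearAlgebraicGroup.commutingProbabilities_subset LinearAlgebraicGroup.IsNilpotent)
    LinearAlgebraicGroup.subset_commutingProbabilities_isNilpotent
  have hS := Set.Subset.antisymm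
    (LinearAlgebraicGroup.commutingProbabilities_subset LinearAlgebraicGroup.IsSolvable)
    (hN.symm.subset.trans
      (LinearAlgebraicGroup.commutingProbabilities_mono fun _ h => h.isSolvable))
  have hT := Set.Subset.antisymm
    (LinearAlgebraicGroup.commutingProbabilities_subset fun _ => True)
    (hN.symm.subset.trans (LinearAlgebraicGroup.commutingProbabilities_mono fun _ _ => trivial))
  refine ⟨⟨hR, hN, hS, hT⟩, fun α hα => ?_⟩
  rw [hR, hN, hS, hT]
  have h := accPt_rat_inter_Ioc (by norm_num) hα
  exact ⟨h, h, h, h⟩
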